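/- **Setting.** Let $\alpha>0$ (path-loss exponent) and $\beta\ge 1$ (SINR threshold) be fixed. An instance consists of $n$ distinct nodes $V$ in an arbitrary metric space $(X,d)$, a link graph $G$ on $V$ (the node pairs that are available as links; any graph), and a noise level $N\ge 0$. A directed link $e=(s_e,r_e)$ has length $\ell_e=d(s_e,r_e)$. A set $S$ of directed links is *feasible* under powers $P$ if for every $v\in S$ we have $P_v>0$ and $$\frac{P_v/\ell_v^{\alpha}}{N+\sum_{u\in S\setminus\{v\}}P_u/d(s_u,r_v)^{\alpha}}\ \ge\ \beta ,$$ where interference at distance $0$ is infinite and a positive number over $0$ is $\infty$. A positive power assignment $P$ on the available links (in both directions) is *monotone* if $\ell_e\le\ell_f$ implies $P_e\le P_f$ and $P_f/\ell_f^{\alpha}\le P_e/\ell_e^{\alpha}$. A *dual* of $P$ is an assignment $P^*_e=\kappa\,\ell_e^{\alpha}/P_e$ with a scaling constant $\kappa>0$. In Connectivity Scheduling one seeks a spanning tree $T$ of $G$ and a coloring of its edges with as few colors (slots) as possible such that every color class is feasible. Algorithms run in time polynomial in $n$ on a real random access machine: unit-cost addition, truncated subtraction and comparison of natural numbers, indexed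 memory access, unit-cost field operations, comparison and $x\mapsto |x|^{\alpha}$ on reals, with natural numbers as the only constants. The input is $n$, the adjacency matrix of $G$, the distance matrix, $\beta$, $N$ and, for fixed powers, the powers of the links. **Theorem.** Connectivity Scheduling in the SINR model on arbitrary metric spaces, with an arbitrary link graph, has polynomial-time $O(\log n)$-approximations, where the implied constants depend only on $\alpha$ and $\beta$: 1. *Fixed monotone powers.* There are a constant $C$ and a polynomial-time algorithm such that the following holds for every instance and every monotone power assignment $P$. Let $\chi$ be the least number of slots in which the edges of some spanning tree of $G$, each directed in some way, can be scheduled in sets feasible under $P$. If $\chi$ exists, the algorithm outputs a spanning tree $T$ of $G$, a direction of each of its edges and a coloring of its edges with $k$ colors, such that each color class is feasible under $P$ in the chosen directions, and each color class with all directions reversed is feasible under one and the same dual of $P$; and $2k\le C\log n\cdot\chi$. (So all tree edges are scheduled in both directions in $2k=O(\log n)\cdot\chi$ slots.) 2. *Global power control.* There are a constant $C$ and a polynomial-time algorithm such that the following holds for every instance. Let $\chi$ be the least number of slots in which the edges of some spanning tree of $G$, each directed in some way, can be scheduled so that each slot is feasible under some powers, which may be chosen separately for each slot. If $\chi$ exists,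 the algorithm outputs a spanning tree $T$ of $G$ and a coloring of its edges with $k\le C\log n\cdot\chi$ colors, such that for every direction of the edges of $T$ each color class is feasible under some powers. If $\chi$ does not exist, the algorithms still halt within the same time bound. -/

import Mathlib

open scoped ENNReal

/-! ### The metric SINR model

A link is an ordered pair `(sender, receiver)` of nodes; `pos` places the nodes in a metric
space, and a power assignment is a function on links. -/

namespace SINR

variable {V X : Type*} [MetricSpace X]

/-- Length of a link. -/
noncomputable def len (pos : V → X) (e : V × V) : ℝ := dist (pos e.1) (pos e.2)

/-- Strength at the receiver of `v` of the signal sent by the sender of `u`. The value is `∞` if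
these two nodes coincide (and the power is positive). -/
noncomputable def received (α : ℝ) (pos : V → X) (P : V × V → ℝ) (u v : V × V) : ℝ≥0∞ :=
  ENNReal.ofReal (P u) / edist (pos u.1) (pos v.2) ^ α

/-- Signal to interference and noise ratio at link `v` when the links of `S` transmit
simultaneously. -/
noncomputable def sinr [DecidableEq V] (α N : ℝ) (pos : V → X) (P : V × V → ℝ)
    (S : Finset (V × V)) (v : V × V) : ℝ≥0∞ :=
  received α pos P v v / (ENNReal.ofReal N + ∑ u ∈ S.erase v, received α pos P u v)

/-- All links of `S` can transmit simultaneously with the powers `P`. -/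
def Feasible [DecidableEq V] (α β N : ℝ) (pos : V → X) (P : V × V → ℝ)
    (S : Finset (V × V)) : Prop :=
  ∀ v ∈ S, 0 < P v ∧ ENNReal.ofReal β ≤ sinr α N pos P S v

/-- `P` is a positive monotone power assignment for the links available in `G`: along
non-decreasing length, powers do not decrease and received signal strengths do not increase. -/
def IsMonotonePower (α : ℝ) (pos : V → X) (G : SimpleGraph V) (P : V × V → ℝ) : Prop :=
  (∀ e : V × V, G.Adj e.1 e.2 → 0 < P e) ∧
  ∀ e f : V × V, G.Adj e.1 e.2 → G.Adj f.1 f.2 → len pos e ≤ len pos f →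
    P e ≤ P f ∧ P f / len pos f ^ α ≤ P e / len pos e ^ α

/-- The dual of the power assignment `P`, with scaling factor `κ`. -/
noncomputable def dualPower (α κ : ℝ) (pos : V → X) (P : V × V → ℝ) : V × V → ℝ :=
  fun e => κ * len pos e ^ α / P e

end SINR

/-! ### Connectivity scheduling -/

namespace ConnSched

variable {V X : Type*} [MetricSpace X]

/-- `T` is a spanning tree of the link graph `G`, and `color` colors its edges with the colors
`0, …, k - 1`. -/
structure IsColoredSpanningTree (G T : SimpleGraph V) (color : Sym2 V → ℕ) (k : ℕ) : Prop where
  le : T ≤ G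
  isTree : T.IsTree
  color_lt : ∀ e ∈ T.edgeSet, color e < k

/-- `D` contains each edge of `T` in exactly one of its two directions, and nothing else. -/
def IsOrientation (T : SimpleGraph V) (D : Finset (V × V)) : Prop :=
  (∀ u v, (u, v) ∈ D → T.Adj u v) ∧ ∀ u v, T.Adj u v → ((u, v) ∈ D ↔ (v, u) ∉ D)

/-- The directed links of color `i`. -/
def slot (D : Finset (V × V)) (color : Sym2 V → ℕ) (i : ℕ) : Finset (V × V) :=
  D.filter fun e => color s(e.1, e.2) = i

/-- The links of `S` with their directions reversed. -/
def reversed [DecidableEq V] (S : Finset (V × V)) : Finset (V × V) := S.image Prod.swap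

/-- With the fixed powers `P`, the links of some spanning tree of `G`, each one directed in some
way, can be scheduled in `k` slots. -/
def FixedSchedulable [DecidableEq V] (α β N : ℝ) (pos : V → X) (G : SimpleGraph V)
    (P : V × V → ℝ) (k : ℕ) : Prop :=
  ∃ (T : SimpleGraph V) (color : Sym2 V → ℕ) (D : Finset (V × V)),
    IsColoredSpanningTree G T color k ∧ IsOrientation T D ∧
      ∀ i < k, SINR.Feasible α β N pos P (slot D color i)

/-- With power control, the links of some spanning tree of `G`, each one directed in some way,
can be scheduled in `k` slots; each slot may use powers of its own. -/
def GlobalSchedulable [DecidableEq V] (α β N : ℝ) (pos : V → X) (G : SimpleGraph V)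
    (k : ℕ) : Prop :=
  ∃ (T : SimpleGraph V) (color : Sym2 V → ℕ) (D : Finset (V × V)),
    IsColoredSpanningTree G T color k ∧ IsOrientation T D ∧
      ∀ i < k, ∃ P : V × V → ℝ, SINR.Feasible α β N pos P (slot D color i)

end ConnSched

/-! ### A real random access machine

Programs work on two-dimensional arrays (numbered by natural numbers) of natural numbers and of
real numbers. Unit-cost operations: addition and truncated subtraction of natural numbers, the
four field operations and `x ↦ |x| ^ α` on reals (`α` is the path-loss exponent), indexed reading
and writing, comparisons. The only constants are natural numbers, and real numbers influence
natural numbers and the flow of control only through comparisons. -/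

namespace RealRAM

structure Memory where
  nat : ℕ → ℕ → ℕ → ℕ
  real : ℕ → ℕ → ℕ → ℝ

inductive NatExpr where
  | lit (k : ℕ)
  | get (A : ℕ) (i j : NatExpr)
  | add (a b : NatExpr)
  | sub (a b : NatExpr)

inductive RealExpr where
  | lit (k : ℕ)
  | get (A : ℕ) (i j : NatExpr)
  | add (x y : RealExpr)
  | sub (x y : RealExpr)
  | mul (x y : RealExpr)
  | div (x y : RealExpr)
  | pow (x : RealExpr)

inductive Cond where
  | natLe (a b : NatExpr)
  | realLe (x y : RealExpr)
  | neg (b : Cond)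
  | conj (b c : Cond)

inductive Program where
  | skip
  | setNat (A : ℕ) (i j e : NatExpr)
  | setReal (A : ℕ) (i j : NatExpr) (e : RealExpr)
  | seq (p q : Program)
  | ite (b : Cond) (p q : Program)
  | loop (b : Cond) (p : Program)

def NatExpr.eval (σ : Memory) : NatExpr → ℕ
  | .lit k => k
  | .get A i j => σ.nat A (i.eval σ) (j.eval σ)
  | .add a b => a.eval σ + b.eval σ
  | .sub a b => a.eval σ - b.eval σ

def NatExpr.cost : NatExpr → ℕ
  | .lit _ => 1
  | .get _ i j => i.cost + j.cost + 1
  | .add a b => a.cost + b.cost + 1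
  | .sub a b => a.cost + b.cost + 1

noncomputable def RealExpr.eval (α : ℝ) (σ : Memory) : RealExpr → ℝ
  | .lit k => k
  | .get A i j => σ.real A (i.eval σ) (j.eval σ)
  | .add x y => x.eval α σ + y.eval α σ
  | .sub x y => x.eval α σ - y.eval α σ
  | .mul x y => x.eval α σ * y.eval α σ
  | .div x y => x.eval α σ / y.eval α σ
  | .pow x => |x.eval α σ| ^ α

def RealExpr.cost : RealExpr → ℕ
  | .lit _ => 1
  | .get _ i j => i.cost + j.cost + 1
  | .add x y => x.cost + y.cost + 1
  | .sub x y => x.cost + y.cost + 1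
  | .mul x y => x.cost + y.cost + 1
  | .div x y => x.cost + y.cost + 1
  | .pow x => x.cost + 1

def Cond.eval (α : ℝ) (σ : Memory) : Cond → Prop
  | .natLe a b => a.eval σ ≤ b.eval σ
  | .realLe x y => x.eval α σ ≤ y.eval α σ
  | .neg b => ¬ b.eval α σ
  | .conj b c => b.eval α σ ∧ c.eval α σ

def Cond.cost : Cond → ℕ
  | .natLe a b => a.cost + b.cost + 1
  | .realLe x y => x.cost + y.cost + 1
  | .neg b => b.cost + 1
  | .conj b c => b.cost + c.cost + 1

def Memory.writeNat (σ : Memory) (A i j a : ℕ) : Memory :=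
  { σ with nat := fun A' i' j' => if A' = A ∧ i' = i ∧ j' = j then a else σ.nat A' i' j' }

noncomputable def Memory.writeReal (σ : Memory) (A i j : ℕ) (x : ℝ) : Memory :=
  { σ with real := fun A' i' j' => if A' = A ∧ i' = i ∧ j' = j then x else σ.real A' i' j' }

/-- `Exec α p σ τ t`: the program `p`, started with memory `σ`, halts after `t` steps with
memory `τ`. -/
inductive Exec (α : ℝ) : Program → Memory → Memory → ℕ → Prop where
  | skip (σ : Memory) : Exec α .skip σ σ 1
  | setNat (A : ℕ) (i j e : NatExpr) (σ : Memory) :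
      Exec α (.setNat A i j e) σ (σ.writeNat A (i.eval σ) (j.eval σ) (e.eval σ))
        (i.cost + j.cost + e.cost + 1)
  | setReal (A : ℕ) (i j : NatExpr) (e : RealExpr) (σ : Memory) :
      Exec α (.setReal A i j e) σ (σ.writeReal A (i.eval σ) (j.eval σ) (e.eval α σ))
        (i.cost + j.cost + e.cost + 1)
  | seq {p q : Program} {σ σ' σ'' : Memory} {s t : ℕ} :
      Exec α p σ σ' s → Exec α q σ' σ'' t → Exec α (.seq p q) σ σ'' (s + t)
  | iteTrue {b : Cond} {p q : Program} {σ σ' : Memory} {t : ℕ} :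
      b.eval α σ → Exec α p σ σ' t → Exec α (.ite b p q) σ σ' (b.cost + t)
  | iteFalse {b : Cond} {p q : Program} {σ σ' : Memory} {t : ℕ} :
      ¬ b.eval α σ → Exec α q σ σ' t → Exec α (.ite b p q) σ σ' (b.cost + t)
  | loopDone {b : Cond} {p : Program} {σ : Memory} :
      ¬ b.eval α σ → Exec α (.loop b p) σ σ b.cost
  | loopStep {b : Cond} {p : Program} {σ σ' σ'' : Memory} {s t : ℕ} :
      b.eval α σ → Exec α p σ σ' s → Exec α (.loop b p) σ' σ'' t →
        Exec α (.loop b p) σ σ'' (b.cost + s + t)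

open Classical in
/-- Initial memory. Natural numbers: cell `(0, 0)` of array `0` holds the number of nodes, array
`1` the adjacency matrix of the link graph. Reals: array `0` holds the distance matrix, array `1`
the powers of the links, array `2` the SINR threshold and the noise. Everything else is `0`. -/
noncomputable def input {n : ℕ} {X : Type*} [MetricSpace X] (β N : ℝ) (pos : Fin n → X)
    (G : SimpleGraph (Fin n)) (P : Fin n × Fin n → ℝ) : Memory where
  nat A i j :=
    if A = 0 ∧ i = 0 ∧ j = 0 then n
    else if A = 1 ∧ ∃ (hi : i < n) (hj : j < n), G.Adj ⟨i, hi⟩ ⟨j, hj⟩ then 1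
    else 0
  real A i j :=
    if h : i < n ∧ j < n ∧ A = 0 then dist (pos ⟨i, h.1⟩) (pos ⟨j, h.2.1⟩)
    else if h : i < n ∧ j < n ∧ A = 1 then P (⟨i, h.1⟩, ⟨j, h.2.1⟩)
    else if A = 2 ∧ i = 0 ∧ j = 0 then β
    else if A = 2 ∧ i = 0 ∧ j = 1 then N
    else 0

/-- The memory holds the tree `T` (adjacency matrix in array `2`), its coloring (array `3`) and
the number `k` of colors (cell `(0, 0)` of array `5`). -/
def OutputsTree {n : ℕ} (τ : Memory) (T : SimpleGraph (Fin n)) (color : Sym2 (Fin n) → ℕ)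
    (k : ℕ) : Prop :=
  (∀ u v : Fin n, T.Adj u v ↔ τ.nat 2 u v = 1) ∧
  (∀ u v : Fin n, T.Adj u v → τ.nat 3 u v = color s(u, v)) ∧
  τ.nat 5 0 0 = k

/-- The memory holds the set `D` of directed links (array `4`). -/
def OutputsLinks {n : ℕ} (τ : Memory) (D : Finset (Fin n × Fin n)) : Prop :=
  ∀ u v : Fin n, (u, v) ∈ D ↔ τ.nat 4 u v = 1

end RealRAM

/-!
Both algorithms work in rounds. A round successively adds shortest links which join different
components and whose conflict with the links added before is small, until there are none left, and
keeps those whose total conflict has stayed small in the end. Each conflict is charged to both of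
its links, so that the average is at most twice the bound for acceptance, and at least half of the
links are kept.

Take a schedule with `χ` slots. If there are `m` components, one of the slots contains
`(m - 1) / χ` links which form a forest over the components. They contain a constant fraction such
that the conflicts of any link with the longer links of the fraction add up to `O(1)`. The greedy
choice has joined the ends of such a link or rejected it because of conflicts with links that are
not longer, and the latter can happen to `O(1)` links only for each link that was added. Hence the
round keeps at least a multiple of `(m - 1) / χ` links, and `O(χ log n)` rounds connect all nodes.

For fixed powers the conflict of two links is the sum of their affectances on each other; passing to
the dual powers with reversed links interchanges the two, so that a small conflict takes care of
both. For power control the conflict depends on the distances between the ends of the two links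
only, and not on their directions; powers are assigned from the longest link down to the shortest.
-/

/-! ### Components of a set of links -/

namespace ConnSched

open Finset

variable {V : Type*}

/-- The undirected graph whose edges are the links of `E`. Links from a node to itself are
dropped. -/
def linkGraph (E : Finset (V × V)) : SimpleGraph V := SimpleGraph.fromRel fun u v => (u, v) ∈ E

/-- The nodes `x` and `y` lie in the same component of the links of `E`. -/
def Joined (E : Finset (V × V)) (x y : V) : Prop := (linkGraph E).Reachable x y

/-- Equality of the labels `L` describes the components of the links of `E`. This is how the
program represents components. -/
def IsLabel {ι : Type*} (E : Finset (V × V)) (L : V → ι) : Prop := ∀ x y, L x = L y ↔ Joined E x y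

/-- The number of components of the links of `E`. -/
noncomputable def numComp (E : Finset (V × V)) : ℕ := Nat.card (linkGraph E).ConnectedComponent

/-- The links of `O` form a forest over the components of `F`: each of them reduces the number of
components. In the language of matroids, `O` is independent in the cycle matroid contracted
by `F`. -/
def IsForestOver [DecidableEq V] (F O : Finset (V × V)) : Prop := numComp (F ∪ O) + #O = numComp F

section Joined

variable {E E' : Finset (V × V)} {x y : V}

lemma linkGraph_adj : (linkGraph E).Adj x y ↔ x ≠ y ∧ ((x, y) ∈ E ∨ (y, x) ∈ E) := by
  simp [linkGraph, SimpleGraph.fromRel_adj]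

lemma joined_of_mem {e : V × V} (h : e ∈ E) : Joined E e.1 e.2 := by
  by_cases hne : e.1 = e.2
  · exact hne ▸ SimpleGraph.Reachable.rfl
  · exact (linkGraph_adj.2 ⟨hne, Or.inl h⟩).reachable

lemma Joined.eq_of_forall_mem {ι : Type*} {f : V → ι} (hf : ∀ e ∈ E, f e.1 = f e.2)
    (h : Joined E x y) : f x = f y := by
  obtain ⟨p⟩ := h
  induction p with
  | nil => rfl
  | cons hadj _ ih =>
    rcases (linkGraph_adj.1 hadj).2 with h | h
    · exact (hf _ h).trans ih
    · exact (hf _ h).symm.trans ih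

lemma isLabel_connectedComponentMk (E : Finset (V × V)) :
    IsLabel E (linkGraph E).connectedComponentMk :=
  fun _ _ => SimpleGraph.ConnectedComponent.eq

lemma Joined.of_forall_mem (hE : ∀ e ∈ E, Joined E' e.1 e.2) (h : Joined E x y) : Joined E' x y :=
  (isLabel_connectedComponentMk E' x y).1 <|
    h.eq_of_forall_mem fun e he => (isLabel_connectedComponentMk E' _ _).2 (hE e he)

lemma Joined.mono (hE : E ⊆ E') (h : Joined E x y) : Joined E' x y :=
  h.of_forall_mem fun _ he => joined_of_mem (hE he)

lemma joined_empty : Joined ∅ x y ↔ x = y :=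
  ⟨fun h => h.eq_of_forall_mem (f := id) (by simp), fun h => h ▸ SimpleGraph.Reachable.rfl⟩

lemma IsLabel.insert [DecidableEq V] {ι : Type*} [DecidableEq ι] {L : V → ι} (hL : IsLabel E L)
    (e : V × V) : IsLabel (insert e E) fun x => if L x = L e.2 then L e.1 else L x := by
  have joined_of_eq {x y} (h : L x = L y) : Joined (Insert.insert e E) x y :=
    ((hL x y).1 h).mono (subset_insert e E)
  have he : Joined (Insert.insert e E) e.1 e.2 := joined_of_mem (mem_insert_self e E)
  intro x y
  constructor
  · intro h
    by_cases hx : L x = L e.2 <;> by_cases hy : L y = L e.2 <;>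
      simp only [hx, hy, if_true, if_false] at h
    · exact joined_of_eq (hx.trans hy.symm)
    · exact (joined_of_eq hx).trans (he.symm.trans (joined_of_eq h))
    · exact (joined_of_eq h).trans (he.trans (joined_of_eq hy).symm)
    · exact joined_of_eq h
  · refine Joined.eq_of_forall_mem (f := fun x => if L x = L e.2 then L e.1 else L x) fun f hf => ?_
    rcases mem_insert.1 hf with rfl | hf
    · simp
    · simp only [(hL _ _).2 (joined_of_mem hf)]

end Joined

section NumComp

lemma IsLabel.numComp_eq {ι : Type*} {E : Finset (V × V)} {L : V → ι} (hL : IsLabel E L) :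
    numComp E = (Set.range L).ncard := by
  let g : (linkGraph E).ConnectedComponent → ι :=
    SimpleGraph.ConnectedComponent.lift L fun v w p _ => (hL v w).2 ⟨p⟩
  have hg : Function.Injective g := SimpleGraph.ConnectedComponent.ind₂ fun v w h =>
    SimpleGraph.ConnectedComponent.eq.2 ((hL v w).1 h)
  have hrange : Set.range g = Set.range L := by
    ext m
    exact SimpleGraph.ConnectedComponent.exists
  rw [numComp, ← Nat.card_range_of_injective hg, hrange, Nat.card_coe_set_eq]

lemma numComp_empty : numComp (∅ : Finset (V × V)) = Nat.card V := by
  have hid : IsLabel (∅ : Finset (V × V)) id := fun _ _ => joined_empty.symm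
  rw [hid.numComp_eq, Set.range_id, Set.ncard_univ]

variable [Finite V]

lemma numComp_le_of_forall_mem {E E' : Finset (V × V)} (hE : ∀ e ∈ E, Joined E' e.1 e.2) :
    numComp E' ≤ numComp E := by
  refine Nat.card_le_card_of_surjective
    (SimpleGraph.ConnectedComponent.lift (linkGraph E').connectedComponentMk
      fun v w p _ => SimpleGraph.ConnectedComponent.eq.2 (Joined.of_forall_mem hE ⟨p⟩)) ?_
  exact SimpleGraph.ConnectedComponent.ind fun v => ⟨(linkGraph E).connectedComponentMk v, rfl⟩

lemma one_le_numComp [Nonempty V] (E : Finset (V × V)) : 1 ≤ numComp E := Nat.card_pos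

lemma numComp_le_one_iff {E : Finset (V × V)} : numComp E ≤ 1 ↔ ∀ x y, Joined E x y :=
  Finite.card_le_one_iff_subsingleton.trans
    ⟨fun _ _ _ => SimpleGraph.ConnectedComponent.eq.1 (Subsingleton.elim _ _),
      fun h => SimpleGraph.Preconnected.subsingleton_connectedComponent h⟩

variable [DecidableEq V]

lemma numComp_insert_of_not_joined {E : Finset (V × V)} {e : V × V}
    (h : ¬ Joined E e.1 e.2) : numComp (insert e E) + 1 = numComp E := by
  classical
  let L := (linkGraph E).connectedComponentMk
  have hL : IsLabel E L := isLabel_connectedComponentMk E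
  have hne : L e.1 ≠ L e.2 := fun h' => h ((hL _ _).1 h')
  have hrange : Set.range (fun x => if L x = L e.2 then L e.1 else L x) =
      Set.range L \ {L e.2} := by
    ext m
    constructor
    · rintro ⟨x, rfl⟩
      dsimp only
      split_ifs with hx
      exacts [⟨⟨e.1, rfl⟩, hne⟩, ⟨⟨x, rfl⟩, hx⟩]
    · rintro ⟨⟨x, rfl⟩, hx⟩
      exact ⟨x, if_neg hx⟩
  rw [(hL.insert e).numComp_eq, hL.numComp_eq, hrange,
    Set.ncard_sdiff_singleton_add_one (Set.mem_range_self e.2) (Set.toFinite _)]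

lemma numComp_insert_of_joined {E : Finset (V × V)} {e : V × V}
    (h : Joined E e.1 e.2) : numComp (insert e E) = numComp E := by
  refine le_antisymm (numComp_le_of_forall_mem fun f hf => joined_of_mem (mem_insert_of_mem hf))
    (numComp_le_of_forall_mem fun f hf => ?_)
  rcases mem_insert.1 hf with rfl | hf
  exacts [h, joined_of_mem hf]

lemma numComp_le_numComp_insert_add_one (E : Finset (V × V)) (e : V × V) :
    numComp E ≤ numComp (insert e E) + 1 := by
  by_cases h : Joined E e.1 e.2
  · exact (numComp_insert_of_joined h).ge.trans (Nat.le_succ _)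
  · exact (numComp_insert_of_not_joined h).ge

lemma numComp_le_numComp_union_add_card (E B : Finset (V × V)) :
    numComp E ≤ numComp (E ∪ B) + #B := by
  induction B using Finset.induction_on with
  | empty => simp
  | insert e B he ih =>
    rw [union_insert, card_insert_of_notMem he]
    have := numComp_le_numComp_insert_add_one (E ∪ B) e
    omega

end NumComp

section IsForestOver

variable [DecidableEq V]

lemma isForestOver_empty (F : Finset (V × V)) : IsForestOver F ∅ := by simp [IsForestOver]

variable [Finite V] {F O O' : Finset (V × V)}

lemma IsForestOver.subset (hO : IsForestOver F O) (h : O' ⊆ O) : IsForestOver F O' := by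
  have h1 := numComp_le_numComp_union_add_card F O'
  have h2 := numComp_le_numComp_union_add_card (F ∪ O') (O \ O')
  rw [union_assoc, union_sdiff_of_subset h, card_sdiff_of_subset h] at h2
  have := card_le_card h
  unfold IsForestOver at *
  omega

lemma IsForestOver.insert (hO : IsForestOver F O) {e : V × V} (he : ¬ Joined (F ∪ O) e.1 e.2) :
    IsForestOver F (insert e O) := by
  have heO : e ∉ O := fun h => he (joined_of_mem (mem_union_right _ h))
  have := numComp_insert_of_not_joined he
  unfold IsForestOver at *
  rw [union_insert, card_insert_of_notMem heO]
  omega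

lemma IsForestOver.union {E : Finset (V × V)} (hO : IsForestOver F O)
    (hE : IsForestOver (F ∪ O) E) : IsForestOver F (O ∪ E) := by
  have h1 := numComp_le_numComp_union_add_card F (O ∪ E)
  have h2 := card_union_le O E
  unfold IsForestOver at *
  rw [← union_assoc] at *
  omega

lemma IsForestOver.card_le_of_joined {G : Finset (V × V)} (hO : IsForestOver F O)
    (hG : IsForestOver F G) (h : ∀ e ∈ O, Joined (F ∪ G) e.1 e.2) : #O ≤ #G := by
  have : numComp (F ∪ G) ≤ numComp (F ∪ O) := numComp_le_of_forall_mem fun e he =>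
    (mem_union.1 he).elim (fun he => joined_of_mem (mem_union_left _ he)) (h e)
  unfold IsForestOver at *
  omega

lemma IsForestOver.card_lt [Nonempty V] (hO : IsForestOver F O) : #O < Nat.card V := by
  have hF : numComp F ≤ Nat.card V :=
    numComp_empty (V := V) ▸ numComp_le_of_forall_mem (by simp)
  have := one_le_numComp (F ∪ O)
  unfold IsForestOver at hO
  omega

lemma IsForestOver.not_joined_erase (hO : IsForestOver F O) {e : V × V} (he : e ∈ O) :
    ¬ Joined (F ∪ O.erase e) e.1 e.2 := by
  intro hj
  have h1 := numComp_insert_of_joined hj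
  have h2 := hO.subset (erase_subset e O)
  have := card_pos.2 ⟨e, he⟩
  rw [← union_insert, insert_erase he] at h1
  unfold IsForestOver at *
  rw [card_erase_of_mem he] at h2
  omega

lemma exists_isForestOver_subset (F A : Finset (V × V)) :
    ∃ O ⊆ A, IsForestOver F O ∧ ∀ e ∈ A, Joined (F ∪ O) e.1 e.2 := by
  induction A using Finset.induction_on with
  | empty => exact ⟨∅, Subset.rfl, isForestOver_empty F, by simp⟩
  | insert e A _ ih =>
    obtain ⟨O, hOA, hO, hj⟩ := ih
    by_cases h : Joined (F ∪ O) e.1 e.2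
    · exact ⟨O, hOA.trans (subset_insert _ _), hO, forall_mem_insert _ _ _ |>.2 ⟨h, hj⟩⟩
    · refine ⟨insert e O, insert_subset_insert _ hOA, hO.insert h, forall_mem_insert _ _ _ |>.2
        ⟨joined_of_mem (by simp), fun f hf => ?_⟩⟩
      exact (hj f hf).mono (union_subset_union_right (subset_insert _ _))

/-- Joining a spanning forest of each `A i` to `F` connects everything, so that these forests have
at least `numComp F - 1` links altogether; a largest one has at least an average share. -/
lemma exists_large_isForestOver {χ : ℕ} {A : ℕ → Finset (V × V)}
    (hA : ∀ x y, Joined ((range χ).biUnion A) x y) (hF : 2 ≤ numComp F) :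
    ∃ i < χ, ∃ O ⊆ A i, IsForestOver F O ∧ numComp F - 1 ≤ χ * #O := by
  choose O hOA hO hj using fun i => exists_isForestOver_subset F (A i)
  have hconn : numComp (F ∪ (range χ).biUnion O) ≤ 1 := by
    refine numComp_le_one_iff.2 fun x y => (hA x y).of_forall_mem fun e he => ?_
    obtain ⟨i, hi, he⟩ := mem_biUnion.1 he
    exact (hj i e he).mono (union_subset_union_right (subset_biUnion_of_mem O hi))
  have hsum : numComp F - 1 ≤ ∑ i ∈ range χ, #(O i) := by
    have h1 := numComp_le_numComp_union_add_card F ((range χ).biUnion O)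
    have h2 : #((range χ).biUnion O) ≤ ∑ i ∈ range χ, #(O i) := card_biUnion_le
    omega
  have hχ : (range χ).Nonempty := by
    rw [nonempty_iff_ne_empty]
    intro h
    rw [h, sum_empty] at hsum
    omega
  obtain ⟨i, hi, hmax⟩ := exists_max_image (range χ) (fun i => #(O i)) hχ
  refine ⟨i, mem_range.1 hi, O i, hOA i, hO i, hsum.trans ?_⟩
  simpa using sum_le_card_nsmul (range χ) (fun i => #(O i)) _ hmax

lemma linkGraph_isTree [Nonempty V] {E : Finset (V × V)} (hc : numComp E ≤ 1)
    (hE : IsForestOver ∅ E) : (linkGraph E).IsTree := by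
  have hconn : (linkGraph E).Connected :=
    (SimpleGraph.connected_iff _).2 ⟨numComp_le_one_iff.1 hc, inferInstance⟩
  refine SimpleGraph.isTree_iff_connected_and_card.2 ⟨hconn, ?_⟩
  have hedges : Nat.card (linkGraph E).edgeSet ≤ #E := by
    have hsub : (linkGraph E).edgeSet ⊆ (E.image fun e => s(e.1, e.2) : Finset (Sym2 V)) := by
      refine Sym2.ind fun x y h => ?_
      rw [SimpleGraph.mem_edgeSet, linkGraph_adj] at h
      rw [mem_coe, mem_image]
      exact h.2.elim (fun h => ⟨_, h, rfl⟩) fun h => ⟨_, h, Sym2.eq_swap⟩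
    rw [Nat.card_coe_set_eq]
    exact (Set.ncard_le_ncard hsub).trans ((Set.ncard_coe_finset _).trans_le card_image_le)
  have h1 := hconn.card_vert_le_card_edgeSet_add_one
  have h2 := one_le_numComp E
  rw [IsForestOver, empty_union, numComp_empty] at hE
  omega

lemma linkGraph_isOrientation {E : Finset (V × V)} (hE : IsForestOver ∅ E) :
    IsOrientation (linkGraph E) E := by
  have hne {u v : V} (h : (u, v) ∈ E) : u ≠ v := by
    rintro rfl
    exact hE.not_joined_erase h .rfl
  refine ⟨fun u v h => linkGraph_adj.2 ⟨hne h, Or.inl h⟩, fun u v h => ?_⟩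
  obtain ⟨huv, hmem⟩ := linkGraph_adj.1 h
  refine ⟨fun h1 h2 => hE.not_joined_erase h1 ?_, hmem.resolve_right⟩
  have h2' : (v, u) ∈ ∅ ∪ E.erase (u, v) := by simp [h2, huv.symm]
  exact (joined_of_mem h2').symm

end IsForestOver

end ConnSched

/-! ### Greedy selection of links -/

namespace ConnSched

open Finset

lemma natCast_le_mul_log_of_decay {a : ℕ → ℝ} {b : ℝ} {m : ℕ} (hb : 0 < b)
    (ha : ∀ r ≤ m, 1 ≤ a r) (hdecay : ∀ r < m, a r ≤ b * (a r - a (r + 1))) :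
    (m : ℝ) ≤ b * Real.log (a 0) := by
  suffices h : ∀ r ≤ m, (r : ℝ) ≤ b * (Real.log (a 0) - Real.log (a r)) by
    have hm := h m le_rfl
    have := mul_nonneg hb.le (Real.log_nonneg (ha m le_rfl))
    linarith
  intro r hr
  induction r with
  | zero => simp
  | succ r ih =>
    have har : 0 < a r := one_pos.trans_le (ha r (by omega))
    have har' : 0 < a (r + 1) := one_pos.trans_le (ha (r + 1) hr)
    have hlog : Real.log (a (r + 1)) - Real.log (a r) ≤ a (r + 1) / a r - 1 := by
      rw [← Real.log_div har'.ne' har.ne']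
      exact Real.log_le_sub_one_of_pos (div_pos har' har)
    have hratio : b * (a (r + 1) / a r - 1) ≤ -1 := by
      rw [div_sub_one har.ne', mul_div_assoc', div_le_iff₀ har]
      linarith [hdecay r (by omega)]
    have := mul_le_mul_of_nonneg_left hlog hb.le
    push_cast
    linarith [ih (by omega)]

/-- The data which govern the greedy selection: the links that may be used at all, their lengths,
a weight measuring the conflict between two links, and the reciprocal of the threshold for the
total weight. The reciprocal is a natural number because it occurs as a constant in the program. -/
structure Rule (V : Type*) where
  Usable : V × V → Prop
  len : V × V → ℝ
  conflict : V × V → V × V → ℝ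
  K : ℕ

namespace Rule

variable {V : Type*} [DecidableEq V] (R : Rule V)

/-- Total weight of the conflicts of `v` with the other links of `G`. -/
def load (G : Finset (V × V)) (v : V × V) : ℝ := ∑ u ∈ G.erase v, R.conflict u v

/-- Having selected the links `F` in earlier rounds and `G` in the current one, `v` may be added. -/
def Acceptable (F G : Finset (V × V)) (v : V × V) : Prop :=
  R.Usable v ∧ ¬ Joined (F ∪ G) v.1 v.2 ∧ R.K * R.load G v ≤ 1

/-- `G` arises by successively adding shortest acceptable links. -/
inductive Greedy (F : Finset (V × V)) : Finset (V × V) → Prop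
  | empty : Greedy F ∅
  | step {G : Finset (V × V)} {w : V × V} : Greedy F G → R.Acceptable F G w →
      (∀ v, R.Acceptable F G v → R.len w ≤ R.len v) → Greedy F (insert w G)

open Classical in
/-- The links of a greedy set whose load is small. A link is accepted when its load is at most
`1 / K`, but later links add to it; the links whose load has grown beyond `4 / K` are dropped. -/
noncomputable def light (G : Finset (V × V)) : Finset (V × V) :=
  {v ∈ G | R.K * R.load G v ≤ 4}

/-- `X` is the result of a round which starts with the links `F`: the light links of a maximal
greedy set. -/
def IsRound (F X : Finset (V × V)) : Prop :=
  ∃ G, R.Greedy F G ∧ (∀ v, ¬ R.Acceptable F G v) ∧ X = R.light G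

/-- The links selected in the first `r` rounds. -/
def selected (Xs : ℕ → Finset (V × V)) (r : ℕ) : Finset (V × V) := (range r).biUnion Xs

/-- `Xs 0, …, Xs (r - 1)` are the results of consecutive rounds. -/
def IsTrace (Xs : ℕ → Finset (V × V)) (r : ℕ) : Prop :=
  ∀ q < r, R.IsRound (selected Xs q) (Xs q)

/-- The assumptions on a rule under which the greedy selection is analysed. -/
structure Valid : Prop where
  conflict_nonneg : ∀ u v, R.Usable u → R.Usable v → 0 ≤ R.conflict u v
  conflict_comm : ∀ u v, R.conflict u v = R.conflict v u

/-- The nodes can be connected by `χ` sets of links each subset of which contains a large part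
where the links of at least the length of any usable link `w` have a bounded conflict with `w`.
An optimal schedule provides such sets. -/
def Coverable (C : ℝ) (χ : ℕ) : Prop :=
  ∃ A : ℕ → Finset (V × V), (∀ x y, Joined ((range χ).biUnion A) x y) ∧
    ∀ i < χ, ∀ O ⊆ A i, ∃ O' ⊆ O, #O ≤ 2 * #O' ∧ (∀ v ∈ O', R.Usable v) ∧
      ∀ w, R.Usable w → ∑ v ∈ O' with R.len w ≤ R.len v, R.conflict w v ≤ C

variable {R} {F G X : Finset (V × V)} {Xs : ℕ → Finset (V × V)} {r : ℕ}

lemma Acceptable.notMem {v : V × V} (h : R.Acceptable F G v) : v ∉ G :=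
  fun hv => h.2.1 (joined_of_mem (mem_union_right _ hv))

lemma load_insert_self {w : V × V} (hw : w ∉ G) : R.load (insert w G) w = R.load G w := by
  rw [load, erase_insert hw, load, erase_eq_of_notMem hw]

lemma load_insert_of_ne {v w : V × V} (hw : w ∉ G) (hne : w ≠ v) :
    R.load (insert w G) v = R.load G v + R.conflict w v := by
  rw [load, erase_insert_of_ne hne, sum_insert fun h => hw (mem_of_mem_erase h), add_comm, load]

lemma Greedy.usable (h : R.Greedy F G) : ∀ v ∈ G, R.Usable v := by
  induction h with
  | empty => simp
  | step _ hw _ ih => exact forall_mem_insert _ _ _ |>.2 ⟨hw.1, ih⟩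

lemma light_subset (G : Finset (V × V)) : R.light G ⊆ G := filter_subset _ _

/-- When `w` is added, it contributes its load, which is at most `1 / K`, once to itself and once
to the links that are already there. -/
lemma Greedy.sum_load_le (hR : R.Valid) (h : R.Greedy F G) :
    R.K * ∑ v ∈ G, R.load G v ≤ 2 * #G := by
  induction h with
  | empty => simp
  | @step G w _ hw _ ih =>
    have hwG := hw.notMem
    have hsum : ∑ v ∈ G, R.load (insert w G) v = ∑ v ∈ G, R.load G v + R.load G w := by
      rw [load, erase_eq_of_notMem hwG, ← sum_add_distrib]
      exact sum_congr rfl fun v hv => by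
        rw [load_insert_of_ne hwG fun h => hwG (h ▸ hv), hR.conflict_comm]
    rw [sum_insert hwG, load_insert_self hwG, hsum, card_insert_of_notMem hwG]
    push_cast
    linarith [hw.2.2]

lemma Greedy.card_le_two_mul_card_light (hR : R.Valid) (h : R.Greedy F G) :
    #G ≤ 2 * #(R.light G) := by
  have hheavy : (#(G \ R.light G) : ℝ) * 4 ≤ R.K * ∑ v ∈ G, R.load G v := by
    rw [← nsmul_eq_mul, ← sum_const, mul_sum]
    refine (sum_le_sum fun v hv => ?_).trans <|
      sum_le_sum_of_subset_of_nonneg (f := fun v => R.K * R.load G v) sdiff_subset fun v hv _ => ?_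
    · rw [mem_sdiff, light, mem_filter] at hv
      exact (not_le.1 fun h => hv.2 ⟨hv.1, h⟩).le
    · exact mul_nonneg (Nat.cast_nonneg _) (sum_nonneg fun u hu =>
        hR.conflict_nonneg _ _ (h.usable u (mem_of_mem_erase hu)) (h.usable v hv))
  have hcard : (#(G \ R.light G) : ℝ) + #(R.light G) = #G := by
    exact_mod_cast card_sdiff_add_card_eq_card (light_subset G)
  have : (#G : ℝ) ≤ 2 * #(R.light G) := by linarith [h.sum_load_le hR]
  exact_mod_cast this

/-- As long as `v` is acceptable, the links that are added are not longer than `v`. -/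
lemma Greedy.acceptable_or_joined_or_lt (hR : R.Valid) (h : R.Greedy F G) {v : V × V}
    (hv : R.Usable v) : (R.Acceptable F G v ∧ ∀ w ∈ G, R.len w ≤ R.len v) ∨
      Joined (F ∪ G) v.1 v.2 ∨ 1 < R.K * ∑ w ∈ G with R.len w ≤ R.len v, R.conflict w v := by
  classical
  induction h with
  | empty =>
    by_cases hj : Joined (F ∪ ∅) v.1 v.2
    · exact Or.inr (Or.inl hj)
    · exact Or.inl ⟨⟨hv, hj, by simp [load]⟩, by simp⟩
  | @step G w hG hw hmin ih =>
    have nonneg : ∀ u ∈ insert w G, 0 ≤ R.conflict u v := fun u hu =>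
      hR.conflict_nonneg _ _ ((hG.step hw hmin).usable u hu) hv
    rcases ih with ⟨hacc, hle⟩ | hj | hlt
    · have hshort : ∀ u ∈ insert w G, R.len u ≤ R.len v :=
        forall_mem_insert _ _ _ |>.2 ⟨hmin v hacc, hle⟩
      by_cases hj : Joined (F ∪ insert w G) v.1 v.2
      · exact Or.inr (Or.inl hj)
      by_cases hl : R.K * R.load (insert w G) v ≤ 1
      · exact Or.inl ⟨⟨hv, hj, hl⟩, hshort⟩
      · rw [filter_true_of_mem hshort]
        refine Or.inr (Or.inr ((not_le.1 hl).trans_le ?_))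
        exact mul_le_mul_of_nonneg_left (sum_le_sum_of_subset_of_nonneg (erase_subset _ _)
          fun u hu _ => nonneg u hu) (Nat.cast_nonneg _)
    · exact Or.inr (Or.inl (hj.mono (union_subset_union_right (subset_insert _ _))))
    · refine Or.inr (Or.inr (hlt.trans_le (mul_le_mul_of_nonneg_left ?_ (Nat.cast_nonneg _))))
      exact sum_le_sum_of_subset_of_nonneg (filter_subset_filter _ (subset_insert _ _))
        fun u hu _ => nonneg u (mem_of_mem_filter u hu)

/-- Each link of `Q` was rejected because of its conflicts with links of `G` that are not longer;
count these conflicts from the side of `G`. -/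
lemma Greedy.card_le_of_not_joined (hR : R.Valid) (h : R.Greedy F G)
    (hmax : ∀ v, ¬ R.Acceptable F G v) {C : ℝ} {Q : Finset (V × V)} (hQ : ∀ v ∈ Q, R.Usable v)
    (hQG : ∀ v ∈ Q, ¬ Joined (F ∪ G) v.1 v.2)
    (hC : ∀ w, R.Usable w → ∑ v ∈ Q with R.len w ≤ R.len v, R.conflict w v ≤ C) :
    (#Q : ℝ) ≤ R.K * C * #G := by
  have hrejected (v : V × V) (hv : v ∈ Q) :
      1 ≤ R.K * ∑ w ∈ G with R.len w ≤ R.len v, R.conflict w v :=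
    ((h.acceptable_or_joined_or_lt hR (hQ v hv)).resolve_left fun h => hmax v h.1).resolve_left
      (hQG v hv) |>.le
  calc (#Q : ℝ) = ∑ _v ∈ Q, (1 : ℝ) := by simp
    _ ≤ ∑ v ∈ Q, R.K * ∑ w ∈ G with R.len w ≤ R.len v, R.conflict w v := sum_le_sum hrejected
    _ = R.K * ∑ w ∈ G, ∑ v ∈ Q with R.len w ≤ R.len v, R.conflict w v := by
      simp_rw [← mul_sum, sum_filter]
      rw [sum_comm]
    _ ≤ R.K * ∑ _w ∈ G, C := by
      gcongr with w hw
      exact hC w (h.usable w hw)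
    _ = R.K * C * #G := by
      rw [sum_const, nsmul_eq_mul]
      ring

lemma selected_zero (Xs : ℕ → Finset (V × V)) : selected Xs 0 = ∅ := rfl

lemma selected_succ (Xs : ℕ → Finset (V × V)) (r : ℕ) :
    selected Xs (r + 1) = selected Xs r ∪ Xs r := by
  rw [selected, range_add_one, biUnion_insert, union_comm, selected]

lemma selected_congr {Ys : ℕ → Finset (V × V)} (h : ∀ q < r, Xs q = Ys q) :
    selected Xs r = selected Ys r :=
  biUnion_congr rfl fun q hq => h q (mem_range.1 hq)

lemma IsRound.usable (h : R.IsRound F X) {v : V × V} (hv : v ∈ X) : R.Usable v := by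
  obtain ⟨G, hG, -, rfl⟩ := h
  exact hG.usable v (light_subset G hv)

lemma IsRound.mul_load_le (h : R.IsRound F X) (hR : R.Valid) {v : V × V} (hv : v ∈ X) :
    R.K * R.load X v ≤ 4 := by
  obtain ⟨G, hG, -, rfl⟩ := h
  obtain ⟨hvG, hload⟩ := mem_filter.1 hv
  refine (mul_le_mul_of_nonneg_left ?_ R.K.cast_nonneg).trans hload
  exact sum_le_sum_of_subset_of_nonneg (erase_subset_erase _ (light_subset G)) fun u hu _ =>
    hR.conflict_nonneg _ _ (hG.usable u (mem_of_mem_erase hu)) (hG.usable v hvG)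

variable [Finite V]

lemma Greedy.isForestOver (h : R.Greedy F G) : IsForestOver F G := by
  induction h with
  | empty => exact isForestOver_empty F
  | step _ hw _ ih => exact ih.insert hw.2.1

lemma IsRound.isForestOver (h : R.IsRound F X) : IsForestOver F X := by
  obtain ⟨G, hG, -, rfl⟩ := h
  exact hG.isForestOver.subset (light_subset G)

/-- Half of the links that the cover contributes are either joined by `G`, so that `G` has as many
links, or were rejected because of `G`. -/
lemma IsRound.numComp_sub_one_le (hR : R.Valid) {C : ℝ} (hC : 0 ≤ C) {χ : ℕ}
    (hcov : R.Coverable C χ) (h : R.IsRound F X) (hF : 2 ≤ numComp F) :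
    (numComp F : ℝ) - 1 ≤ 4 * (1 + R.K * C) * χ * #X := by
  classical
  obtain ⟨A, hconn, hA⟩ := hcov
  obtain ⟨G, hG, hmax, rfl⟩ := h
  obtain ⟨i, hi, O, hOA, hO, hcard⟩ := exists_large_isForestOver hconn hF
  obtain ⟨O', hO'O, hhalf, hok, hW⟩ := hA i hi O hOA
  set J := {v ∈ O' | Joined (F ∪ G) v.1 v.2}
  set Q := {v ∈ O' | ¬ Joined (F ∪ G) v.1 v.2}
  have hJG : #J ≤ #G := (hO.subset ((filter_subset _ _).trans hO'O)).card_le_of_joined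
    hG.isForestOver fun v hv => (mem_filter.1 hv).2
  have hQG : (#Q : ℝ) ≤ R.K * C * #G := by
    refine hG.card_le_of_not_joined hR hmax (fun v hv => hok v (mem_of_mem_filter v hv))
      (fun v hv => (mem_filter.1 hv).2) fun w hw => (hW w hw).trans' ?_
    refine sum_le_sum_of_subset_of_nonneg (filter_subset_filter _ (filter_subset _ _)) ?_
    exact fun v hv _ => hR.conflict_nonneg _ _ hw (hok v (mem_of_mem_filter v hv))
  have hO'G : (#O' : ℝ) ≤ (1 + R.K * C) * #G := by
    have : #J + #Q = #O' := card_filter_add_card_filter_not _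
    rw [← this]
    push_cast
    linarith [(Nat.cast_le (α := ℝ)).2 hJG]
  have hlight : (#G : ℝ) ≤ 2 * #(R.light G) := by exact_mod_cast hG.card_le_two_mul_card_light hR
  calc (numComp F : ℝ) - 1 ≤ χ * #O := by
        rw [sub_le_iff_le_add]
        exact_mod_cast (by omega : numComp F ≤ χ * #O + 1)
    _ ≤ χ * (2 * #O') := by gcongr; exact_mod_cast hhalf
    _ ≤ χ * (2 * ((1 + R.K * C) * (2 * #(R.light G)))) := by
        gcongr
        exact hO'G.trans (by gcongr)
    _ = 4 * (1 + R.K * C) * χ * #(R.light G) := by ring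

lemma IsTrace.isForestOver (h : R.IsTrace Xs r) : IsForestOver ∅ (selected Xs r) := by
  induction r with
  | zero => exact isForestOver_empty ∅
  | succ r ih =>
    rw [selected_succ]
    refine (ih fun q hq => h q (hq.trans r.lt_succ_self)).union ?_
    rw [empty_union]
    exact (h r r.lt_succ_self).isForestOver

lemma IsTrace.numComp_succ_add_card {m : ℕ} (h : R.IsTrace Xs m) (hr : r < m) :
    numComp (selected Xs (r + 1)) + #(Xs r) = numComp (selected Xs r) := by
  rw [selected_succ]
  exact (h r hr).isForestOver

lemma IsTrace.numComp_anti {m : ℕ} (h : R.IsTrace Xs m) {q : ℕ} (hqr : q ≤ r) (hr : r ≤ m) :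
    numComp (selected Xs r) ≤ numComp (selected Xs q) := by
  induction r, hqr using Nat.le_induction with
  | base => rfl
  | succ r _ ih => exact (ih (by omega)).trans' (by have := h.numComp_succ_add_card hr; omega)

variable {C : ℝ} {χ m : ℕ}

lemma IsTrace.numComp_decay (hR : R.Valid) (hC : 0 ≤ C) (hcov : R.Coverable C χ)
    (h : R.IsTrace Xs m) (hr : r < m) (h2 : 2 ≤ numComp (selected Xs r)) :
    (numComp (selected Xs r) : ℝ) - 1 ≤ 4 * (1 + R.K * C) * χ *
      ((numComp (selected Xs r) - 1) - (numComp (selected Xs (r + 1)) - 1)) := by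
  have hcard : (numComp (selected Xs (r + 1)) : ℝ) + #(Xs r) = numComp (selected Xs r) := by
    exact_mod_cast h.numComp_succ_add_card hr
  rw [sub_sub_sub_cancel_right, ← hcard, add_sub_cancel_left, hcard]
  exact (h r hr).numComp_sub_one_le hR hC hcov h2

lemma IsTrace.numComp_le_one (hR : R.Valid) (hC : 0 ≤ C) (hcov : R.Coverable C χ)
    (h : R.IsTrace Xs m) (hm : Nat.card V ≤ m) : numComp (selected Xs m) ≤ 1 := by
  suffices key : ∀ r ≤ m, numComp (selected Xs r) ≤ max 1 (Nat.card V - r) by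
    have := key m le_rfl
    omega
  intro r hr
  induction r with
  | zero => simp [selected_zero, numComp_empty]
  | succ r ih =>
    have hle := ih (by omega)
    have hcard := h.numComp_succ_add_card (r := r) (by omega)
    by_cases h2 : 2 ≤ numComp (selected Xs r)
    · have hX : #(Xs r) ≠ 0 := by
        intro h0
        have hprog := (h r (by omega)).numComp_sub_one_le hR hC hcov h2
        rw [h0, Nat.cast_zero, mul_zero] at hprog
        linarith [(Nat.ofNat_le_cast (α := ℝ)).2 h2]
      omega
    · omega

/-- The summand `2` accounts for the last round, as `1 ≤ 2 * Real.log 2`. -/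
lemma IsTrace.natCast_le_mul_log (hR : R.Valid) (hC : 0 ≤ C) (hcov : R.Coverable C χ)
    [Nonempty V] {k : ℕ} (h : R.IsTrace Xs m) (hk : k ≤ m)
    (hlast : k ≠ 0 → (Xs (k - 1)).Nonempty) :
    (k : ℝ) ≤ (4 * (1 + R.K * C) + 2) * Real.log (Nat.card V) * χ := by
  set B := 4 * (1 + R.K * C)
  have : 0 < B := by positivity
  rcases k with - | j
  · have := Real.log_natCast_nonneg (Nat.card V)
    rw [Nat.cast_zero]
    positivity
  have two_le : ∀ r ≤ j, 2 ≤ numComp (selected Xs r) := fun r hr => by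
    have h1 := h.numComp_anti hr (by omega)
    have h2 := h.numComp_succ_add_card hk
    have h3 := one_le_numComp (selected Xs (j + 1))
    have h4 := card_pos.2 (hlast j.succ_ne_zero)
    rw [Nat.add_sub_cancel] at h4
    omega
  have one_le : ∀ r ≤ j, (1 : ℝ) ≤ numComp (selected Xs r) - 1 := fun r hr => by
    linarith [(Nat.ofNat_le_cast (α := ℝ)).2 (two_le r hr)]
  have hn : 2 ≤ Nat.card V := by
    simpa only [selected_zero, numComp_empty] using two_le 0 j.zero_le
  have hχ : 1 ≤ χ := by
    refine Nat.one_le_iff_ne_zero.2 fun h0 => ?_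
    have hprog := (h j hk).numComp_sub_one_le hR hC hcov (two_le j le_rfl)
    rw [h0, Nat.cast_zero, mul_zero, zero_mul] at hprog
    linarith [one_le j le_rfl]
  have hj : (j : ℝ) ≤ B * χ * Real.log (Nat.card V) := by
    refine (natCast_le_mul_log_of_decay (by positivity) one_le fun r hr =>
      h.numComp_decay hR hC hcov (by omega) (two_le r hr.le)).trans ?_
    gcongr
    · linarith [one_le 0 j.zero_le]
    · rw [selected_zero, numComp_empty]
      linarith
  have hlog : 1 / 2 ≤ Real.log (Nat.card V) :=
    (by linarith [Real.log_two_gt_d9] : (1 : ℝ) / 2 ≤ Real.log 2).trans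
      (Real.log_le_log two_pos (by exact_mod_cast hn))
  have hlogχ : (1 : ℝ) / 2 * 1 ≤ Real.log (Nat.card V) * χ := by
    gcongr
    exact_mod_cast hχ
  push_cast
  linarith

end Rule

end ConnSched

/-! ### Feasibility in terms of real numbers -/

namespace SINR

open Finset

variable {V X : Type*} [MetricSpace X] {α β N : ℝ} {pos : V → X} {P : V × V → ℝ}
  {S : Finset (V × V)} {u v : V × V}

/-- Attenuation of the signal of the sender of `u` at the receiver of `v`. -/
noncomputable def att (α : ℝ) (pos : V → X) (u v : V × V) : ℝ := dist (pos u.1) (pos v.2) ^ α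

lemma att_self (α : ℝ) (pos : V → X) (v : V × V) : att α pos v v = len pos v ^ α := rfl

lemma att_nonneg (α : ℝ) (pos : V → X) (u v : V × V) : 0 ≤ att α pos u v :=
  Real.rpow_nonneg dist_nonneg _

lemma att_pos (h : pos u.1 ≠ pos v.2) : 0 < att α pos u v :=
  Real.rpow_pos_of_pos (dist_pos.2 h) _

lemma ne_of_att_pos (hα : 0 < α) (h : 0 < att α pos u v) : pos u.1 ≠ pos v.2 := by
  intro heq
  rw [att, heq, dist_self, Real.zero_rpow hα.ne'] at h
  exact h.false

lemma received_of_ne (h : pos u.1 ≠ pos v.2) :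
    received α pos P u v = ENNReal.ofReal (P u / att α pos u v) := by
  have hd : 0 < dist (pos u.1) (pos v.2) := dist_pos.2 h
  rw [received, edist_dist, ENNReal.ofReal_rpow_of_pos hd, att,
    ENNReal.ofReal_div_of_pos (Real.rpow_pos_of_pos hd _)]

lemma received_of_eq (hα : 0 < α) (hP : 0 < P u) (h : pos u.1 = pos v.2) :
    received α pos P u v = ∞ := by
  rw [received, h, edist_self, ENNReal.zero_rpow_of_pos hα]
  exact ENNReal.div_zero (ENNReal.ofReal_pos.2 hP).ne'

section Feasibility

variable [DecidableEq V]

lemma interference_eq_ofReal (hN : 0 ≤ N) (hP : ∀ u ∈ S, 0 < P u)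
    (h : ∀ u ∈ S.erase v, pos u.1 ≠ pos v.2) :
    ENNReal.ofReal N + ∑ u ∈ S.erase v, received α pos P u v =
      ENNReal.ofReal (N + ∑ u ∈ S.erase v, P u / att α pos u v) := by
  have hnn : ∀ u ∈ S.erase v, 0 ≤ P u / att α pos u v := fun u hu =>
    div_nonneg (hP u (mem_of_mem_erase hu)).le (att_nonneg _ _ _ _)
  rw [ENNReal.ofReal_add hN (sum_nonneg hnn), ENNReal.ofReal_sum_of_nonneg hnn]
  congr 1
  exact sum_congr rfl fun u hu => received_of_ne (h u hu)

lemma ofReal_le_sinr_iff (hβ : 0 < β) (hN : 0 ≤ N) (hP : ∀ u ∈ S, 0 < P u) (hv : v ∈ S)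
    (hne : ∀ u ∈ S, pos u.1 ≠ pos v.2) :
    ENNReal.ofReal β ≤ sinr α N pos P S v ↔
      β * (N + ∑ u ∈ S.erase v, P u / att α pos u v) ≤ P v / att α pos v v := by
  have hsig : 0 < P v / att α pos v v := div_pos (hP v hv) (att_pos (hne v hv))
  rw [sinr, interference_eq_ofReal hN hP fun u hu => hne u (mem_of_mem_erase hu),
    received_of_ne (hne v hv), ENNReal.le_div_iff_mul_le
      (Or.inr (ENNReal.ofReal_pos.2 hsig).ne') (Or.inl ENNReal.ofReal_ne_top),
    ← ENNReal.ofReal_mul hβ.le, ENNReal.ofReal_le_ofReal_iff hsig.le]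

lemma Feasible.ne (hα : 0 < α) (hβ : 0 < β) (h : Feasible α β N pos P S) (hu : u ∈ S)
    (hv : v ∈ S) (huv : u ≠ v) : pos u.1 ≠ pos v.2 := by
  intro heq
  have hinf : ENNReal.ofReal N + ∑ u ∈ S.erase v, received α pos P u v = ∞ := by
    have : received α pos P u v ≤ ∑ u ∈ S.erase v, received α pos P u v :=
      single_le_sum (f := fun u => received α pos P u v) (fun _ _ => bot_le)
        (mem_erase.2 ⟨huv, hu⟩)
    rw [received_of_eq hα (h u hu).1 heq, top_le_iff] at this
    rw [this, add_top]
  have hsinr := (h v hv).2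
  rw [sinr, hinf, ENNReal.div_top, nonpos_iff_eq_zero, ENNReal.ofReal_eq_zero] at hsinr
  exact hsinr.not_gt hβ

lemma Feasible.mul_interference_le (hα : 0 < α) (hβ : 0 < β) (hN : 0 ≤ N)
    (h : Feasible α β N pos P S) (hv : v ∈ S) (hne : pos v.1 ≠ pos v.2) :
    β * (N + ∑ u ∈ S.erase v, P u / att α pos u v) ≤ P v / att α pos v v := by
  refine (ofReal_le_sinr_iff hβ hN (fun u hu => (h u hu).1) hv fun u hu => ?_).1 (h v hv).2
  rcases eq_or_ne u v with rfl | huv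
  · exact hne
  · exact h.ne hα hβ hu hv huv

lemma feasible_of_mul_interference_le (hβ : 0 < β) (hN : 0 ≤ N) (hP : ∀ v ∈ S, 0 < P v)
    (hne : ∀ u ∈ S, ∀ v ∈ S, pos u.1 ≠ pos v.2)
    (h : ∀ v ∈ S, β * (N + ∑ u ∈ S.erase v, P u / att α pos u v) ≤ P v / att α pos v v) :
    Feasible α β N pos P S :=
  fun v hv => ⟨hP v hv, (ofReal_le_sinr_iff hβ hN hP hv fun u hu => hne u hu v hv).2 (h v hv)⟩

lemma Feasible.mono {O : Finset (V × V)} (h : Feasible α β N pos P S) (hO : O ⊆ S) :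
    Feasible α β N pos P O := fun v hv => by
  refine ⟨(h v (hO hv)).1, (h v (hO hv)).2.trans ?_⟩
  unfold sinr
  gcongr

end Feasibility

/-! ### Averaging and comparison with a nearest link -/

lemma card_le_two_mul_card_filter {ι : Type*} {O : Finset ι} {g : ι → ℝ} (h0 : ∀ v ∈ O, 0 ≤ g v)
    (h : ∑ v ∈ O, g v ≤ #O) : #O ≤ 2 * #{v ∈ O | g v ≤ 2} := by
  have hlarge : (#{v ∈ O | ¬ g v ≤ 2} : ℝ) * 2 ≤ #O := calc
    (#{v ∈ O | ¬ g v ≤ 2} : ℝ) * 2 = ∑ v ∈ O with ¬ g v ≤ 2, 2 := by simp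
    _ ≤ ∑ v ∈ O with ¬ g v ≤ 2, g v :=
      sum_le_sum fun v hv => (not_le.1 (mem_filter.1 hv).2).le
    _ ≤ ∑ v ∈ O, g v :=
      sum_le_sum_of_subset_of_nonneg (filter_subset _ _) fun v hv _ => h0 v hv
    _ ≤ #O := h
  have hlarge' : #{v ∈ O | ¬ g v ≤ 2} * 2 ≤ #O := by exact_mod_cast hlarge
  have := card_filter_add_card_filter_not (s := O) (fun v => g v ≤ 2)
  omega

lemma sum_sum_erase_comm {ι : Type*} [DecidableEq ι] (O : Finset ι) (f : ι → ι → ℝ) :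
    ∑ v ∈ O, ∑ u ∈ O.erase v, f u v = ∑ v ∈ O, ∑ u ∈ O.erase v, f v u := by
  refine sum_comm' fun u v => ?_
  simp only [mem_erase, ne_eq, eq_comm (a := u)]
  tauto

lemma exists_large_sum_erase_le_two {ι : Type*} [DecidableEq ι] {O : Finset ι} {f : ι → ι → ℝ}
    (hf : ∀ u ∈ O, ∀ v ∈ O, 0 ≤ f u v) (h : ∀ v ∈ O, ∑ u ∈ O.erase v, f u v ≤ 1) :
    ∃ O' ⊆ O, #O ≤ 2 * #O' ∧ ∀ u ∈ O', ∑ v ∈ O.erase u, f u v ≤ 2 := by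
  refine ⟨{u ∈ O | ∑ v ∈ O.erase u, f u v ≤ 2}, filter_subset _ _, ?_,
    fun u hu => (mem_filter.1 hu).2⟩
  refine card_le_two_mul_card_filter
    (fun u hu => sum_nonneg fun v hv => hf u hu v (mem_of_mem_erase hv)) ?_
  calc ∑ u ∈ O, ∑ v ∈ O.erase u, f u v = ∑ v ∈ O, ∑ u ∈ O.erase v, f u v :=
        (sum_sum_erase_comm O f).symm
    _ ≤ ∑ v ∈ O, 1 := sum_le_sum h
    _ = #O := by simp

lemma sum_le_of_nearest {ι : Type*} [DecidableEq ι] {S : Finset ι} {D φ : ι → ℝ} {B : ℝ}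
    (hB : 0 ≤ B) (hφ : ∀ v ∈ S, φ v ≤ 1)
    (h : ∀ v₀ ∈ S, (∀ v ∈ S, D v₀ ≤ D v) → ∑ v ∈ S.erase v₀, φ v ≤ B) :
    ∑ v ∈ S, φ v ≤ 1 + B := by
  rcases S.eq_empty_or_nonempty with rfl | hS
  · rw [sum_empty]
    positivity
  · obtain ⟨v₀, hv₀, hmin⟩ := exists_min_image S D hS
    rw [← add_sum_erase S φ hv₀]
    exact add_le_add (hφ v₀ hv₀) (h v₀ hv₀ hmin)

lemma rpow_le_of_le_add_two_mul {x ℓ D : ℝ} (hα : 0 ≤ α) (hx : 0 ≤ x) (hℓ : 0 ≤ ℓ) (hD : 0 ≤ D)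
    (h : x ≤ ℓ + 2 * D) : x ^ α ≤ 3 ^ α * max (ℓ ^ α) (D ^ α) := by
  have hmax : x ≤ 3 * max ℓ D := by linarith [le_max_left ℓ D, le_max_right ℓ D]
  calc x ^ α ≤ (3 * max ℓ D) ^ α := Real.rpow_le_rpow hx hmax hα
    _ = 3 ^ α * max ℓ D ^ α := Real.mul_rpow zero_le_three (le_max_of_le_left hℓ)
    _ = 3 ^ α * max (ℓ ^ α) (D ^ α) := by
      rw [(Real.monotoneOn_rpow_Ici_of_exponent_nonneg hα).map_max hℓ hD]

lemma att_le_of_dist_receiver_le (hα : 0 ≤ α) {x : X} (h : dist x (pos u.2) ≤ dist x (pos v.2)) :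
    att α pos u v ≤ 3 ^ α * max (len pos u ^ α) (dist x (pos v.2) ^ α) ∧
    att α pos v u ≤ 3 ^ α * max (len pos v ^ α) (dist x (pos v.2) ^ α) := by
  constructor <;> refine rpow_le_of_le_add_two_mul hα dist_nonneg dist_nonneg dist_nonneg ?_
  · have := dist_triangle4 (pos u.1) (pos u.2) x (pos v.2)
    rw [dist_comm (pos u.2) x] at this
    rw [len]
    linarith
  · have := dist_triangle4 (pos v.1) (pos v.2) x (pos u.2)
    rw [dist_comm (pos v.2) x] at this
    rw [len]
    linarith

lemma att_le_of_dist_sender_le (hα : 0 ≤ α) {x : X} (h : dist (pos u.1) x ≤ dist (pos v.1) x) :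
    att α pos v u ≤ 3 ^ α * max (len pos u ^ α) (dist (pos v.1) x ^ α) ∧
    att α pos u v ≤ 3 ^ α * max (len pos v ^ α) (dist (pos v.1) x ^ α) := by
  constructor <;> refine rpow_le_of_le_add_two_mul hα dist_nonneg dist_nonneg dist_nonneg ?_
  · have := dist_triangle4 (pos v.1) x (pos u.1) (pos u.2)
    rw [dist_comm x (pos u.1)] at this
    rw [len]
    linarith
  · have := dist_triangle4 (pos u.1) x (pos v.1) (pos v.2)
    rw [dist_comm x (pos v.1)] at this
    rw [len]
    linarith

end SINR

/-! ### Fixed monotone powers -/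

namespace SINR

open Finset ConnSched

variable {V X : Type*} [MetricSpace X]

/-- The part of the signal strength which noise leaves for interference. -/
noncomputable def slack (α β N : ℝ) (pos : V → X) (P : V × V → ℝ) (v : V × V) : ℝ :=
  P v / len pos v ^ α - β * N

/-- Interference of `u` at `v`, relative to the interference which `v` tolerates. -/
noncomputable def relInterference (α β N : ℝ) (pos : V → X) (P : V × V → ℝ) (u v : V × V) : ℝ :=
  β * P u / (att α pos u v * slack α β N pos P v)

/-- Affectance of `u` on `v`: the relative interference, capped at one. The cap is the smooth one
`x ↦ x / (1 + x)`. -/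
noncomputable def aff (α β N : ℝ) (pos : V → X) (P : V × V → ℝ) (u v : V × V) : ℝ :=
  β * P u / (β * P u + att α pos u v * slack α β N pos P v)

/-- The selection rule for the fixed powers `P`: a link may be used if it can transmit alone, and
two links are in conflict as far as they affect each other. -/
noncomputable def fixedRule (α β N : ℝ) (pos : V → X) (G : SimpleGraph V) (P : V × V → ℝ) :
    Rule V where
  Usable v := G.Adj v.1 v.2 ∧ β * N * len pos v ^ α ≤ P v
  len := len pos
  conflict u v := aff α β N pos P u v + aff α β N pos P v u
  K := 16

variable {α β N : ℝ} {pos : V → X} {G : SimpleGraph V} {P : V × V → ℝ} {S O : Finset (V × V)}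
  {u v w : V × V}

lemma len_pos (h : pos v.1 ≠ pos v.2) : 0 < len pos v := dist_pos.2 h

lemma len_swap (v : V × V) : len pos v.swap = len pos v := dist_comm _ _

lemma slack_nonneg_iff (h : pos v.1 ≠ pos v.2) :
    0 ≤ slack α β N pos P v ↔ β * N * len pos v ^ α ≤ P v := by
  rw [slack, sub_nonneg, le_div_iff₀ (Real.rpow_pos_of_pos (len_pos h) α)]

lemma slack_le (hβ : 0 ≤ β) (hN : 0 ≤ N) (v : V × V) :
    slack α β N pos P v ≤ P v / len pos v ^ α :=
  sub_le_self _ (mul_nonneg hβ hN)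

lemma relInterference_nonneg (hβ : 0 ≤ β) (hP : 0 ≤ P u) (hs : 0 ≤ slack α β N pos P v) :
    0 ≤ relInterference α β N pos P u v :=
  div_nonneg (mul_nonneg hβ hP) (mul_nonneg (att_nonneg _ _ _ _) hs)

lemma aff_nonneg (hβ : 0 ≤ β) (hP : 0 ≤ P u) (hs : 0 ≤ slack α β N pos P v) :
    0 ≤ aff α β N pos P u v :=
  div_nonneg (mul_nonneg hβ hP)
    (add_nonneg (mul_nonneg hβ hP) (mul_nonneg (att_nonneg _ _ _ _) hs))

lemma aff_le_one (hβ : 0 ≤ β) (hP : 0 ≤ P u) (hs : 0 ≤ slack α β N pos P v) :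
    aff α β N pos P u v ≤ 1 :=
  div_le_one_of_le₀ (le_add_of_nonneg_right (mul_nonneg (att_nonneg _ _ _ _) hs))
    (add_nonneg (mul_nonneg hβ hP) (mul_nonneg (att_nonneg _ _ _ _) hs))

lemma fixedRule_valid (hβ : 0 ≤ β) (hpos : Function.Injective pos)
    (hP : IsMonotonePower α pos G P) : (fixedRule α β N pos G P).Valid where
  conflict_nonneg u v hu hv := add_nonneg
    (aff_nonneg hβ (hP.1 u hu.1).le ((slack_nonneg_iff (hpos.ne hv.1.ne)).2 hv.2))
    (aff_nonneg hβ (hP.1 v hv.1).le ((slack_nonneg_iff (hpos.ne hu.1.ne)).2 hu.2))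
  conflict_comm _ _ := add_comm _ _

/-! #### A feasible set has a large part with bounded conflicts -/

section Feasible

variable [DecidableEq V]

lemma Feasible.mul_sum_le_slack (hα : 0 < α) (hβ : 0 < β) (hN : 0 ≤ N)
    (h : Feasible α β N pos P O) (hv : v ∈ O) (hne : pos v.1 ≠ pos v.2) :
    β * ∑ u ∈ O.erase v, P u / att α pos u v ≤ slack α β N pos P v := by
  have := h.mul_interference_le hα hβ hN hv hne
  rw [att_self] at this
  rw [slack]
  linarith

lemma Feasible.slack_nonneg (hα : 0 < α) (hβ : 0 < β) (hN : 0 ≤ N)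
    (h : Feasible α β N pos P O) (hv : v ∈ O) (hne : pos v.1 ≠ pos v.2) :
    0 ≤ slack α β N pos P v :=
  (mul_nonneg hβ.le (sum_nonneg fun u hu => div_nonneg (h u (mem_of_mem_erase hu)).1.le
    (att_nonneg _ _ _ _))).trans (h.mul_sum_le_slack hα hβ hN hv hne)

lemma Feasible.slack_pos (hα : 0 < α) (hβ : 0 < β) (hN : 0 ≤ N)
    (h : Feasible α β N pos P O) (hu : u ∈ O) (hv : v ∈ O) (huv : u ≠ v)
    (hne : pos v.1 ≠ pos v.2) : 0 < slack α β N pos P v := by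
  refine (mul_pos hβ ?_).trans_le (h.mul_sum_le_slack hα hβ hN hv hne)
  exact sum_pos' (fun x hx => div_nonneg (h x (mem_of_mem_erase hx)).1.le (att_nonneg _ _ _ _))
    ⟨u, mem_erase.2 ⟨huv, hu⟩, div_pos (h u hu).1 (att_pos (h.ne hα hβ hu hv huv))⟩

lemma Feasible.sum_relInterference_le_one (hα : 0 < α) (hβ : 0 < β) (hN : 0 ≤ N)
    (h : Feasible α β N pos P O) (hv : v ∈ O) (hne : pos v.1 ≠ pos v.2) :
    ∑ u ∈ O.erase v, relInterference α β N pos P u v ≤ 1 := by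
  have hsum : ∑ u ∈ O.erase v, relInterference α β N pos P u v =
      (β * ∑ u ∈ O.erase v, P u / att α pos u v) / slack α β N pos P v := by
    simp_rw [mul_sum, sum_div, relInterference, mul_div_assoc', div_div]
  rw [hsum]
  exact div_le_one_of_le₀ (h.mul_sum_le_slack hα hβ hN hv hne)
    (h.slack_nonneg hα hβ hN hv hne)

end Feasible

lemma IsMonotonePower.slack_anti (hP : IsMonotonePower α pos G P) (hu : G.Adj u.1 u.2)
    (hv : G.Adj v.1 v.2) (h : len pos u ≤ len pos v) :
    slack α β N pos P v ≤ slack α β N pos P u :=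
  sub_le_sub_right (hP.2 u v hu hv h).2 _

lemma IsMonotonePower.len_rpow_mul_slack_le (hP : IsMonotonePower α pos G P) (hβ : 1 ≤ β)
    (hN : 0 ≤ N) (hpos : Function.Injective pos) (hu : G.Adj u.1 u.2) (hv : G.Adj v.1 v.2)
    (h : len pos u ≤ len pos v) : len pos u ^ α * slack α β N pos P v ≤ β * P u := by
  have hs := (hP.slack_anti (β := β) (N := N) hu hv h).trans (slack_le (by linarith) hN u)
  rw [le_div_iff₀' (Real.rpow_pos_of_pos (len_pos (hpos.ne hu.ne)) α)] at hs
  exact hs.trans (le_mul_of_one_le_left (hP.1 u hu).le hβ)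

lemma div_add_le_mul_div {x D r z L s t E : ℝ} (hx : 0 < x) (hD : 0 ≤ D) (hr : 0 ≤ r)
    (hz : 0 ≤ z) (hs : 0 < s) (ht : 0 ≤ t) (hE : 0 < E) (hEt : E ≤ t * max L D)
    (hL : L * s ≤ z) (hxz : x * s ≤ z * r) : x / (x + D * r) ≤ t * (z / (E * s)) := by
  rw [mul_div_assoc', div_le_div_iff₀ (by positivity) (by positivity)]
  have hmax : x * (max L D * s) ≤ z * (x + D * r) := by
    have hzx : 0 ≤ z * x := by positivity
    have hzDr : 0 ≤ z * (D * r) := by positivity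
    rcases max_choice L D with h | h <;> rw [h]
    · linarith [mul_le_mul_of_nonneg_left hL hx.le]
    · linarith [mul_le_mul_of_nonneg_left hxz hD]
  calc x * (E * s) ≤ x * (t * max L D * s) := by gcongr
    _ = t * (x * (max L D * s)) := by ring
    _ ≤ t * (z * (x + D * r)) := by gcongr
    _ = t * z * (x + D * r) := by ring

section Nearest

variable (hβ : 1 ≤ β) (hN : 0 ≤ N) (hpos : Function.Injective pos)
  (hP : IsMonotonePower α pos G P) (hw : G.Adj w.1 w.2) (hu : G.Adj u.1 u.2)
  (hv : G.Adj v.1 v.2) (hwu : len pos w ≤ len pos u) (hwv : len pos w ≤ len pos v)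
  (hsu : 0 < slack α β N pos P u) (hsv : 0 < slack α β N pos P v)
  (huv : pos u.1 ≠ pos v.2) (hvu : pos v.1 ≠ pos u.2)

include hβ hN hpos hP hw hu hv hwu hwv hsu hsv huv hvu

lemma aff_le_of_sender_near
    (huv' : att α pos u v ≤ 3 ^ α * max (len pos u ^ α) (att α pos w v))
    (hvu' : att α pos v u ≤ 3 ^ α * max (len pos v ^ α) (att α pos w v)) :
    aff α β N pos P w v ≤
      3 ^ α * (relInterference α β N pos P u v + relInterference α β N pos P v u) := by
  have hβ0 : 0 < β := by linarith
  have := hP.1 u hu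
  have := hP.1 v hv
  have hPw := hP.1 w hw
  rw [mul_add]
  rcases le_total (len pos u) (len pos v) with h | h
  · refine le_add_of_le_of_nonneg ?_ (mul_nonneg (by positivity)
      (relInterference_nonneg hβ0.le (hP.1 v hv).le hsu.le))
    refine div_add_le_mul_div (by positivity) (att_nonneg _ _ _ _) hsv.le (by positivity) hsv
      (by positivity) (att_pos huv) huv' (hP.len_rpow_mul_slack_le hβ hN hpos hu hv h) ?_
    gcongr
    exact (hP.2 w u hw hu hwu).1
  · refine le_add_of_nonneg_of_le (mul_nonneg (by positivity)
      (relInterference_nonneg hβ0.le (hP.1 u hu).le hsv.le)) ?_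
    refine div_add_le_mul_div (by positivity) (att_nonneg _ _ _ _) hsv.le (by positivity) hsu
      (by positivity) (att_pos hvu) hvu' (hP.len_rpow_mul_slack_le hβ hN hpos hv hu h) ?_
    gcongr
    · exact (hP.2 w v hw hv hwv).1
    · exact hP.slack_anti hv hu h

lemma aff_le_of_receiver_near
    (huv' : att α pos u v ≤ 3 ^ α * max (len pos v ^ α) (att α pos v w))
    (hvu' : att α pos v u ≤ 3 ^ α * max (len pos u ^ α) (att α pos v w)) :
    aff α β N pos P v w ≤
      3 ^ α * (relInterference α β N pos P u v + relInterference α β N pos P v u) := by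
  have hβ0 : 0 < β := by linarith
  have := hP.1 u hu
  have := hP.1 v hv
  have hsw := hsv.trans_le (hP.slack_anti hw hv hwv)
  rw [mul_add]
  rcases le_total (len pos u) (len pos v) with h | h
  · have hPuv := (hP.2 u v hu hv h).1
    refine le_add_of_nonneg_of_le (mul_nonneg (by positivity)
      (relInterference_nonneg hβ0.le (hP.1 u hu).le hsv.le)) ?_
    refine div_add_le_mul_div (by positivity) (att_nonneg _ _ _ _) hsw.le (by positivity) hsu
      (by positivity) (att_pos hvu) hvu' ?_ ?_
    · exact (hP.len_rpow_mul_slack_le hβ hN hpos hu hu le_rfl).trans (by gcongr)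
    · gcongr
      exact hP.slack_anti hw hu hwu
  · have hPvu := (hP.2 v u hv hu h).1
    refine le_add_of_le_of_nonneg ?_ (mul_nonneg (by positivity)
      (relInterference_nonneg hβ0.le (hP.1 v hv).le hsu.le))
    refine div_add_le_mul_div (by positivity) (att_nonneg _ _ _ _) hsw.le (by positivity) hsv
      (by positivity) (att_pos huv) huv' ?_ ?_
    · exact (hP.len_rpow_mul_slack_le hβ hN hpos hv hv le_rfl).trans (by gcongr)
    · gcongr
      exact hP.slack_anti hw hv hwv

end Nearest

section Cover

variable [DecidableEq V] (hα : 0 < α) (hβ : 1 ≤ β) (hN : 0 ≤ N) (hpos : Function.Injective pos)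
  (hP : IsMonotonePower α pos G P) (hS : ∀ v ∈ S, G.Adj v.1 v.2) (h : Feasible α β N pos P S)
  (hw : G.Adj w.1 w.2) (hwS : ∀ v ∈ S, len pos w ≤ len pos v)
  (hrow : ∀ v ∈ S, ∑ u ∈ S.erase v, relInterference α β N pos P v u ≤ 2)

include hα hβ hN hpos hS h hrow in
lemma Feasible.sum_relInterference_le_three (hv : v ∈ S) :
    ∑ u ∈ S.erase v,
      3 ^ α * (relInterference α β N pos P v u + relInterference α β N pos P u v) ≤ 3 * 3 ^ α := by
  have hcol := h.sum_relInterference_le_one hα (by linarith) hN hv (hpos.ne (hS v hv).ne)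
  rw [← mul_sum, sum_add_distrib, mul_comm 3]
  gcongr
  linarith [hrow v hv]

include hα hβ hN hpos hP hS h hw hwS hrow

lemma Feasible.sum_aff_from_le :
    ∑ v ∈ S, aff α β N pos P w v ≤ 1 + 3 * 3 ^ α := by
  have hβ0 : 0 < β := by linarith
  refine sum_le_of_nearest (D := fun v => dist (pos w.1) (pos v.2)) (by positivity)
    (fun v hv => aff_le_one hβ0.le (hP.1 w hw).le
      (h.slack_nonneg hα hβ0 hN hv (hpos.ne (hS v hv).ne))) fun u hu hmin => ?_
  refine (sum_le_sum fun v hv => ?_).trans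
    (h.sum_relInterference_le_three hα hβ hN hpos hS hrow hu)
  obtain ⟨hvu, hv⟩ := mem_erase.1 hv
  have hnear := att_le_of_dist_receiver_le hα.le (hmin v hv)
  exact aff_le_of_sender_near hβ hN hpos hP hw (hS u hu) (hS v hv) (hwS u hu) (hwS v hv)
    (h.slack_pos hα hβ0 hN hv hu hvu (hpos.ne (hS u hu).ne))
    (h.slack_pos hα hβ0 hN hu hv hvu.symm (hpos.ne (hS v hv).ne))
    (h.ne hα hβ0 hu hv hvu.symm) (h.ne hα hβ0 hv hu hvu) hnear.1 hnear.2

lemma Feasible.sum_aff_to_le (hsw : 0 ≤ slack α β N pos P w) :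
    ∑ v ∈ S, aff α β N pos P v w ≤ 1 + 3 * 3 ^ α := by
  have hβ0 : 0 < β := by linarith
  refine sum_le_of_nearest (D := fun v => dist (pos v.1) (pos w.2)) (by positivity)
    (fun v hv => aff_le_one hβ0.le (h v hv).1.le hsw) fun u hu hmin => ?_
  refine (sum_le_sum fun v hv => ?_).trans
    (h.sum_relInterference_le_three hα hβ hN hpos hS hrow hu)
  obtain ⟨hvu, hv⟩ := mem_erase.1 hv
  have hnear := att_le_of_dist_sender_le hα.le (hmin v hv)
  exact aff_le_of_receiver_near hβ hN hpos hP hw (hS u hu) (hS v hv) (hwS u hu) (hwS v hv)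
    (h.slack_pos hα hβ0 hN hv hu hvu (hpos.ne (hS u hu).ne))
    (h.slack_pos hα hβ0 hN hu hv hvu.symm (hpos.ne (hS v hv).ne))
    (h.ne hα hβ0 hu hv hvu.symm) (h.ne hα hβ0 hv hu hvu) hnear.2 hnear.1

end Cover

lemma Feasible.exists_large_fixedRule_conflict_le [DecidableEq V] (hα : 0 < α) (hβ : 1 ≤ β)
    (hN : 0 ≤ N) (hpos : Function.Injective pos) (hP : IsMonotonePower α pos G P)
    (hO : ∀ v ∈ O, G.Adj v.1 v.2) (h : Feasible α β N pos P O) :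
    ∃ O' ⊆ O, #O ≤ 2 * #O' ∧ (∀ v ∈ O', (fixedRule α β N pos G P).Usable v) ∧
      ∀ w, (fixedRule α β N pos G P).Usable w →
        ∑ v ∈ O' with (fixedRule α β N pos G P).len w ≤ (fixedRule α β N pos G P).len v,
          (fixedRule α β N pos G P).conflict w v ≤ 2 * (1 + 3 * 3 ^ α) := by
  have hβ0 : 0 < β := by linarith
  have hne (v) (hv : v ∈ O) : pos v.1 ≠ pos v.2 := hpos.ne (hO v hv).ne
  have hslack (v) (hv : v ∈ O) := h.slack_nonneg hα hβ0 hN hv (hne v hv)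
  have hnonneg (u) (hu : u ∈ O) (v) (hv : v ∈ O) : 0 ≤ relInterference α β N pos P u v :=
    relInterference_nonneg hβ0.le (h u hu).1.le (hslack v hv)
  obtain ⟨O', hO', hcard, hrow⟩ := exists_large_sum_erase_le_two hnonneg fun v hv =>
    h.sum_relInterference_le_one hα hβ0 hN hv (hne v hv)
  refine ⟨O', hO', hcard,
    fun v hv => ⟨hO v (hO' hv), (slack_nonneg_iff (hne v (hO' hv))).1 (hslack v (hO' hv))⟩,
    fun w hw => ?_⟩
  set S := {v ∈ O' | len pos w ≤ len pos v}
  have hSO : S ⊆ O := (filter_subset _ _).trans hO'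
  have hSadj : ∀ v ∈ S, G.Adj v.1 v.2 := fun v hv => hO v (hSO hv)
  have hrowS (v) (hv : v ∈ S) : ∑ u ∈ S.erase v, relInterference α β N pos P v u ≤ 2 :=
    (sum_le_sum_of_subset_of_nonneg (erase_subset_erase _ hSO) fun u hu _ =>
      hnonneg v (hSO hv) u (mem_of_mem_erase hu)).trans (hrow v (mem_of_mem_filter v hv))
  have hwS : ∀ v ∈ S, len pos w ≤ len pos v := fun v hv => (mem_filter.1 hv).2
  have hfrom := (h.mono hSO).sum_aff_from_le hα hβ hN hpos hP hSadj hw.1 hwS hrowS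
  have hto := (h.mono hSO).sum_aff_to_le hα hβ hN hpos hP hSadj hw.1 hwS hrowS
    ((slack_nonneg_iff (hpos.ne hw.1.ne)).2 hw.2)
  calc ∑ v ∈ S, (fixedRule α β N pos G P).conflict w v
      = ∑ v ∈ S, aff α β N pos P w v + ∑ v ∈ S, aff α β N pos P v w := sum_add_distrib
    _ ≤ 2 * (1 + 3 * 3 ^ α) := by linarith

/-! #### Links of small load can transmit simultaneously -/

lemma att_mul_slack_pos (hβ : 0 < β) (hP : 0 < P u) (hs : 0 ≤ slack α β N pos P v)
    (h : aff α β N pos P u v ≤ 1 / 4) : 0 < att α pos u v * slack α β N pos P v := by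
  have hb : 0 < β * P u := mul_pos hβ hP
  have hd : 0 ≤ att α pos u v * slack α β N pos P v := mul_nonneg (att_nonneg _ _ _ _) hs
  rw [aff, div_le_iff₀ (by linarith)] at h
  linarith

lemma ne_of_aff_le (hα : 0 < α) (hβ : 0 < β) (hP : 0 < P u) (hs : 0 ≤ slack α β N pos P v)
    (h : aff α β N pos P u v ≤ 1 / 4) : pos u.1 ≠ pos v.2 :=
  ne_of_att_pos hα (pos_of_mul_pos_left (att_mul_slack_pos hβ hP hs h) hs)

lemma mul_div_att_le_aff_mul_slack (hβ : 0 < β) (hP : 0 < P u) (hs : 0 ≤ slack α β N pos P v)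
    (h : aff α β N pos P u v ≤ 1 / 4) :
    β * (P u / att α pos u v) ≤ 4 / 3 * aff α β N pos P u v * slack α β N pos P v := by
  have hb : 0 < β * P u := mul_pos hβ hP
  have hd := att_mul_slack_pos hβ hP hs h
  have ha : 0 < att α pos u v := pos_of_mul_pos_left hd hs
  rw [aff, div_le_iff₀ (by linarith)] at h
  rw [aff, ← mul_div_assoc, mul_div_assoc', div_mul_eq_mul_div, div_le_div_iff₀ ha (by linarith)]
  nlinarith

section Small

variable [DecidableEq V] (hα : 0 < α) (hβ : 0 < β) (hN : 0 ≤ N)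
  (hpos : ∀ v ∈ S, pos v.1 ≠ pos v.2) (hP : ∀ v ∈ S, 0 < P v)
  (hs : ∀ v ∈ S, 0 ≤ slack α β N pos P v)

include hα hβ hpos hP hs in
lemma ne_of_aff_le_of_mem (h : ∀ v ∈ S, ∀ u ∈ S.erase v, aff α β N pos P u v ≤ 1 / 4) :
    ∀ u ∈ S, ∀ v ∈ S, pos u.1 ≠ pos v.2 := fun u hu v hv => by
  rcases eq_or_ne u v with rfl | huv
  · exact hpos u hu
  · exact ne_of_aff_le hα hβ (hP u hu) (hs v hv) (h v hv u (mem_erase.2 ⟨huv, hu⟩))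

include hα hβ hN hpos hP hs

lemma feasible_of_sum_aff_le (h : ∀ v ∈ S, ∑ u ∈ S.erase v, aff α β N pos P u v ≤ 1 / 4) :
    Feasible α β N pos P S := by
  have hle (v) (hv : v ∈ S) (u) (hu : u ∈ S.erase v) : aff α β N pos P u v ≤ 1 / 4 :=
    (single_le_sum (f := fun u => aff α β N pos P u v) (fun x hx =>
      aff_nonneg hβ.le (hP x (mem_of_mem_erase hx)).le (hs v hv)) hu).trans (h v hv)
  refine feasible_of_mul_interference_le hβ hN hP (ne_of_aff_le_of_mem hα hβ hpos hP hs hle)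
    fun v hv => ?_
  have hsum : β * ∑ u ∈ S.erase v, P u / att α pos u v ≤ slack α β N pos P v := calc
    β * ∑ u ∈ S.erase v, P u / att α pos u v
        ≤ ∑ u ∈ S.erase v, 4 / 3 * aff α β N pos P u v * slack α β N pos P v := by
      rw [mul_sum]
      exact sum_le_sum fun u hu => mul_div_att_le_aff_mul_slack hβ
        (hP u (mem_of_mem_erase hu)) (hs v hv) (hle v hv u hu)
    _ = 4 / 3 * (∑ u ∈ S.erase v, aff α β N pos P u v) * slack α β N pos P v := by
      rw [← sum_mul, ← mul_sum]
    _ ≤ slack α β N pos P v :=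
      mul_le_of_le_one_left (hs v hv) (by linarith [h v hv])
  rw [slack] at hsum
  rw [att_self]
  linarith

end Small

lemma IsMonotonePower.swap_eq (hP : IsMonotonePower α pos G P) (hv : G.Adj v.1 v.2) :
    P v.swap = P v :=
  le_antisymm (hP.2 _ _ hv.symm hv (len_swap v).le).1 (hP.2 _ _ hv hv.symm (len_swap v).ge).1

lemma att_swap_swap (u v : V × V) : att α pos u.swap v.swap = att α pos v u := by
  simp only [att, Prod.fst_swap, Prod.snd_swap, dist_comm]

/-- In the dual assignment the roles of affecting and affected link are interchanged. -/
lemma mul_dualPower_div_att_le {κ : ℝ} (hβ : 0 < β) (hN : 0 ≤ N) (hκ : 0 < κ) (hu : 0 < P u)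
    (hv : 0 < P v) (hne : pos u.1 ≠ pos u.2) (hs : 0 ≤ slack α β N pos P u)
    (h : aff α β N pos P v u ≤ 1 / 4) :
    β * (dualPower α κ pos P u / att α pos v u) ≤
      4 / 3 * aff α β N pos P v u * (κ / P v) := by
  have hL : 0 < len pos u ^ α := Real.rpow_pos_of_pos (len_pos hne) α
  have hle : β * (P v / att α pos v u) ≤ 4 / 3 * aff α β N pos P v u * (P u / len pos u ^ α) :=
    (mul_div_att_le_aff_mul_slack hβ hv hs h).trans (mul_le_mul_of_nonneg_left
      (slack_le hβ.le hN u) (mul_nonneg (by norm_num) (aff_nonneg hβ.le hv.le hs)))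
  calc β * (dualPower α κ pos P u / att α pos v u)
      = β * (P v / att α pos v u) * (κ * len pos u ^ α / (P u * P v)) := by
        rw [dualPower]
        field_simp
    _ ≤ 4 / 3 * aff α β N pos P v u * (P u / len pos u ^ α) *
          (κ * len pos u ^ α / (P u * P v)) := by gcongr
    _ = 4 / 3 * aff α β N pos P v u * (κ / P v) := by field_simp

lemma IsMonotonePower.dualPower_swap (hP : IsMonotonePower α pos G P) (κ : ℝ)
    (hv : G.Adj v.1 v.2) : dualPower α κ pos P v.swap = dualPower α κ pos P v := by
  rw [dualPower, len_swap, hP.swap_eq hv, dualPower]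

section Dual

variable [DecidableEq V] {κ : ℝ} (hα : 0 < α) (hβ : 0 < β) (hN : 0 ≤ N)
  (hpos : Function.Injective pos) (hP : IsMonotonePower α pos G P) (hS : ∀ v ∈ S, G.Adj v.1 v.2)
  (hs : ∀ v ∈ S, 0 ≤ slack α β N pos P v)
  (h : ∀ v ∈ S, ∑ u ∈ S.erase v, aff α β N pos P v u ≤ 1 / 4) (hκ : 0 < κ)

include hβ hP hS hs h in
lemma IsMonotonePower.aff_le_of_sum_le (hv : v ∈ S) (hu : u ∈ S.erase v) :
    aff α β N pos P v u ≤ 1 / 4 :=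
  (single_le_sum (fun x hx => aff_nonneg hβ.le (hP.1 v (hS v hv)).le (hs x (mem_of_mem_erase hx)))
    hu).trans (h v hv)

include hβ hN hpos hP hS hs h hκ in
lemma IsMonotonePower.sum_dualPower_le (hv : v ∈ S) :
    β * ∑ u ∈ (reversed S).erase v.swap, dualPower α κ pos P u / att α pos u v.swap ≤
      1 / 3 * (κ / P v) := by
  have hPv := hP.1 v (hS v hv)
  calc β * ∑ u ∈ (reversed S).erase v.swap, dualPower α κ pos P u / att α pos u v.swap
      = ∑ u ∈ S.erase v, β * (dualPower α κ pos P u.swap / att α pos u.swap v.swap) := by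
        rw [reversed, ← image_erase Prod.swap_injective, sum_image Prod.swap_injective.injOn,
          mul_sum]
    _ ≤ ∑ u ∈ S.erase v, 4 / 3 * aff α β N pos P v u * (κ / P v) := by
        refine sum_le_sum fun u hu => ?_
        have huS := mem_of_mem_erase hu
        rw [hP.dualPower_swap κ (hS u huS), att_swap_swap]
        exact mul_dualPower_div_att_le hβ hN hκ (hP.1 u (hS u huS)) hPv (hpos.ne (hS u huS).ne)
          (hs u huS) (hP.aff_le_of_sum_le hβ hS hs h hv hu)
    _ = 4 / 3 * (∑ u ∈ S.erase v, aff α β N pos P v u) * (κ / P v) := by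
        rw [← sum_mul, ← mul_sum]
    _ ≤ 1 / 3 * (κ / P v) :=
        mul_le_mul_of_nonneg_right (by linarith [h v hv]) (div_pos hκ hPv).le

include hα hβ hN hpos hP hS hs h hκ in
lemma IsMonotonePower.feasible_dualPower (hκS : ∀ v ∈ S, 2 * β * N * P v ≤ κ) :
    Feasible α β N pos (dualPower α κ pos P) (reversed S) := by
  have hPS : ∀ v ∈ S, 0 < P v := fun v hv => hP.1 v (hS v hv)
  have hL (v) (hv : v ∈ S) : 0 < len pos v ^ α :=
    Real.rpow_pos_of_pos (len_pos (hpos.ne (hS v hv).ne)) α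
  have hne := ne_of_aff_le_of_mem hα hβ (fun v hv => hpos.ne (hS v hv).ne) hPS hs
    fun v hv u hu => hP.aff_le_of_sum_le hβ hS hs h (mem_of_mem_erase hu)
      (mem_erase.2 ⟨(ne_of_mem_erase hu).symm, hv⟩)
  have hforall {p : V × V → Prop} : (∀ v ∈ reversed S, p v) ↔ ∀ v ∈ S, p v.swap := forall_mem_image
  refine feasible_of_mul_interference_le hβ hN (hforall.2 fun v hv => ?_)
    (hforall.2 fun u hu => hforall.2 fun v hv => (hne v hv u hu).symm) (hforall.2 fun v hv => ?_)
  · rw [hP.dualPower_swap κ (hS v hv)]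
    exact div_pos (mul_pos hκ (hL v hv)) (hPS v hv)
  · have hnoise : β * N ≤ 1 / 2 * (κ / P v) := by
      rw [mul_div_assoc', le_div_iff₀ (hPS v hv)]
      linarith [hκS v hv]
    have hsignal : dualPower α κ pos P v.swap / att α pos v.swap v.swap = κ / P v := by
      rw [hP.dualPower_swap κ (hS v hv), att_swap_swap, att_self, dualPower, div_right_comm,
        mul_div_cancel_right₀ _ (hL v hv).ne']
    rw [hsignal, mul_add]
    linarith [hP.sum_dualPower_le hβ hN hpos hS hs h hκ hv, div_pos hκ (hPS v hv)]

end Dual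

lemma feasible_of_fixedRule_load_le [DecidableEq V] (hα : 0 < α) (hβ : 0 < β) (hN : 0 ≤ N)
    (hpos : Function.Injective pos) (hP : IsMonotonePower α pos G P)
    (hS : ∀ v ∈ S, (fixedRule α β N pos G P).Usable v)
    (hload : ∀ v ∈ S, (fixedRule α β N pos G P).load S v ≤ 1 / 4) :
    Feasible α β N pos P S ∧ ∀ κ : ℝ, 0 < κ → (∀ v ∈ S, 2 * β * N * P v ≤ κ) →
      Feasible α β N pos (dualPower α κ pos P) (reversed S) := by
  have hne : ∀ v ∈ S, pos v.1 ≠ pos v.2 := fun v hv => hpos.ne (hS v hv).1.ne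
  have hPS : ∀ v ∈ S, 0 < P v := fun v hv => hP.1 v (hS v hv).1
  have hs : ∀ v ∈ S, 0 ≤ slack α β N pos P v := fun v hv =>
    (slack_nonneg_iff (hne v hv)).2 (hS v hv).2
  have hnn (u) (hu : u ∈ S) (v) (hv : v ∈ S) : 0 ≤ aff α β N pos P u v :=
    aff_nonneg hβ.le (hPS u hu).le (hs v hv)
  have hadd (v) (hv : v ∈ S) : ∑ u ∈ S.erase v, aff α β N pos P u v +
      ∑ u ∈ S.erase v, aff α β N pos P v u ≤ 1 / 4 := by
    rw [← sum_add_distrib]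
    exact hload v hv
  exact ⟨feasible_of_sum_aff_le hα hβ hN hne hPS hs fun v hv =>
      le_of_add_le_of_nonneg_left (hadd v hv)
        (sum_nonneg fun u hu => hnn v hv u (mem_of_mem_erase hu)),
    fun κ hκ hκS => hP.feasible_dualPower hα hβ hN hpos (fun v hv => (hS v hv).1) hs
      (fun v hv => le_of_add_le_of_nonneg_right (hadd v hv)
        (sum_nonneg fun u hu => hnn u (mem_of_mem_erase hu) v hv)) hκ hκS⟩

end SINR

/-! ### Power control -/

namespace SINR

open Finset ConnSched

/-! #### Assigning powers from the longest link down to the shortest one -/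

section Powers

variable {ι κ : Type*} [LinearOrder κ] {key : ι → κ} {S : Finset ι} {E : ι → ι → ℝ} {P : ι → ℝ}
  {β M N t η : ℝ} {v : ι}

lemma exists_pos_forall_eq_mul_add_sum {g : ι → ℝ} (key : ι → κ) (hg : ∀ v ∈ S, 0 < g v)
    (hE : ∀ u ∈ S, ∀ v ∈ S, 0 ≤ E u v) (hM : 0 < M) :
    ∃ P : ι → ℝ, ∀ v ∈ S, 0 < P v ∧
      P v = g v * (M + ∑ u ∈ S with key v < key u, P u / E u v) := by
  classical
  induction S using Finset.induction_on_min_value key with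
  | empty => exact ⟨0, by simp⟩
  | insert a s ha hmin ih =>
    obtain ⟨P, hP⟩ := ih (fun v hv => hg v (mem_insert_of_mem hv))
      fun u hu v hv => hE u (mem_insert_of_mem hu) v (mem_insert_of_mem hv)
    set p := g a * (M + ∑ u ∈ s with key a < key u, P u / E u a)
    have hP_ne (u) (hu : u ∈ s) : Function.update P a p u = P u :=
      Function.update_of_ne (ne_of_mem_of_not_mem hu ha) _ _
    have hsum (v) (hav : key a ≤ key v) :
        ∑ u ∈ insert a s with key v < key u, Function.update P a p u / E u v =
          ∑ u ∈ s with key v < key u, P u / E u v := by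
      rw [filter_insert, if_neg hav.not_gt]
      exact sum_congr rfl fun u hu => by rw [hP_ne u (mem_of_mem_filter u hu)]
    refine ⟨Function.update P a p, forall_mem_insert _ _ _ |>.2 ⟨?_, fun v hv => ?_⟩⟩
    · rw [hsum a le_rfl, Function.update_self]
      have hnonneg : 0 ≤ ∑ u ∈ s with key a < key u, P u / E u a := sum_nonneg fun u hu =>
        have hu := mem_of_mem_filter u hu
        div_nonneg (hP u hu).1.le (hE u (mem_insert_of_mem hu) a (mem_insert_self a s))
      exact ⟨mul_pos (hg a (mem_insert_self a s)) (by linarith), rfl⟩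
    · rw [hsum v (hmin v hv), hP_ne v hv]
      exact hP v hv

lemma sum_erase_eq_sum_lt_add_sum_gt [DecidableEq ι] (hkey : Function.Injective key) (f : ι → ℝ) :
    ∑ u ∈ S.erase v, f u =
      ∑ u ∈ S with key u < key v, f u + ∑ u ∈ S with key v < key u, f u := by
  rw [← sum_union (disjoint_filter.2 fun _ _ => lt_asymm)]
  congr 1
  ext u
  rw [mem_erase, mem_union, mem_filter, mem_filter, ← and_or_left, ← ne_iff_lt_or_gt,
    hkey.ne_iff, and_comm]

variable (hE : ∀ u ∈ S, ∀ v ∈ S, 0 < E u v)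
  (hsmall : ∀ v ∈ S, ∑ w ∈ S with key w < key v, (E w w / E w v + E w w / E v w) ≤ η)

include hE hsmall in
lemma sum_div_le_of_forall_lt (hv : v ∈ S) {T : Finset ι} (hTS : T ⊆ S)
    (hT : ∀ w ∈ T, key w < key v) :
    ∑ w ∈ T, E w w / E w v ≤ η ∧ ∑ w ∈ T, E w w / E v w ≤ η := by
  have hnonneg (w) (hw : w ∈ S) : 0 ≤ E w w / E w v ∧ 0 ≤ E w w / E v w :=
    ⟨(div_pos (hE w hw w hw) (hE w hw v hv)).le, (div_pos (hE w hw w hw) (hE v hv w hw)).le⟩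
  have hsum : ∑ w ∈ T, (E w w / E w v + E w w / E v w) ≤ η :=
    (sum_le_sum_of_subset_of_nonneg (fun w hw => mem_filter.2 ⟨hTS hw, hT w hw⟩) fun w hw _ =>
      have := hnonneg w (mem_of_mem_filter w hw)
      add_nonneg this.1 this.2).trans (hsmall v hv)
  exact ⟨(sum_le_sum fun w hw => le_add_of_nonneg_right (hnonneg w (hTS hw)).2).trans hsum,
    (sum_le_sum fun w hw => le_add_of_nonneg_left (hnonneg w (hTS hw)).1).trans hsum⟩

lemma div_mul_div_le_mul_add {p ℓ Euv Euw Ewv : ℝ} (hp : 0 ≤ p) (hℓ : 0 ≤ ℓ) (ht : 0 ≤ t)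
    (huv : 0 < Euv) (huw : 0 < Euw) (hwv : 0 < Ewv) (h : Euv ≤ t * max Euw Ewv) :
    ℓ / Ewv * (p / Euw) ≤ t * (p / Euv) * (ℓ / Euw + ℓ / Ewv) := by
  have hsum : Euv ≤ t * (Euw + Ewv) :=
    h.trans (by gcongr; exact max_le_add_of_nonneg huw.le hwv.le)
  calc ℓ / Ewv * (p / Euw) ≤ ℓ / Ewv * (p / Euw) * (t * (Euw + Ewv) / Euv) :=
        le_mul_of_one_le_right (by positivity) ((one_le_div huv).2 hsum)
    _ = t * (p / Euv) * (ℓ / Euw + ℓ / Ewv) := by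
        field_simp
        ring

variable (ht : 0 ≤ t)
  (htri : ∀ u ∈ S, ∀ v ∈ S, ∀ w ∈ S, key w < key u → key w < key v →
    E u v ≤ t * max (E u w) (E w v))

include hE hsmall ht htri

lemma sum_sum_div_mul_div_le (hP : ∀ v ∈ S, 0 ≤ P v) (hv : v ∈ S) :
    ∑ w ∈ S with key w < key v, ∑ u ∈ S with key w < key u, E w w / E w v * (P u / E u w) ≤
      2 * t * η * ∑ u ∈ S, P u / E u v := by
  calc ∑ w ∈ S with key w < key v, ∑ u ∈ S with key w < key u, E w w / E w v * (P u / E u w)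
      ≤ ∑ w ∈ S with key w < key v, ∑ u ∈ S with key w < key u,
          t * (P u / E u v) * (E w w / E u w + E w w / E w v) := by
        refine sum_le_sum fun w hw => sum_le_sum fun u hu => ?_
        obtain ⟨hw, hwv⟩ := mem_filter.1 hw
        obtain ⟨hu, hwu⟩ := mem_filter.1 hu
        exact div_mul_div_le_mul_add (hP u hu) (hE w hw w hw).le ht (hE u hu v hv) (hE u hu w hw)
          (hE w hw v hv) (htri u hu v hv w hw hwu hwv)
    _ = ∑ u ∈ S, ∑ w ∈ S with key w < key v ∧ key w < key u,
          t * (P u / E u v) * (E w w / E u w + E w w / E w v) := by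
        refine sum_comm' fun w u => ?_
        simp only [mem_filter]
        tauto
    _ ≤ ∑ u ∈ S, t * (P u / E u v) * (η + η) := by
        refine sum_le_sum fun u hu => ?_
        rw [← mul_sum, sum_add_distrib]
        refine mul_le_mul_of_nonneg_left (add_le_add ?_ ?_)
          (mul_nonneg ht (div_nonneg (hP u hu) (hE u hu v hv).le))
        · exact (sum_div_le_of_forall_lt hE hsmall hu (filter_subset _ _)
            fun w hw => (mem_filter.1 hw).2.2).2
        · exact (sum_div_le_of_forall_lt hE hsmall hv (filter_subset _ _)
            fun w hw => (mem_filter.1 hw).2.1).1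
    _ = 2 * t * η * ∑ u ∈ S, P u / E u v := by
        rw [mul_sum]
        exact sum_congr rfl fun u _ => by ring

lemma sum_shorter_interference_le (hβ : 0 ≤ β) (hM : 0 ≤ M)
    (hP : ∀ v ∈ S, 0 < P v ∧
      P v = 2 * β * E v v * (M + ∑ u ∈ S with key v < key u, P u / E u v)) (hv : v ∈ S) :
    ∑ w ∈ S with key w < key v, P w / E w v ≤
      2 * β * η * M + 4 * β * t * η * ∑ u ∈ S, P u / E u v := by
  have hdirect := (sum_div_le_of_forall_lt hE hsmall hv (filter_subset (key · < key v) S)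
    fun w hw => (mem_filter.1 hw).2).1
  have hindirect := sum_sum_div_mul_div_le hE hsmall ht htri (fun v hv => (hP v hv).1.le) hv
  calc ∑ w ∈ S with key w < key v, P w / E w v
      = ∑ w ∈ S with key w < key v, (2 * β * M * (E w w / E w v) +
          2 * β * ∑ u ∈ S with key w < key u, E w w / E w v * (P u / E u w)) := by
        refine sum_congr rfl fun w hw => ?_
        rw [(hP w (mem_of_mem_filter w hw)).2, ← mul_sum]
        ring
    _ = 2 * β * M * ∑ w ∈ S with key w < key v, E w w / E w v + 2 * β *
          ∑ w ∈ S with key w < key v, ∑ u ∈ S with key w < key u,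
            E w w / E w v * (P u / E u w) := by
        rw [sum_add_distrib, mul_sum, mul_sum]
    _ ≤ 2 * β * M * η + 2 * β * (2 * t * η * ∑ u ∈ S, P u / E u v) := by gcongr
    _ = 2 * β * η * M + 4 * β * t * η * ∑ u ∈ S, P u / E u v := by ring

omit hE hsmall ht htri in
lemma mul_noise_add_interference_le {I J Z : ℝ} (hβ : 1 ≤ β) (hN : 0 ≤ N) (ht : 1 ≤ t)
    (hη : 0 ≤ η) (hη' : 32 * β ^ 2 * t * η ≤ 1) (hI : 0 ≤ I) (hJ : 0 ≤ J)
    (hZ : Z = 2 * β * (N + 1 + J))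
    (h : I ≤ 2 * β * η * (N + 1) + 4 * β * t * η * (Z + (I + J))) :
    β * (N + (I + J)) ≤ Z := by
  have hZpos : 0 ≤ Z := by rw [hZ]; positivity
  set ε := 4 * β * t * η with hε
  have hε0 : 0 ≤ ε := by positivity
  have hβε : 8 * (β * ε) ≤ 1 := by rw [hε]; linarith
  have hε8 : ε ≤ 1 / 8 := by linarith [le_mul_of_one_le_left hε0 hβ]
  have hηε : 2 * β * η ≤ ε := by
    rw [hε]
    nlinarith [mul_nonneg (mul_nonneg (zero_le_one.trans hβ) hη) (sub_nonneg.2 ht)]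
  have hMJ : N + 1 + J ≤ Z / 2 := by
    rw [hZ]
    linarith [le_mul_of_one_le_left (show 0 ≤ N + 1 + J by positivity) hβ]
  have hIε : I ≤ ε * (3 / 2 * Z + I) := calc
    I ≤ ε * (N + 1) + ε * (Z + (I + J)) := h.trans (by gcongr)
    _ = ε * (N + 1 + J + Z + I) := by ring
    _ ≤ ε * (3 / 2 * Z + I) := by gcongr; linarith
  have hIZ : 7 / 8 * I ≤ 3 / 2 * ε * Z := by linarith [mul_le_mul_of_nonneg_right hε8 hI]
  have hβI : β * I ≤ Z / 2 := by
    linarith [mul_le_mul_of_nonneg_left hIZ (zero_le_one.trans hβ),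
      mul_le_mul_of_nonneg_right hβε hZpos]
  have hβNJ : β * (N + J) ≤ Z / 2 := by
    rw [hZ]
    linarith
  linarith [hβI, hβNJ]

omit ht in
/-- The power of a link is chosen to cope with noise and the longer links. Interference of the
shorter links, whose powers are determined by those of the longer ones, is then negligible. -/
lemma exists_powers [DecidableEq ι] (hkey : Function.Injective key) (hβ : 1 ≤ β) (hN : 0 ≤ N)
    (ht : 1 ≤ t) (hη : 0 ≤ η) (hη' : 32 * β ^ 2 * t * η ≤ 1) :
    ∃ P : ι → ℝ, ∀ v ∈ S, 0 < P v ∧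
      β * (N + ∑ u ∈ S.erase v, P u / E u v) ≤ P v / E v v := by
  have hβ0 : 0 < β := by linarith
  obtain ⟨P, hP⟩ := exists_pos_forall_eq_mul_add_sum key (g := fun v => 2 * β * E v v)
    (M := N + 1) (fun v hv => mul_pos (by positivity) (hE v hv v hv))
    (fun u hu v hv => (hE u hu v hv).le) (by positivity)
  refine ⟨P, fun v hv => ⟨(hP v hv).1, ?_⟩⟩
  have hnonneg (u) (hu : u ∈ S) : 0 ≤ P u / E u v := (div_pos (hP u hu).1 (hE u hu v hv)).le
  have hI := sum_shorter_interference_le hE hsmall (zero_le_one.trans ht) htri hβ0.le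
    (M := N + 1) (by positivity) hP hv
  rw [← add_sum_erase S _ hv, sum_erase_eq_sum_lt_add_sum_gt hkey] at hI
  rw [sum_erase_eq_sum_lt_add_sum_gt hkey]
  refine mul_noise_add_interference_le hβ hN ht hη hη'
    (sum_nonneg fun u hu => hnonneg u (mem_of_mem_filter u hu))
    (sum_nonneg fun u hu => hnonneg u (mem_of_mem_filter u hu)) ?_ hI
  rw [(hP v hv).2, mul_right_comm, mul_div_cancel_right₀ _ (hE v hv v hv).ne']

end Powers

/-! #### The conflict of two links -/

variable {V X : Type*} [MetricSpace X]

/-- Half the harmonic mean of the attenuations along two links: up to a factor of two, the smaller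
one of them. -/
noncomputable def harm (α : ℝ) (pos : V → X) (u v : V × V) : ℝ :=
  len pos u ^ α * len pos v ^ α / (len pos u ^ α + len pos v ^ α)

/-- Closeness of two nodes in comparison with the attenuation `h`, a number between zero and
one. -/
noncomputable def near (α : ℝ) (pos : V → X) (h : ℝ) (x y : V) : ℝ :=
  h / (h + dist (pos x) (pos y) ^ α)

/-- The selection rule for power control: all available links may be used, and two links are in
conflict as far as an endpoint of one is close to an endpoint of the other. -/
noncomputable def globalRule (α : ℝ) (pos : V → X) (G : SimpleGraph V) (K : ℕ) : Rule V where
  Usable v := G.Adj v.1 v.2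
  len := len pos
  conflict u v := near α pos (harm α pos u v) u.1 v.1 + near α pos (harm α pos u v) u.1 v.2 +
    (near α pos (harm α pos u v) u.2 v.1 + near α pos (harm α pos u v) u.2 v.2)
  K := K

variable {α β N h : ℝ} {pos : V → X} {G : SimpleGraph V} {K : ℕ} {P : V × V → ℝ}
  {S T O : Finset (V × V)} {u v w : V × V}

lemma len_rpow_pos (hpos : Function.Injective pos) (hv : G.Adj v.1 v.2) : 0 < len pos v ^ α :=
  Real.rpow_pos_of_pos (len_pos (hpos.ne hv.ne)) α

lemma len_rpow_nonneg (v : V × V) : 0 ≤ len pos v ^ α := Real.rpow_nonneg dist_nonneg α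

lemma harm_comm (u v : V × V) : harm α pos u v = harm α pos v u := by
  rw [harm, harm, mul_comm, add_comm]

lemma harm_swap_left (u v : V × V) : harm α pos u.swap v = harm α pos u v := by
  rw [harm, harm, len_swap]

lemma harm_nonneg (u v : V × V) : 0 ≤ harm α pos u v :=
  div_nonneg (mul_nonneg (len_rpow_nonneg u) (len_rpow_nonneg v))
    (add_nonneg (len_rpow_nonneg u) (len_rpow_nonneg v))

lemma harm_pos (hu : 0 < len pos u ^ α) (hv : 0 < len pos v ^ α) : 0 < harm α pos u v :=
  div_pos (mul_pos hu hv) (add_pos hu hv)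

lemma harm_le_left (hu : 0 < len pos u ^ α) : harm α pos u v ≤ len pos u ^ α := by
  have hv := len_rpow_nonneg (α := α) (pos := pos) v
  rw [harm, div_le_iff₀ (add_pos_of_pos_of_nonneg hu hv)]
  exact mul_le_mul_of_nonneg_left (le_add_of_nonneg_left hu.le) hu.le

lemma le_two_mul_harm (hu : 0 < len pos u ^ α) (h : len pos u ^ α ≤ len pos v ^ α) :
    len pos u ^ α ≤ 2 * harm α pos u v := by
  rw [harm, ← mul_div_assoc, le_div_iff₀ (add_pos hu (hu.trans_le h))]
  linarith [mul_le_mul_of_nonneg_left h hu.le]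

lemma near_comm (h : ℝ) (x y : V) : near α pos h x y = near α pos h y x := by
  rw [near, near, dist_comm]

lemma near_nonneg (hh : 0 ≤ h) (x y : V) : 0 ≤ near α pos h x y :=
  div_nonneg hh (add_nonneg hh (Real.rpow_nonneg dist_nonneg α))

lemma near_le_one (hh : 0 ≤ h) (x y : V) : near α pos h x y ≤ 1 :=
  have hd : 0 ≤ dist (pos x) (pos y) ^ α := Real.rpow_nonneg dist_nonneg α
  div_le_one_of_le₀ (le_add_of_nonneg_right hd) (add_nonneg hh hd)

lemma globalRule_conflict_nonneg (u v : V × V) : 0 ≤ (globalRule α pos G K).conflict u v :=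
  have hh := harm_nonneg u v
  add_nonneg (add_nonneg (near_nonneg hh _ _) (near_nonneg hh _ _))
    (add_nonneg (near_nonneg hh _ _) (near_nonneg hh _ _))

lemma globalRule_conflict_comm (u v : V × V) :
    (globalRule α pos G K).conflict u v = (globalRule α pos G K).conflict v u := by
  simp only [globalRule, harm_comm u v, near_comm _ v.1, near_comm _ v.2]
  ring

lemma globalRule_valid : (globalRule α pos G K).Valid where
  conflict_nonneg u v _ _ := globalRule_conflict_nonneg u v
  conflict_comm := globalRule_conflict_comm

lemma globalRule_conflict_swap_left (u v : V × V) :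
    (globalRule α pos G K).conflict u.swap v = (globalRule α pos G K).conflict u v := by
  simp only [globalRule, harm_swap_left, Prod.fst_swap, Prod.snd_swap]
  ring

lemma globalRule_conflict_swap_right (u v : V × V) :
    (globalRule α pos G K).conflict u v.swap = (globalRule α pos G K).conflict u v := by
  rw [globalRule_conflict_comm, globalRule_conflict_swap_left, globalRule_conflict_comm]

/-! #### Feasible sets have small conflicts -/

lemma le_mul_add_of_le_mul {a b c t x y : ℝ} (ha : 0 ≤ a) (hb : 0 ≤ b) (hc : 0 ≤ c) (ht : 0 ≤ t)
    (hx : c ≤ t * x) (hy : c ≤ t * y) (hxy : x * y ≤ a * b) : c ≤ t * (a + b) := by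
  refine le_of_sq_le_sq ?_ (by positivity)
  calc c ^ 2 = c * c := sq c
    _ ≤ t * x * (t * y) := mul_le_mul hx hy hc (hc.trans hx)
    _ = t ^ 2 * (x * y) := by ring
    _ ≤ t ^ 2 * (a + b) ^ 2 := by
        gcongr
        nlinarith
    _ = (t * (a + b)) ^ 2 := by ring

lemma len_rpow_le_div_slack (hβ : 1 ≤ β) (hN : 0 ≤ N) (hlen : 0 < len pos v ^ α) (hP : 0 ≤ P v)
    (hs : 0 < slack α β N pos P v) : len pos v ^ α ≤ β * P v / slack α β N pos P v := by
  rw [le_div_iff₀ hs]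
  have := slack_le (α := α) (pos := pos) (P := P) (zero_le_one.trans hβ) hN v
  rw [le_div_iff₀' hlen] at this
  exact this.trans (le_mul_of_one_le_left hP hβ)

section Near

variable (hβ : 1 ≤ β) (hN : 0 ≤ N) (hu : 0 < len pos u ^ α) (hv : 0 < len pos v ^ α)
  (hPu : 0 ≤ P u) (hPv : 0 ≤ P v) (hsu : 0 < slack α β N pos P u)
  (hsv : 0 < slack α β N pos P v)

include hβ hN hu hv hPu hPv hsu hsv

lemma len_rpow_mul_div_att_mul_le :
    len pos u ^ α * len pos v ^ α / (att α pos u v * att α pos v u) ≤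
      relInterference α β N pos P u v * relInterference α β N pos P v u := by
  calc len pos u ^ α * len pos v ^ α / (att α pos u v * att α pos v u)
      ≤ β * P u / slack α β N pos P u * (β * P v / slack α β N pos P v) /
          (att α pos u v * att α pos v u) := by
        have huv := att_nonneg α pos u v
        have hvu := att_nonneg α pos v u
        gcongr
        · exact len_rpow_le_div_slack hβ hN hu hPu hsu
        · exact len_rpow_le_div_slack hβ hN hv hPv hsv
    _ = relInterference α β N pos P u v * relInterference α β N pos P v u := by
        rw [relInterference, relInterference, div_mul_div_comm, div_mul_div_comm, div_div]
        congr 1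
        ring

/-- The powers cancel in the product of the relative interferences of `u` at `v` and of `v` at
`u`. -/
lemma near_le_of_le_max {E E' : ℝ} {x y : V} (hh : 0 < h) (hhu : h ≤ len pos u ^ α)
    (hhv : h ≤ len pos v ^ α) (hE : 0 < E) (hE' : 0 < E')
    (hEE' : E * E' = att α pos u v * att α pos v u)
    (hEu : E ≤ 3 ^ α * max (len pos u ^ α) (dist (pos x) (pos y) ^ α))
    (hEv : E' ≤ 3 ^ α * max (len pos v ^ α) (dist (pos x) (pos y) ^ α)) :
    near α pos h x y ≤
      3 ^ α * (relInterference α β N pos P u v + relInterference α β N pos P v u) := by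
  have hβ0 : 0 ≤ β := zero_le_one.trans hβ
  have hnear {L F : ℝ} (hL : h ≤ L) (hF : 0 < F)
      (hFL : F ≤ 3 ^ α * max L (dist (pos x) (pos y) ^ α)) :
      near α pos h x y ≤ 3 ^ α * (L / F) := by
    have := div_add_le_mul_div hh (Real.rpow_nonneg dist_nonneg α) zero_le_one
      (hh.le.trans hL) one_pos (by positivity) hF hFL (mul_one L).le (by simpa only [mul_one])
    simpa only [mul_one, near] using this
  refine le_mul_add_of_le_mul (relInterference_nonneg hβ0 hPu hsv.le)
    (relInterference_nonneg hβ0 hPv hsu.le) (near_nonneg hh.le x y) (by positivity)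
    (hnear hhu hE hEu) (hnear hhv hE' hEv) ?_
  rw [div_mul_div_comm, hEE']
  exact len_rpow_mul_div_att_mul_le hβ hN hu hv hPu hPv hsu hsv

end Near

section Cover

variable [DecidableEq V] (hα : 0 < α) (hβ : 1 ≤ β) (hN : 0 ≤ N) (hpos : Function.Injective pos)
  (hS : ∀ v ∈ S, G.Adj v.1 v.2) (hfeas : Feasible α β N pos P S)
  (hw : G.Adj w.1 w.2) (hwS : ∀ v ∈ S, len pos w ≤ len pos v)
  (hrow : ∀ v ∈ S, ∑ u ∈ S.erase v, relInterference α β N pos P v u ≤ 2)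

include hα hβ hN hpos hS hfeas hw hwS

lemma Feasible.near_le_of_mem {E E' : ℝ} {x y : V} (hu : u ∈ S) (hv : v ∈ S) (hvu : v ≠ u)
    (hE : 0 < E) (hE' : 0 < E') (hEE' : E * E' = att α pos u v * att α pos v u)
    (hEu : E ≤ 3 ^ α * max (len pos u ^ α) (dist (pos x) (pos y) ^ α))
    (hEv : E' ≤ 3 ^ α * max (len pos v ^ α) (dist (pos x) (pos y) ^ α)) :
    near α pos (harm α pos w v) x y ≤
      3 ^ α * (relInterference α β N pos P u v + relInterference α β N pos P v u) := by
  have hβ0 : 0 < β := by linarith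
  have hharm (z) (hz : z ∈ S) : harm α pos w v ≤ len pos z ^ α :=
    (harm_le_left (len_rpow_pos hpos hw)).trans (Real.rpow_le_rpow dist_nonneg (hwS z hz) hα.le)
  exact near_le_of_le_max hβ hN (len_rpow_pos hpos (hS u hu)) (len_rpow_pos hpos (hS v hv))
    (hfeas u hu).1.le (hfeas v hv).1.le
    (hfeas.slack_pos hα hβ0 hN hv hu hvu (hpos.ne (hS u hu).ne))
    (hfeas.slack_pos hα hβ0 hN hu hv hvu.symm (hpos.ne (hS v hv).ne))
    (harm_pos (len_rpow_pos hpos hw) (len_rpow_pos hpos (hS v hv))) (hharm u hu) (hharm v hv)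
    hE hE' hEE' hEu hEv

include hrow

lemma Feasible.sum_near_receiver_le (x : V) :
    ∑ v ∈ S, near α pos (harm α pos w v) x v.2 ≤ 1 + 3 * 3 ^ α := by
  have hβ0 : 0 < β := by linarith
  refine sum_le_of_nearest (D := fun v => dist (pos x) (pos v.2)) (by positivity)
    (fun v _ => near_le_one (harm_nonneg w v) _ _) fun u hu hmin => ?_
  refine (sum_le_sum fun v hv => ?_).trans
    (hfeas.sum_relInterference_le_three hα hβ hN hpos hS hrow hu)
  obtain ⟨hvu, hv⟩ := mem_erase.1 hv
  have hnear := att_le_of_dist_receiver_le hα.le (hmin v hv)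
  exact hfeas.near_le_of_mem hα hβ hN hpos hS hw hwS hu hv hvu
    (att_pos (hfeas.ne hα hβ0 hu hv hvu.symm)) (att_pos (hfeas.ne hα hβ0 hv hu hvu)) rfl
    hnear.1 hnear.2

lemma Feasible.sum_near_sender_le (x : V) :
    ∑ v ∈ S, near α pos (harm α pos w v) x v.1 ≤ 1 + 3 * 3 ^ α := by
  have hβ0 : 0 < β := by linarith
  refine sum_le_of_nearest (D := fun v => dist (pos v.1) (pos x)) (by positivity)
    (fun v _ => near_le_one (harm_nonneg w v) _ _) fun u hu hmin => ?_
  refine (sum_le_sum fun v hv => ?_).trans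
    (hfeas.sum_relInterference_le_three hα hβ hN hpos hS hrow hu)
  obtain ⟨hvu, hv⟩ := mem_erase.1 hv
  have hnear := att_le_of_dist_sender_le hα.le (hmin v hv)
  rw [near_comm]
  exact hfeas.near_le_of_mem hα hβ hN hpos hS hw hwS hu hv hvu
    (att_pos (hfeas.ne hα hβ0 hv hu hvu)) (att_pos (hfeas.ne hα hβ0 hu hv hvu.symm))
    (mul_comm _ _) hnear.1 hnear.2

end Cover

lemma Feasible.exists_large_globalRule_conflict_le [DecidableEq V] (hα : 0 < α) (hβ : 1 ≤ β)
    (hN : 0 ≤ N) (hpos : Function.Injective pos) (hO : ∀ v ∈ O, G.Adj v.1 v.2)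
    (hfeas : Feasible α β N pos P O) :
    ∃ O' ⊆ O, #O ≤ 2 * #O' ∧ (∀ v ∈ O', (globalRule α pos G K).Usable v) ∧
      ∀ w, (globalRule α pos G K).Usable w →
        ∑ v ∈ O' with (globalRule α pos G K).len w ≤ (globalRule α pos G K).len v,
          (globalRule α pos G K).conflict w v ≤ 4 * (1 + 3 * 3 ^ α) := by
  have hβ0 : 0 < β := by linarith
  have hne (v) (hv : v ∈ O) : pos v.1 ≠ pos v.2 := hpos.ne (hO v hv).ne
  have hnonneg (u) (hu : u ∈ O) (v) (hv : v ∈ O) : 0 ≤ relInterference α β N pos P u v :=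
    relInterference_nonneg hβ0.le (hfeas u hu).1.le (hfeas.slack_nonneg hα hβ0 hN hv (hne v hv))
  obtain ⟨O', hO', hcard, hrow⟩ := exists_large_sum_erase_le_two hnonneg fun v hv =>
    hfeas.sum_relInterference_le_one hα hβ0 hN hv (hne v hv)
  refine ⟨O', hO', hcard, fun v hv => hO v (hO' hv), fun w hw => ?_⟩
  set S := {v ∈ O' | len pos w ≤ len pos v}
  have hSO : S ⊆ O := (filter_subset _ _).trans hO'
  have hSadj : ∀ v ∈ S, G.Adj v.1 v.2 := fun v hv => hO v (hSO hv)
  have hrowS (v) (hv : v ∈ S) : ∑ u ∈ S.erase v, relInterference α β N pos P v u ≤ 2 :=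
    (sum_le_sum_of_subset_of_nonneg (erase_subset_erase _ hSO) fun u hu _ =>
      hnonneg v (hSO hv) u (mem_of_mem_erase hu)).trans (hrow v (mem_of_mem_filter v hv))
  have hwS : ∀ v ∈ S, len pos w ≤ len pos v := fun v hv => (mem_filter.1 hv).2
  have hrec := (hfeas.mono hSO).sum_near_receiver_le hα hβ hN hpos hSadj hw hwS hrowS
  have hsnd := (hfeas.mono hSO).sum_near_sender_le hα hβ hN hpos hSadj hw hwS hrowS
  change ∑ v ∈ S, (_ + _) ≤ _
  rw [sum_add_distrib, sum_add_distrib, sum_add_distrib]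
  linarith [hrec w.1, hrec w.2, hsnd w.1, hsnd w.2]

/-! #### Links of small load can transmit simultaneously -/

lemma le_dist_rpow_of_near_le_half {x y : V} (hh : 0 < h) (hle : near α pos h x y ≤ 1 / 2) :
    h ≤ dist (pos x) (pos y) ^ α := by
  have hd : 0 ≤ dist (pos x) (pos y) ^ α := Real.rpow_nonneg dist_nonneg α
  rw [near, div_le_iff₀ (add_pos_of_pos_of_nonneg hh hd)] at hle
  linarith

lemma div_dist_rpow_le_two_mul_near {x y : V} (hh : 0 < h) (hle : near α pos h x y ≤ 1 / 2) :
    h / dist (pos x) (pos y) ^ α ≤ 2 * near α pos h x y := by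
  have hd := le_dist_rpow_of_near_le_half hh hle
  rw [near, mul_div_assoc', div_le_div_iff₀ (hh.trans_le hd) (by positivity)]
  linarith [mul_le_mul_of_nonneg_left hd hh.le]

lemma near_add_near_le_globalRule_conflict (u v : V × V) :
    near α pos (harm α pos u v) u.1 v.2 + near α pos (harm α pos u v) v.1 u.2 ≤
      (globalRule α pos G K).conflict u v := by
  have hh := harm_nonneg (α := α) (pos := pos) u v
  rw [near_comm _ v.1 u.2]
  simp only [globalRule]
  linarith [near_nonneg (α := α) (pos := pos) hh u.1 v.1,
    near_nonneg (α := α) (pos := pos) hh u.2 v.2]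

section Conflict

variable (hpos : Function.Injective pos) (hu : G.Adj u.1 u.2) (hv : G.Adj v.1 v.2)
  (huv : (globalRule α pos G K).conflict u v ≤ 1 / 2)

include hpos hu hv huv

lemma ne_of_globalRule_conflict_le (hα : 0 < α) : pos u.1 ≠ pos v.2 := by
  have hh := harm_pos (α := α) (len_rpow_pos hpos hu) (len_rpow_pos hpos hv)
  refine ne_of_att_pos hα (hh.trans_le (le_dist_rpow_of_near_le_half hh ?_))
  exact (le_add_of_nonneg_right (near_nonneg hh.le _ _)).trans
    ((near_add_near_le_globalRule_conflict u v).trans huv)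

lemma len_rpow_div_att_add_le (hα : 0 ≤ α) (hlen : len pos u ≤ len pos v) :
    len pos u ^ α / att α pos u v + len pos u ^ α / att α pos v u ≤
      4 * (globalRule α pos G K).conflict u v := by
  have hLu := len_rpow_pos (α := α) hpos hu
  have hh := harm_pos hLu (len_rpow_pos (α := α) hpos hv)
  have hle := near_add_near_le_globalRule_conflict (α := α) (pos := pos) (G := G) (K := K) u v
  have hharm := le_two_mul_harm hLu (Real.rpow_le_rpow dist_nonneg hlen hα)
  have hdiv {x y : V} (hxy : near α pos (harm α pos u v) x y ≤ 1 / 2) :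
      len pos u ^ α / dist (pos x) (pos y) ^ α ≤ 4 * near α pos (harm α pos u v) x y := calc
    _ ≤ 2 * harm α pos u v / dist (pos x) (pos y) ^ α := by gcongr
    _ = 2 * (harm α pos u v / dist (pos x) (pos y) ^ α) := mul_div_assoc _ _ _
    _ ≤ 2 * (2 * near α pos (harm α pos u v) x y) := by
        gcongr
        exact div_dist_rpow_le_two_mul_near hh hxy
    _ = 4 * near α pos (harm α pos u v) x y := by ring
  have hnonneg := near_nonneg (α := α) (pos := pos) hh.le
  have huv' := hdiv (x := u.1) (y := v.2) (by linarith [hnonneg v.1 u.2])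
  have hvu' := hdiv (x := v.1) (y := u.2) (by linarith [hnonneg u.1 v.2])
  simp only [att]
  linarith

end Conflict

section Load

variable [DecidableEq V] {η : ℝ} (hα : 0 < α) (hpos : Function.Injective pos)
  (hS : ∀ v ∈ S, G.Adj v.1 v.2) (hη : η ≤ 1 / 4)
  (hload : ∀ v ∈ S, (globalRule α pos G K).load S v ≤ η)

include hload in
lemma globalRule_conflict_le_of_load_le (hu : u ∈ S) (hv : v ∈ S) (huv : u ≠ v) :
    (globalRule α pos G K).conflict u v ≤ η :=
  (single_le_sum (f := fun u => (globalRule α pos G K).conflict u v)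
    (fun u _ => globalRule_conflict_nonneg u v) (mem_erase.2 ⟨huv, hu⟩)).trans (hload v hv)

include hα hpos hS hη hload

lemma ne_of_globalRule_load_le (hu : u ∈ S) (hv : v ∈ S) : pos u.1 ≠ pos v.2 := by
  rcases eq_or_ne u v with rfl | huv
  · exact hpos.ne (hS u hu).ne
  · exact ne_of_globalRule_conflict_le hpos (hS u hu) (hS v hv)
      ((globalRule_conflict_le_of_load_le hload hu hv huv).trans (by linarith)) hα

lemma sum_len_rpow_div_att_le (hv : v ∈ S) (hT : T ⊆ S.erase v)
    (hlen : ∀ w ∈ T, len pos w ≤ len pos v) :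
    ∑ w ∈ T, (len pos w ^ α / att α pos w v + len pos w ^ α / att α pos v w) ≤ 4 * η :=
  calc ∑ w ∈ T, (len pos w ^ α / att α pos w v + len pos w ^ α / att α pos v w)
      ≤ ∑ w ∈ T, 4 * (globalRule α pos G K).conflict w v := by
        refine sum_le_sum fun w hw => ?_
        obtain ⟨hwv, hwS⟩ := mem_erase.1 (hT hw)
        exact len_rpow_div_att_add_le hpos (hS w hwS) (hS v hv)
          ((globalRule_conflict_le_of_load_le hload hwS hv hwv).trans (by linarith)) hα.le
          (hlen w hw)
    _ ≤ ∑ w ∈ S.erase v, 4 * (globalRule α pos G K).conflict w v :=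
        sum_le_sum_of_subset_of_nonneg hT fun w _ _ =>
          mul_nonneg zero_le_four (globalRule_conflict_nonneg w v)
    _ = 4 * (globalRule α pos G K).load S v := (mul_sum _ _ _).symm
    _ ≤ 4 * η := by linarith [hload v hv]

lemma len_le_dist_of_globalRule_load_le (hw : w ∈ S) (hv : v ∈ S) (hwv : w ≠ v)
    (hlen : len pos w ≤ len pos v) : len pos w ≤ dist (pos w.1) (pos v.2) := by
  have hsum := sum_len_rpow_div_att_le hα hpos hS hη hload hv
    (singleton_subset_iff.2 (mem_erase.2 ⟨hwv, hw⟩)) (by simpa only [mem_singleton, forall_eq])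
  rw [sum_singleton] at hsum
  have hnonneg : 0 ≤ len pos w ^ α / att α pos v w :=
    div_nonneg (len_rpow_nonneg w) (att_nonneg _ _ _ _)
  have hle : len pos w ^ α / att α pos w v ≤ 1 := by linarith
  rw [div_le_one (att_pos (ne_of_globalRule_load_le hα hpos hS hη hload hw hv))] at hle
  exact (Real.rpow_le_rpow_iff dist_nonneg dist_nonneg hα).1 hle

end Load

lemma att_le_of_len_le_dist (hα : 0 ≤ α) (h : len pos w ≤ dist (pos w.1) (pos v.2)) :
    att α pos u v ≤ 3 ^ α * max (att α pos u w) (att α pos w v) := by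
  refine rpow_le_of_le_add_two_mul hα dist_nonneg dist_nonneg dist_nonneg ?_
  have htri := dist_triangle4 (pos u.1) (pos w.2) (pos w.1) (pos v.2)
  rw [dist_comm (pos w.2)] at htri
  rw [len] at h
  linarith

/-- The lengths of the links, with ties broken arbitrarily. -/
noncomputable def lenKey (pos : V → X) (v : V × V) : ℝ ×ₗ Cardinal :=
  toLex (len pos v, embeddingToCardinal v)

lemma lenKey_injective : Function.Injective (lenKey pos) := fun _ _ h =>
  embeddingToCardinal.injective (congrArg (fun z => (ofLex z).2) h)

lemma len_le_of_lenKey_lt (h : lenKey pos u < lenKey pos v) : len pos u ≤ len pos v :=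
  (Prod.Lex.toLex_lt_toLex.1 h).elim le_of_lt fun h => h.1.le

lemma exists_feasible_of_globalRule_load_le [DecidableEq V] (hα : 0 < α) (hβ : 1 ≤ β) (hN : 0 ≤ N)
    (hpos : Function.Injective pos) (hK : 512 * β ^ 2 * 3 ^ α ≤ K) (hS : ∀ v ∈ S, G.Adj v.1 v.2)
    (hload : ∀ v ∈ S, K * (globalRule α pos G K).load S v ≤ 4) :
    ∃ P : V × V → ℝ, Feasible α β N pos P S := by
  have ht : (1 : ℝ) ≤ 3 ^ α := Real.one_le_rpow (by norm_num) hα.le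
  have hK512 : (512 : ℝ) ≤ K := by
    linarith [one_le_mul_of_one_le_of_one_le (one_le_pow₀ hβ (n := 2)) ht]
  have hK0 : (0 : ℝ) < K := by linarith
  have hη : (4 : ℝ) / K ≤ 1 / 4 := by
    rw [div_le_iff₀ hK0]
    linarith
  have hload' (v) (hv : v ∈ S) : (globalRule α pos G K).load S v ≤ 4 / K :=
    (le_div_iff₀' hK0).2 (hload v hv)
  have hne (u) (hu : u ∈ S) (v) (hv : v ∈ S) : pos u.1 ≠ pos v.2 :=
    ne_of_globalRule_load_le hα hpos hS hη hload' hu hv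
  have hlt_ne {u v} (h : lenKey pos u < lenKey pos v) : u ≠ v := fun huv => h.ne (by rw [huv])
  obtain ⟨P, hP⟩ := exists_powers (S := S) (E := att α pos) (N := N) (η := 4 * (4 / K))
    (fun u hu v hv => att_pos (hne u hu v hv))
    (fun v hv => sum_len_rpow_div_att_le hα hpos hS hη hload' hv
      (fun w hw => mem_erase.2 ⟨hlt_ne (mem_filter.1 hw).2, mem_of_mem_filter w hw⟩)
      fun w hw => len_le_of_lenKey_lt (mem_filter.1 hw).2)
    (fun u _ v hv w hw _ hwv => att_le_of_len_le_dist hα.le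
      (len_le_dist_of_globalRule_load_le hα hpos hS hη hload' hw hv (hlt_ne hwv)
        (len_le_of_lenKey_lt hwv)))
    lenKey_injective hβ hN ht (by positivity)
    (by rw [← mul_div_assoc, ← mul_div_assoc, div_le_one hK0]; linarith)
  exact ⟨P, feasible_of_mul_interference_le (by linarith) hN (fun v hv => (hP v hv).1) hne
    fun v hv => (hP v hv).2⟩

end SINR

/-! ### Reasoning about programs -/

namespace RealRAM

/-- The arrays of natural numbers which a program may write. -/
def Program.natMods : Program → Finset ℕ
  | .skip => ∅
  | .setNat A _ _ _ => {A}
  | .setReal _ _ _ _ => ∅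
  | .seq p q => p.natMods ∪ q.natMods
  | .ite _ p q => p.natMods ∪ q.natMods
  | .loop _ p => p.natMods

/-- The arrays of real numbers which a program may write. -/
def Program.realMods : Program → Finset ℕ
  | .skip => ∅
  | .setNat _ _ _ _ => ∅
  | .setReal A _ _ _ => {A}
  | .seq p q => p.realMods ∪ q.realMods
  | .ite _ p q => p.realMods ∪ q.realMods
  | .loop _ p => p.realMods

/-- A bound for the number of steps, provided that no loop makes more than `n` iterations. -/
def Program.bound (n : ℕ) : Program → ℕ
  | .skip => 1
  | .setNat _ i j e => i.cost + j.cost + e.cost + 1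
  | .setReal _ i j e => i.cost + j.cost + e.cost + 1
  | .seq p q => p.bound n + q.bound n
  | .ite b p q => b.cost + (p.bound n + q.bound n)
  | .loop b p => n * (b.cost + p.bound n) + b.cost

lemma Program.exists_polynomial (p : Program) :
    ∃ q : Polynomial ℕ, ∀ n, p.bound n = q.eval n := by
  induction p with
  | skip => exact ⟨1, fun n => by simp [bound]⟩
  | setNat A i j e =>
    exact ⟨Polynomial.C (i.cost + j.cost + e.cost + 1), fun n => by rw [Polynomial.eval_C, bound]⟩
  | setReal A i j e =>
    exact ⟨Polynomial.C (i.cost + j.cost + e.cost + 1), fun n => by rw [Polynomial.eval_C, bound]⟩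
  | seq p q ihp ihq =>
    obtain ⟨a, ha⟩ := ihp
    obtain ⟨b, hb⟩ := ihq
    exact ⟨a + b, fun n => by rw [bound, ha, hb, Polynomial.eval_add]⟩
  | ite c p q ihp ihq =>
    obtain ⟨a, ha⟩ := ihp
    obtain ⟨b, hb⟩ := ihq
    exact ⟨Polynomial.C c.cost + (a + b), fun n => by
      rw [bound, ha, hb, Polynomial.eval_add, Polynomial.eval_add, Polynomial.eval_C]⟩
  | loop c p ihp =>
    obtain ⟨a, ha⟩ := ihp
    exact ⟨Polynomial.X * (Polynomial.C c.cost + a) + Polynomial.C c.cost, fun n => by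
      rw [bound, ha, Polynomial.eval_add, Polynomial.eval_mul, Polynomial.eval_add,
        Polynomial.eval_C, Polynomial.eval_X]⟩

/-- `τ` differs from `σ` at most in arrays which `p` may write. -/
def Frame (p : Program) (σ τ : Memory) : Prop :=
  (∀ A, A ∉ p.natMods → τ.nat A = σ.nat A) ∧ ∀ A, A ∉ p.realMods → τ.real A = σ.real A

lemma Frame.refl (p : Program) (σ : Memory) : Frame p σ σ := ⟨fun _ _ => rfl, fun _ _ => rfl⟩

lemma Frame.trans {p : Program} {σ τ υ : Memory} (h : Frame p σ τ) (h' : Frame p τ υ) :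
    Frame p σ υ :=
  ⟨fun A hA => (h'.1 A hA).trans (h.1 A hA), fun A hA => (h'.2 A hA).trans (h.2 A hA)⟩

lemma Frame.mono {p q : Program} {σ τ : Memory} (h : Frame p σ τ) (hn : p.natMods ⊆ q.natMods)
    (hr : p.realMods ⊆ q.realMods) : Frame q σ τ :=
  ⟨fun A hA => h.1 A fun h' => hA (hn h'), fun A hA => h.2 A fun h' => hA (hr h')⟩

lemma Memory.writeNat_nat_of_ne {σ : Memory} {A B i j a : ℕ} (h : B ≠ A) :
    (σ.writeNat A i j a).nat B = σ.nat B := by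
  funext i' j'
  exact if_neg fun h' => h h'.1

lemma Memory.writeReal_real_of_ne {σ : Memory} {A B i j : ℕ} {a : ℝ} (h : B ≠ A) :
    (σ.writeReal A i j a).real B = σ.real B := by
  funext i' j'
  exact if_neg fun h' => h h'.1

lemma Memory.writeNat_nat_self (σ : Memory) (A i j a : ℕ) : (σ.writeNat A i j a).nat A i j = a :=
  if_pos ⟨rfl, rfl, rfl⟩

lemma Frame.writeNat {p : Program} (σ : Memory) {A : ℕ} (i j a : ℕ) (hA : A ∈ p.natMods) :
    Frame p σ (σ.writeNat A i j a) :=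
  ⟨fun _ hB => Memory.writeNat_nat_of_ne (ne_of_mem_of_not_mem hA hB).symm, fun _ _ => rfl⟩

lemma Exec.frame {α : ℝ} {p : Program} {σ τ : Memory} {t : ℕ} (h : Exec α p σ τ t) :
    Frame p σ τ := by
  induction h with
  | skip σ => exact Frame.refl _ _
  | setNat A i j e σ =>
    refine ⟨fun B hB => Memory.writeNat_nat_of_ne ?_, fun _ _ => rfl⟩
    simpa only [Program.natMods, Finset.mem_singleton] using hB
  | setReal A i j e σ =>
    refine ⟨fun _ _ => rfl, fun B hB => Memory.writeReal_real_of_ne ?_⟩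
    simpa only [Program.realMods, Finset.mem_singleton] using hB
  | seq _ _ ih1 ih2 =>
    exact (ih1.mono Finset.subset_union_left Finset.subset_union_left).trans
      (ih2.mono Finset.subset_union_right Finset.subset_union_right)
  | iteTrue _ _ ih => exact ih.mono Finset.subset_union_left Finset.subset_union_left
  | iteFalse _ _ ih => exact ih.mono Finset.subset_union_right Finset.subset_union_right
  | loopDone _ => exact Frame.refl _ _
  | loopStep _ _ _ ih1 ih2 =>
    exact (ih1.mono (Finset.Subset.refl _) (Finset.Subset.refl _)).trans ih2

/-- Started with memory `σ`, the program `p` halts within `p.bound n` steps with a memory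
satisfying `Q`. -/
def Run (α : ℝ) (n : ℕ) (p : Program) (σ : Memory) (Q : Memory → Prop) : Prop :=
  ∃ τ t, Exec α p σ τ t ∧ t ≤ p.bound n ∧ Q τ

variable {α : ℝ} {n : ℕ} {p q : Program} {σ : Memory} {Q Q' : Memory → Prop}

lemma Run.mono (h : Run α n p σ Q) (hQ : ∀ τ, Frame p σ τ → Q τ → Q' τ) : Run α n p σ Q' := by
  obtain ⟨τ, t, he, ht, hq⟩ := h
  exact ⟨τ, t, he, ht, hQ τ he.frame hq⟩

lemma run_skip (h : Q σ) : Run α n .skip σ Q := ⟨σ, 1, .skip σ, le_rfl, h⟩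

lemma run_setNat {A : ℕ} {i j e : NatExpr}
    (h : Q (σ.writeNat A (i.eval σ) (j.eval σ) (e.eval σ))) : Run α n (.setNat A i j e) σ Q :=
  ⟨_, _, .setNat A i j e σ, le_rfl, h⟩

lemma run_setReal {A : ℕ} {i j : NatExpr} {e : RealExpr}
    (h : Q (σ.writeReal A (i.eval σ) (j.eval σ) (e.eval α σ))) : Run α n (.setReal A i j e) σ Q :=
  ⟨_, _, .setReal A i j e σ, le_rfl, h⟩

lemma run_seq (h : Run α n p σ fun σ' => Run α n q σ' Q) : Run α n (.seq p q) σ Q := by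
  obtain ⟨σ', s, h1, hs, τ, t, h2, ht, hq⟩ := h
  exact ⟨τ, s + t, .seq h1 h2, Nat.add_le_add hs ht, hq⟩

lemma run_ite {b : Cond} (h1 : b.eval α σ → Run α n p σ Q) (h2 : ¬ b.eval α σ → Run α n q σ Q) :
    Run α n (.ite b p q) σ Q := by
  by_cases hb : b.eval α σ
  · obtain ⟨τ, t, he, ht, hq⟩ := h1 hb
    exact ⟨τ, _, .iteTrue hb he, by simp only [Program.bound]; omega, hq⟩
  · obtain ⟨τ, t, he, ht, hq⟩ := h2 hb
    exact ⟨τ, _, .iteFalse hb he, by simp only [Program.bound]; omega, hq⟩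

/-- The number in the first cell of an array. -/
def cell (A : ℕ) : NatExpr := .get A (.lit 0) (.lit 0)

/-- Execution of `p` with the values `0, …, n - 1` in the first cell of array `c`, where `n` is
the number of nodes. -/
def forLoop (c : ℕ) (p : Program) : Program :=
  .seq (.setNat c (.lit 0) (.lit 0) (.lit 0))
    (.loop (.neg (.natLe (cell 0) (cell c)))
      (.seq p (.setNat c (.lit 0) (.lit 0) (.add (cell c) (.lit 1)))))

lemma cell_eval (A : ℕ) (σ : Memory) : (cell A).eval σ = σ.nat A 0 0 := rfl

lemma run_loop {b : Cond} (Inv : ℕ → Memory → Prop)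
    (hstep : ∀ k < n, ∀ σ, Inv k σ → b.eval α σ ∧ Run α n p σ (Inv (k + 1)))
    (hend : ∀ σ, Inv n σ → ¬ b.eval α σ) (h0 : Inv 0 σ) : Run α n (.loop b p) σ (Inv n) := by
  have hloop : ∀ m ≤ n, ∀ σ, Inv (n - m) σ →
      ∃ τ t, Exec α (.loop b p) σ τ t ∧ t ≤ m * (b.cost + p.bound n) + b.cost ∧ Inv n τ := by
    intro m
    induction m with
    | zero => exact fun _ σ hσ => ⟨σ, b.cost, .loopDone (hend σ hσ), by omega, hσ⟩
    | succ m ih =>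
      intro hm σ hσ
      obtain ⟨hb, σ', s, hexec, hs, hσ'⟩ := hstep (n - (m + 1)) (by omega) σ hσ
      rw [show n - (m + 1) + 1 = n - m by omega] at hσ'
      obtain ⟨τ, t, hexec', ht, hτ⟩ := ih (by omega) σ' hσ'
      refine ⟨τ, _, .loopStep hb hexec hexec', ?_, hτ⟩
      rw [Nat.succ_mul]
      omega
  exact hloop n le_rfl σ (by rwa [Nat.sub_self])

lemma natMods_forLoop (c : ℕ) (p : Program) : (forLoop c p).natMods = insert c p.natMods := by
  ext A
  simp [forLoop, Program.natMods]

@[simp] lemma realMods_forLoop (c : ℕ) (p : Program) : (forLoop c p).realMods = p.realMods := by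
  ext A
  simp [forLoop, Program.realMods]

lemma Frame.forLoop {τ : Memory} {c : ℕ} (h : Frame p σ τ) : Frame (forLoop c p) σ τ :=
  h.mono (natMods_forLoop c p ▸ Finset.subset_insert c _) (realMods_forLoop c p).ge

lemma run_forLoop {c : ℕ} (Inv : ℕ → Memory → Prop) (hc : c ≠ 0) (hp0 : 0 ∉ p.natMods)
    (hpc : c ∉ p.natMods) (hn : σ.nat 0 0 0 = n)
    (hinv : ∀ k σ x, Inv k σ → Inv k (σ.writeNat c 0 0 x)) (h0 : Inv 0 σ)
    (hstep : ∀ k < n, ∀ σ', Frame (forLoop c p) σ σ' → Inv k σ' → σ'.nat c 0 0 = k →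
      Run α n p σ' (Inv (k + 1))) :
    Run α n (forLoop c p) σ (Inv n) := by
  have hc_mem : c ∈ (forLoop c p).natMods := natMods_forLoop c p ▸ Finset.mem_insert_self c _
  have h0_notMem : 0 ∉ (forLoop c p).natMods := by
    rw [natMods_forLoop, Finset.mem_insert]
    tauto
  have hguard (k : ℕ) {σ' : Memory} (hf : Frame (forLoop c p) σ σ') (hk : σ'.nat c 0 0 = k) :
      (Cond.neg (.natLe (cell 0) (cell c))).eval α σ' ↔ k < n := by
    simp only [Cond.eval, cell_eval, hk, hf.1 0 h0_notMem, hn, not_le]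
  refine run_seq (run_setNat ?_)
  refine (run_loop (fun k σ' => Frame (forLoop c p) σ σ' ∧ Inv k σ' ∧ σ'.nat c 0 0 = k)
    (fun k hk σ' ⟨hf, hi, hck⟩ => ⟨(hguard k hf hck).2 hk, ?_⟩)
    (fun σ' ⟨hf, _, hck⟩ => mt (hguard n hf hck).1 (lt_irrefl n))
    ⟨.writeNat σ _ _ _ hc_mem, hinv _ _ _ h0, Memory.writeNat_nat_self ..⟩).mono
      fun _ _ hτ => hτ.2.1
  refine run_seq ((hstep k hk σ' hf hi hck).mono fun τ hτ hi' => run_setNat ?_)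
  have hck' : τ.nat c 0 0 = k := (congrFun₂ (hτ.1 c hpc) 0 0).trans hck
  simp only [NatExpr.eval, cell_eval, hck']
  exact ⟨(hf.trans hτ.forLoop).trans (.writeNat τ _ _ _ hc_mem), hinv _ _ _ hi',
    Memory.writeNat_nat_self ..⟩

lemma run_forFin {c : ℕ} (Inv : Finset (Fin n) → Memory → Prop) (hc : c ≠ 0)
    (hp0 : 0 ∉ p.natMods) (hpc : c ∉ p.natMods) (hn : σ.nat 0 0 0 = n)
    (hinv : ∀ D σ x, Inv D σ → Inv D (σ.writeNat c 0 0 x)) (h0 : Inv ∅ σ)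
    (hstep : ∀ D (x : Fin n), x ∉ D → ∀ σ', Frame (forLoop c p) σ σ' → Inv D σ' →
      σ'.nat c 0 0 = x → Run α n p σ' (Inv (insert x D))) :
    Run α n (forLoop c p) σ (Inv Finset.univ) := by
  have h := run_forLoop (α := α) (n := n) (p := p) (σ := σ) (c := c)
    (fun k => Inv (Finset.univ.filter fun x : Fin n => (x : ℕ) < k)) hc hp0 hpc hn
    (fun k σ x h => hinv _ σ x h) (by simpa using h0) ?_
  · simpa using h
  · intro k hk σ' hf hi hck
    refine (hstep _ ⟨k, hk⟩ (by simp) σ' hf hi hck).mono fun τ _ hτ => ?_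
    convert hτ using 1
    ext x
    simp only [Finset.mem_filter, Finset.mem_univ, true_and, Finset.mem_insert, Fin.ext_iff]
    omega

/-- Execution of `p` for all pairs of nodes, which are found in the first cells of the arrays `c`
and `d`. -/
def forPairs (c d : ℕ) (p : Program) : Program := forLoop c (forLoop d p)

lemma natMods_forPairs (c d : ℕ) (p : Program) :
    (forPairs c d p).natMods = insert c (insert d p.natMods) := by
  rw [forPairs, natMods_forLoop, natMods_forLoop]

@[simp] lemma realMods_forPairs (c d : ℕ) (p : Program) :
    (forPairs c d p).realMods = p.realMods := by
  rw [forPairs, realMods_forLoop, realMods_forLoop]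

lemma run_forPairs {c d : ℕ} (Inv : Finset (Fin n × Fin n) → Memory → Prop) (hc : c ≠ 0)
    (hd : d ≠ 0) (hcd : c ≠ d) (hp0 : 0 ∉ p.natMods) (hpc : c ∉ p.natMods) (hpd : d ∉ p.natMods)
    (hn : σ.nat 0 0 0 = n)
    (hinvc : ∀ D σ x, Inv D σ → Inv D (σ.writeNat c 0 0 x))
    (hinvd : ∀ D σ x, Inv D σ → Inv D (σ.writeNat d 0 0 x)) (h0 : Inv ∅ σ)
    (hstep : ∀ D (v : Fin n × Fin n), v ∉ D → ∀ σ', Frame (forPairs c d p) σ σ' → Inv D σ' →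
      σ'.nat c 0 0 = v.1 → σ'.nat d 0 0 = v.2 → Run α n p σ' (Inv (insert v D))) :
    Run α n (forPairs c d p) σ (Inv Finset.univ) := by
  have hmods (A : ℕ) : A ∈ (forLoop d p).natMods ↔ A = d ∨ A ∈ p.natMods := by
    rw [natMods_forLoop, Finset.mem_insert]
  have h0_notMem : 0 ∉ (forLoop d p).natMods := by rw [hmods]; tauto
  have hc_notMem : c ∉ (forLoop d p).natMods := by rw [hmods]; tauto
  have hrow (D : Finset (Fin n)) (x : Fin n) (hx : x ∉ D) (σ' : Memory)
      (hf : Frame (forPairs c d p) σ σ') (hi : Inv (D ×ˢ Finset.univ) σ')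
      (hcx : σ'.nat c 0 0 = x) :
      Run α n (forLoop d p) σ' (Inv (D ×ˢ Finset.univ ∪ {x} ×ˢ Finset.univ)) := by
    refine run_forFin (fun D' => Inv (D ×ˢ Finset.univ ∪ {x} ×ˢ D')) hd hp0 hpd ?_
      (fun _ _ _ => hinvd _ _ _) (by simpa using hi) fun D' y hy σ'' hf' hi' hdy => ?_
    · rw [hf.1 0 (by rw [natMods_forPairs, ← natMods_forLoop, Finset.mem_insert]; tauto), hn]
    · refine (hstep _ (x, y) (by simp [hx, hy]) σ'' (hf.trans hf'.forLoop) hi'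
        ((congrFun₂ (hf'.1 c hc_notMem) 0 0).trans hcx) hdy).mono fun τ _ hτ => ?_
      rwa [Finset.insert_eq y, Finset.product_union, Finset.singleton_product_singleton,
        Finset.union_left_comm, ← Finset.insert_eq]
  have h := run_forFin (p := forLoop d p) (fun D => Inv (D ×ˢ Finset.univ)) hc h0_notMem hc_notMem
    hn (fun _ _ _ => hinvc _ _ _) (by simpa using h0) fun D x hx σ' hf hi hcx =>
      (hrow D x hx σ' hf hi hcx).mono fun τ _ hτ => ?_
  · rwa [Finset.univ_product_univ] at h
  · rwa [Finset.insert_eq, Finset.union_product, Finset.union_comm]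

end RealRAM

/-! ### Schedules -/

namespace ConnSched

open Finset

variable {V : Type*} [DecidableEq V] {F X D : Finset (V × V)} {c : Sym2 V → ℕ} {k r i : ℕ}

/-- The coloring `c` after giving the color `r` to the links of `X`. -/
def recolor (c : Sym2 V → ℕ) (X : Finset (V × V)) (r : ℕ) : Sym2 V → ℕ :=
  (X.image fun v => s(v.1, v.2)).piecewise (fun _ => r) c

lemma recolor_empty (c : Sym2 V → ℕ) (r : ℕ) : recolor c ∅ r = c := piecewise_empty ..

lemma recolor_insert (c : Sym2 V → ℕ) (X : Finset (V × V)) (r : ℕ) (v : V × V) :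
    recolor c (insert v X) r = Function.update (recolor c X r) s(v.1, v.2) r := by
  rw [recolor, image_insert, piecewise_insert, recolor]

lemma recolor_of_mem {v : V × V} (hv : v ∈ X) : recolor c X r s(v.1, v.2) = r :=
  piecewise_eq_of_mem _ _ _ (mem_image_of_mem _ hv)

lemma recolor_of_joined [Finite V] (hX : IsForestOver F X) {v : V × V} (hv : Joined F v.1 v.2) :
    recolor c X r s(v.1, v.2) = c s(v.1, v.2) := by
  refine piecewise_eq_of_notMem _ _ _ fun hmem => ?_
  obtain ⟨x, hx, hxv⟩ := mem_image.1 hmem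
  have hx' : Joined F x.1 x.2 := by
    rcases Sym2.eq_iff.1 hxv with ⟨h1, h2⟩ | ⟨h1, h2⟩
    · rwa [h1, h2]
    · rw [h1, h2]
      exact hv.symm
  exact hX.not_joined_erase hx (hx'.mono subset_union_left)

lemma slot_union_recolor [Finite V] (hX : IsForestOver F X) (c : Sym2 V → ℕ) (r i : ℕ) :
    slot (F ∪ X) (recolor c X r) i = slot F c i ∪ if i = r then X else ∅ := by
  rw [slot, filter_union, slot]
  congr 1
  · exact filter_congr fun v hv => by rw [recolor_of_joined hX (joined_of_mem hv)]
  · rw [filter_congr fun v hv => by rw [recolor_of_mem hv], filter_const]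
    simp only [eq_comm]

namespace Rule

/-- The links `F` are the result of `r` rounds, the coloring `c` gives each of them the number of
its round, and all colors that occur are below `k`, where `k` is as small as possible. -/
structure IsSchedule (R : Rule V) (F : Finset (V × V)) (c : Sym2 V → ℕ) (k r : ℕ) : Prop where
  isTrace : R.IsTrace (slot F c) r
  color_lt : ∀ v ∈ F, c s(v.1, v.2) < k
  le : k ≤ r
  slot_nonempty : k ≠ 0 → (slot F c (k - 1)).Nonempty

variable {R : Rule V}

lemma IsSchedule.zero (R : Rule V) (c : Sym2 V → ℕ) : R.IsSchedule ∅ c 0 0 where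
  isTrace q hq := absurd hq q.not_lt_zero
  color_lt := by simp
  le := le_rfl
  slot_nonempty h := absurd rfl h

lemma IsSchedule.selected_slot (h : R.IsSchedule F c k r) : selected (slot F c) r = F := by
  ext v
  simp only [selected, slot, mem_biUnion, mem_range, mem_filter]
  exact ⟨fun ⟨_, _, hv, _⟩ => hv, fun hv => ⟨_, (h.color_lt v hv).trans_le h.le, hv, rfl⟩⟩

lemma IsSchedule.isRound (h : R.IsSchedule F c k r) (hi : i < k) :
    ∃ E, R.IsRound E (slot F c i) :=
  ⟨_, h.isTrace i (hi.trans_le h.le)⟩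

variable [Finite V] {G : SimpleGraph V} {C : ℝ} {χ : ℕ}

lemma IsSchedule.isForestOver (h : R.IsSchedule F c k r) : IsForestOver ∅ F :=
  h.selected_slot ▸ h.isTrace.isForestOver

lemma IsSchedule.succ (h : R.IsSchedule F c k r) (hX : R.IsRound F X) :
    R.IsSchedule (F ∪ X) (recolor c X r) (if X.Nonempty then r + 1 else k) (r + 1) := by
  have hFX := hX.isForestOver
  have hle : k ≤ if X.Nonempty then r + 1 else k := by
    split_ifs
    exacts [h.le.trans r.le_succ, le_rfl]
  have hslot_lt {q : ℕ} (hq : q < r) : slot (F ∪ X) (recolor c X r) q = slot F c q := by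
    rw [slot_union_recolor hFX, if_neg hq.ne, union_empty]
  have hslot : slot (F ∪ X) (recolor c X r) r = X := by
    rw [slot_union_recolor hFX, if_pos rfl, slot, filter_false_of_mem, empty_union]
    exact fun v hv => ((h.color_lt v hv).trans_le h.le).ne
  refine ⟨fun q hq => ?_, fun v hv => ?_, ?_, fun hk => ?_⟩
  · rw [selected_congr fun p hp => hslot_lt (hp.trans_le (Nat.le_of_lt_succ hq))]
    rcases Nat.lt_succ_iff_lt_or_eq.1 hq with hq | rfl
    · rw [hslot_lt hq]
      exact h.isTrace q hq
    · rwa [hslot, h.selected_slot]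
  · rcases mem_union.1 hv with hv | hv
    · rw [recolor_of_joined hFX (joined_of_mem hv)]
      exact (h.color_lt v hv).trans_le hle
    · rw [recolor_of_mem hv, if_pos ⟨v, hv⟩]
      exact r.lt_succ_self
  · split_ifs
    exacts [le_rfl, h.le.trans r.le_succ]
  · split_ifs at hk ⊢ with hne
    · rwa [Nat.add_sub_cancel, hslot]
    · rw [hslot_lt (by have := h.le; omega)]
      exact h.slot_nonempty hk

lemma IsSchedule.isColoredSpanningTree [Nonempty V] (h : R.IsSchedule F c k r) (hR : R.Valid)
    (hG : ∀ v, R.Usable v → G.Adj v.1 v.2) (hC : 0 ≤ C) (hcov : R.Coverable C χ)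
    (hr : Nat.card V ≤ r) : IsColoredSpanningTree G (linkGraph F) c k := by
  have hadj {v : V × V} (hv : v ∈ F) : G.Adj v.1 v.2 := by
    obtain ⟨E, hE⟩ := h.isRound (h.color_lt v hv)
    exact hG v (hE.usable (mem_filter.2 ⟨hv, rfl⟩))
  refine ⟨fun u v huv => ?_, linkGraph_isTree ?_ h.isForestOver, Sym2.ind fun u v huv => ?_⟩
  · exact (linkGraph_adj.1 huv).2.elim hadj fun h => (hadj h).symm
  · exact h.selected_slot ▸ h.isTrace.numComp_le_one hR hC hcov hr
  · rcases (linkGraph_adj.1 huv).2 with hmem | hmem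
    · exact h.color_lt _ hmem
    · exact Sym2.eq_swap (a := u) ▸ h.color_lt _ hmem

lemma IsSchedule.natCast_le_mul_log [Nonempty V] (h : R.IsSchedule F c k r) (hR : R.Valid)
    (hC : 0 ≤ C) (hcov : R.Coverable C χ) :
    (k : ℝ) ≤ (4 * (1 + R.K * C) + 2) * Real.log (Nat.card V) * χ :=
  h.isTrace.natCast_le_mul_log hR hC hcov h.le h.slot_nonempty

end Rule

end ConnSched

/-! ### The program -/

namespace RealRAM

open ConnSched Finset

/-- Equality of natural numbers. -/
def natEq (a b : NatExpr) : Cond := .conj (.natLe a b) (.natLe b a)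

/-- Merge the classes of the nodes in the first cells of the arrays `i` and `j`, for the labelling
which is stored in row `0` of array `A`. -/
def mergeProg (A i j : ℕ) : Program :=
  .seq (.setNat 12 (.lit 0) (.lit 0) (.get A (.lit 0) (cell i))) <|
  .seq (.setNat 13 (.lit 0) (.lit 0) (.get A (.lit 0) (cell j))) <|
  forLoop 24 <| .ite (natEq (.get A (.lit 0) (cell 24)) (cell 13))
    (.setNat A (.lit 0) (cell 24) (cell 12)) .skip

/-- Give each node its own label. -/
def initLabels : Program := forLoop 24 (.setNat 7 (.lit 0) (cell 24) (cell 24))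

/-- Start a round with an empty greedy set: its components are those of the tree links. -/
def clearGreedy : Program :=
  .seq (forLoop 24 (.setNat 8 (.lit 0) (cell 24) (.get 7 (.lit 0) (cell 24)))) <|
  forPairs 22 23 <|
    .seq (.setNat 6 (cell 22) (cell 23) (.lit 0)) (.setReal 3 (cell 22) (cell 23) (.lit 0))

/-- Test whether the link in the cells `22` and `23` may be added to the greedy set. -/
def acceptCond (K : ℕ) (ok : Cond) : Cond :=
  .conj ok <| .conj (.neg (natEq (.get 8 (.lit 0) (cell 22)) (.get 8 (.lit 0) (cell 23))))
    (.realLe (.mul (.lit K) (.get 3 (cell 22) (cell 23))) (.lit 1))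

/-- Replace the link in the cells `10` and `11` by the one in the cells `22` and `23` if the latter
is acceptable and shorter, or if there is no link in the cells `10` and `11` yet. -/
def keepShortest (K : ℕ) (ok : Cond) : Program :=
  .ite (.conj (acceptCond K ok) (.neg (.conj (natEq (cell 9) (.lit 1))
      (.realLe (.get 0 (cell 10) (cell 11)) (.get 0 (cell 22) (cell 23))))))
    (.seq (.setNat 9 (.lit 0) (.lit 0) (.lit 1)) <|
      .seq (.setNat 10 (.lit 0) (.lit 0) (cell 22)) (.setNat 11 (.lit 0) (.lit 0) (cell 23)))
    .skip

/-- Find a shortest acceptable link. -/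
def scan (K : ℕ) (ok : Cond) : Program :=
  .seq (.setNat 9 (.lit 0) (.lit 0) (.lit 0)) (forPairs 22 23 (keepShortest K ok))

/-- Add to the loads of all other links their conflict with the link in the cells `10` and `11`,
where `W` is the conflict of the latter with the link in the cells `22` and `23`. -/
def addConflicts (W : RealExpr) : Program :=
  forPairs 22 23 <|
    .ite (.conj (natEq (cell 10) (cell 22)) (natEq (cell 11) (cell 23))) .skip
      (.setReal 3 (cell 22) (cell 23) (.add (.get 3 (cell 22) (cell 23)) W))

/-- Add the link in the cells `10` and `11` to the greedy set. -/
def addLink (W : RealExpr) : Program :=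
  .seq (addConflicts W) <| .seq (.setNat 6 (cell 10) (cell 11) (.lit 1)) (mergeProg 8 10 11)

/-- Extend the empty greedy set to a maximal one. -/
def growGreedy (K : ℕ) (ok : Cond) (W : RealExpr) : Program :=
  forLoop 21 <| .seq (scan K ok) <| .ite (natEq (cell 9) (.lit 1)) (addLink W) .skip

/-- Add the link in the cells `22` and `23` to the tree. -/
def commitLink : Program :=
  .seq (.setNat 2 (cell 22) (cell 23) (.lit 1)) <|
  .seq (.setNat 2 (cell 23) (cell 22) (.lit 1)) <|
  .seq (.setNat 3 (cell 22) (cell 23) (cell 20)) <|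
  .seq (.setNat 3 (cell 23) (cell 22) (cell 20)) <|
  .seq (.setNat 4 (cell 22) (cell 23) (.lit 1)) <|
  .seq (.setNat 5 (.lit 0) (.lit 0) (.add (cell 20) (.lit 1))) (mergeProg 7 22 23)

/-- Test whether the link in the cells `22` and `23` is a light link of the greedy set. -/
def lightCond (K : ℕ) : Cond :=
  .conj (natEq (.get 6 (cell 22) (cell 23)) (.lit 1))
    (.realLe (.mul (.lit K) (.get 3 (cell 22) (cell 23))) (.lit 4))

/-- Add the light links of the greedy set to the tree. -/
def commit (K : ℕ) : Program := forPairs 22 23 (.ite (lightCond K) commitLink .skip)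

/-- One round of the greedy selection. -/
def roundProg (K : ℕ) (ok : Cond) (W : RealExpr) : Program :=
  .seq clearGreedy <| .seq (growGreedy K ok W) (commit K)

/-- The program for a rule with constant `K`, where `ok` tests whether the link in the cells `22`
and `23` is usable, and `W` is its conflict with the link in the cells `10` and `11`. Here cell `i`
is the first cell of array `i` of natural numbers. The arrays of natural numbers besides those of
the input and the output hold:
* `6`: the current greedy set (adjacency matrix);
* `7`, `8`: labels (in row `0`) for the components of the tree links, and of these together with
  the greedy set;
* `9`, `10`, `11`: whether `scan` has found a link, and the two nodes of the best one so far;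
* `12`, `13`: the two labels that `mergeProg` identifies;
* `20`, `21`, `22`, `23`, `24`: loop counters, where `20` is the number of the round.

Array `3` of real numbers holds the loads of all links with respect to the greedy set. -/
def mainProg (K : ℕ) (ok : Cond) (W : RealExpr) : Program :=
  .seq initLabels (forLoop 20 (roundProg K ok W))

section Mods

variable (K : ℕ) (ok : Cond) (W : RealExpr)

@[simp] lemma natMods_mergeProg (A i j : ℕ) : (mergeProg A i j).natMods = {12, 13, 24, A} := by
  ext
  simp [mergeProg, natMods_forLoop, Program.natMods]
  tauto

@[simp] lemma realMods_mergeProg (A i j : ℕ) : (mergeProg A i j).realMods = ∅ := rfl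

@[simp] lemma natMods_initLabels : initLabels.natMods = {7, 24} := rfl

@[simp] lemma realMods_initLabels : initLabels.realMods = ∅ := rfl

@[simp] lemma natMods_clearGreedy : clearGreedy.natMods = {6, 8, 22, 23, 24} := by decide

@[simp] lemma realMods_clearGreedy : clearGreedy.realMods = {3} := rfl

@[simp] lemma natMods_keepShortest : (keepShortest K ok).natMods = {9, 10, 11} := by
  simp only [keepShortest, Program.natMods]
  decide

@[simp] lemma realMods_keepShortest : (keepShortest K ok).realMods = ∅ := rfl

@[simp] lemma natMods_scan : (scan K ok).natMods = {9, 10, 11, 22, 23} := by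
  simp only [scan, natMods_forPairs, natMods_keepShortest, Program.natMods]
  decide

@[simp] lemma realMods_scan : (scan K ok).realMods = ∅ := rfl

@[simp] lemma natMods_addConflicts : (addConflicts W).natMods = {22, 23} := by
  simp [addConflicts, natMods_forPairs, Program.natMods]

@[simp] lemma natMods_addLink : (addLink W).natMods = {6, 8, 12, 13, 22, 23, 24} := by
  simp only [addLink, natMods_addConflicts, natMods_mergeProg, Program.natMods]
  decide

@[simp] lemma realMods_addLink : (addLink W).realMods = {3} := rfl

@[simp] lemma natMods_growGreedy :
    (growGreedy K ok W).natMods = {6, 8, 9, 10, 11, 12, 13, 21, 22, 23, 24} := by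
  simp only [growGreedy, natMods_forLoop, natMods_scan, natMods_addLink, Program.natMods]
  decide

@[simp] lemma realMods_growGreedy : (growGreedy K ok W).realMods = {3} := rfl

@[simp] lemma natMods_commitLink : commitLink.natMods = {2, 3, 4, 5, 7, 12, 13, 24} := by decide

@[simp] lemma realMods_commitLink : commitLink.realMods = ∅ := rfl

@[simp] lemma natMods_commit :
    (commit K).natMods = {2, 3, 4, 5, 7, 12, 13, 22, 23, 24} := by
  simp only [commit, natMods_forPairs, natMods_commitLink, Program.natMods]
  decide

@[simp] lemma realMods_commit : (commit K).realMods = ∅ := rfl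

end Mods

end RealRAM

/-! ### Correctness of the program -/

namespace RealRAM

open ConnSched Finset

/-- The memories agree on the arrays of natural numbers in `S` and on the arrays of real numbers
in `T`. -/
def Agree (S T : Finset ℕ) (σ τ : Memory) : Prop :=
  (∀ A ∈ S, τ.nat A = σ.nat A) ∧ ∀ A ∈ T, τ.real A = σ.real A

section Agree

variable {S T : Finset ℕ} {σ τ υ : Memory} {A i j a : ℕ}

lemma Agree.trans (h : Agree S T σ τ) (h' : Agree S T τ υ) : Agree S T σ υ :=
  ⟨fun A hA => (h'.1 A hA).trans (h.1 A hA), fun A hA => (h'.2 A hA).trans (h.2 A hA)⟩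

lemma Agree.writeNat (σ : Memory) (hA : A ∉ S) : Agree S T σ (σ.writeNat A i j a) :=
  ⟨fun _ hB => Memory.writeNat_nat_of_ne (ne_of_mem_of_not_mem hB hA), fun _ _ => rfl⟩

lemma Frame.agree {p : Program} (h : Frame p σ τ) (hS : Disjoint S p.natMods)
    (hT : Disjoint T p.realMods) : Agree S T σ τ :=
  ⟨fun A hA => h.1 A (Finset.disjoint_left.1 hS hA),
    fun A hA => h.2 A (Finset.disjoint_left.1 hT hA)⟩

end Agree

/-- The memory `σ` still holds the input `σ₀`. -/
abbrev SameInput : Memory → Memory → Prop := Agree {0, 1} {0, 1, 2}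

variable {α : ℝ} {n : ℕ} {σ σ₀ τ : Memory} {R : Rule (Fin n)} {ok : Cond} {W : RealExpr}
  {F G : Finset (Fin n × Fin n)} {c : Sym2 (Fin n) → ℕ} {k r : ℕ} {v w : Fin n × Fin n}

/-- The test `ok` and the expression `W` describe the rule `R` for the input `σ₀`. -/
structure Describes (α : ℝ) (σ₀ : Memory) (R : Rule (Fin n)) (ok : Cond) (W : RealExpr) :
    Prop where
  size : σ₀.nat 0 0 0 = n
  len : ∀ v : Fin n × Fin n, σ₀.real 0 v.1 v.2 = R.len v
  usable : ∀ σ, SameInput σ₀ σ → ∀ v : Fin n × Fin n, σ.nat 22 0 0 = v.1 → σ.nat 23 0 0 = v.2 →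
    (ok.eval α σ ↔ R.Usable v)
  conflict : ∀ σ, SameInput σ₀ σ → ∀ u v : Fin n × Fin n, σ.nat 10 0 0 = u.1 →
    σ.nat 11 0 0 = u.2 → σ.nat 22 0 0 = v.1 → σ.nat 23 0 0 = v.2 → W.eval α σ = R.conflict u v

lemma Describes.nat_size (hD : Describes α σ₀ R ok W) (hσ : SameInput σ₀ σ) :
    σ.nat 0 0 0 = n := by
  rw [hσ.1 0 (by simp), hD.size]

lemma Describes.real_len (hD : Describes α σ₀ R ok W) (hσ : SameInput σ₀ σ)
    (v : Fin n × Fin n) : σ.real 0 v.1 v.2 = R.len v := by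
  rw [hσ.2 0 (by simp), hD.len]

/-- The labels in array `A`. -/
def labels (n : ℕ) (σ : Memory) (A : ℕ) : Fin n → ℕ := fun x => σ.nat A 0 x

lemma labels_congr {A B : ℕ} (h : τ.nat A = σ.nat B) : labels n τ A = labels n σ B := by
  unfold labels
  rw [h]

lemma labels_writeNat (σ : Memory) (A : ℕ) (x : Fin n) (a : ℕ) :
    labels n (σ.writeNat A 0 x a) A = Function.update (labels n σ A) x a := by
  funext y
  simp [labels, Memory.writeNat, Function.update_apply, Fin.ext_iff]

lemma natEq_eval {a b : NatExpr} : (natEq a b).eval α σ ↔ a.eval σ = b.eval σ :=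
  le_antisymm_iff.symm

lemma val_pair_eq_iff : ((v.1 : ℕ) = w.1 ∧ (v.2 : ℕ) = w.2) ↔ v = w := by
  rw [Prod.ext_iff, Fin.ext_iff, Fin.ext_iff]

lemma writeNat_nat_pair (σ : Memory) (A a : ℕ) (v w : Fin n × Fin n) :
    (σ.writeNat A v.1 v.2 a).nat A w.1 w.2 = if w = v then a else σ.nat A w.1 w.2 := by
  simp only [Memory.writeNat, true_and, val_pair_eq_iff]

lemma writeReal_real_pair (σ : Memory) (A : ℕ) (a : ℝ) (v w : Fin n × Fin n) :
    (σ.writeReal A v.1 v.2 a).real A w.1 w.2 = if w = v then a else σ.real A w.1 w.2 := by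
  simp only [Memory.writeReal, true_and, val_pair_eq_iff]

lemma run_forLabels {A : ℕ} {p : Program} (f : Fin n → ℕ) (hA : A ≠ 24) (hp0 : 0 ∉ p.natMods)
    (hp24 : 24 ∉ p.natMods) (hn : σ.nat 0 0 0 = n)
    (hstep : ∀ (x : Fin n) τ, Frame (forLoop 24 p) σ τ → τ.nat 24 0 0 = x →
      labels n τ A x = labels n σ A x →
      Run α n p τ fun υ => labels n υ A = Function.update (labels n τ A) x (f x)) :
    Run α n (forLoop 24 p) σ fun τ => labels n τ A = f := by
  refine (run_forFin (fun D τ => labels n τ A = D.piecewise f (labels n σ A)) (by simp) hp0 hp24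
    hn (fun D τ x h => ?_) (piecewise_empty ..).symm fun D x hx τ hf hτ h24 => ?_).mono
      fun τ _ h => by rw [h, piecewise_univ]
  · rw [labels_congr (Memory.writeNat_nat_of_ne hA), h]
  · refine (hstep x τ hf h24 ?_).mono fun υ _ hυ => by rw [hυ, hτ, piecewise_insert]
    rw [hτ, piecewise_eq_of_notMem _ _ _ hx]

lemma run_mergeProg {A i j : ℕ} (hA : A ∉ ({0, 12, 13, 24} : Finset ℕ)) (hj : j ≠ 12)
    (hn : σ.nat 0 0 0 = n) (hi1 : σ.nat i 0 0 = v.1) (hj2 : σ.nat j 0 0 = v.2)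
    (hF : IsLabel F (labels n σ A)) :
    Run α n (mergeProg A i j) σ fun τ => IsLabel (insert v F) (labels n τ A) := by
  obtain ⟨hA0, hA12, hA13, hA24⟩ : A ≠ 0 ∧ A ≠ 12 ∧ A ≠ 13 ∧ A ≠ 24 := by
    simpa [not_or] using hA
  refine run_seq (run_setNat (run_seq (run_setNat ?_)))
  simp only [NatExpr.eval, cell_eval, Memory.writeNat_nat_of_ne hj, hi1, hj2,
    Memory.writeNat_nat_of_ne hA12]
  set σ' := (σ.writeNat 12 0 0 (σ.nat A 0 v.1)).writeNat 13 0 0 (σ.nat A 0 v.2) with hσ'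
  have hσA : labels n σ' A = labels n σ A := labels_congr <| by
    rw [hσ', Memory.writeNat_nat_of_ne hA13, Memory.writeNat_nat_of_ne hA12]
  refine (run_forLabels (A := A) (fun x => if labels n σ A x = labels n σ A v.2
    then labels n σ A v.1 else labels n σ A x) hA24 ?_ ?_ ?_ fun x τ hf h24 hx => ?_).mono
      fun τ _ hτ => ?_
  · simpa [Program.natMods] using hA0.symm
  · simpa [Program.natMods] using hA24.symm
  · rw [hσ', Memory.writeNat_nat_of_ne (by simp), Memory.writeNat_nat_of_ne (by simp), hn]
  · rw [hσA] at hx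
    have h12 : τ.nat 12 0 0 = labels n σ A v.1 := by
      rw [hf.1 12 (by simp [natMods_forLoop, Program.natMods, hA12.symm]), hσ',
        Memory.writeNat_nat_of_ne (by simp), Memory.writeNat_nat_self]
      rfl
    have h13 : τ.nat 13 0 0 = labels n σ A v.2 := by
      rw [hf.1 13 (by simp [natMods_forLoop, Program.natMods, hA13.symm]), hσ',
        Memory.writeNat_nat_self]
      rfl
    have hcond : (natEq (.get A (.lit 0) (cell 24)) (cell 13)).eval α τ ↔
        labels n σ A x = labels n σ A v.2 := by
      rw [natEq_eval, ← h13, ← hx, NatExpr.eval, cell_eval, cell_eval, h24]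
      rfl
    refine run_ite (fun h => run_setNat ?_) fun h => run_skip ?_
    · rw [cell_eval, cell_eval, h24, h12, if_pos (hcond.1 h)]
      exact labels_writeNat ..
    · rw [if_neg (mt hcond.2 h), ← hx, Function.update_eq_self]
  · rw [hτ]
    exact hF.insert v

lemma run_initLabels (hn : σ.nat 0 0 0 = n) :
    Run α n initLabels σ fun τ => IsLabel ∅ (labels n τ 7) := by
  refine (run_forLabels (A := 7) (fun x : Fin n => (x : ℕ)) (by simp) (by simp [Program.natMods])
    (by simp [Program.natMods]) hn fun x τ _ h24 _ => run_setNat ?_).mono fun τ _ hτ => ?_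
  · rw [cell_eval, h24]
    exact labels_writeNat ..
  · rw [hτ]
    exact fun x y => Fin.ext_iff.symm.trans joined_empty.symm

/-- The memory represents the greedy set `G` of a round which starts with the links `F`. -/
structure HoldsGreedy (R : Rule (Fin n)) (F G : Finset (Fin n × Fin n)) (σ : Memory) : Prop where
  isLabel : IsLabel (F ∪ G) (labels n σ 8)
  mark : ∀ v : Fin n × Fin n, σ.nat 6 v.1 v.2 = 1 ↔ v ∈ G
  load : ∀ v : Fin n × Fin n, σ.real 3 v.1 v.2 = R.load G v

lemma HoldsGreedy.congr (h : HoldsGreedy R F G σ) (hτ : Agree {6, 8} {3} σ τ) :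
    HoldsGreedy R F G τ where
  isLabel := labels_congr (hτ.1 8 (by simp)) ▸ h.isLabel
  mark := hτ.1 6 (by simp) ▸ h.mark
  load := hτ.2 3 (by simp) ▸ h.load

lemma run_clearGreedy (hn : σ.nat 0 0 0 = n) (hF : IsLabel F (labels n σ 7)) :
    Run α n clearGreedy σ (HoldsGreedy R F ∅) := by
  refine run_seq ((run_forLabels (A := 8) (labels n σ 7) (by simp) (by simp [Program.natMods])
    (by simp [Program.natMods]) hn fun x τ hf h24 _ => run_setNat ?_).mono fun τ hf hlab => ?_)
  · have h7 : (NatExpr.get 7 (.lit 0) (cell 24)).eval τ = labels n σ 7 x := by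
      rw [NatExpr.eval, cell_eval, h24, hf.1 7 (by simp [natMods_forLoop, Program.natMods])]
      rfl
    rw [h7, cell_eval, h24]
    exact labels_writeNat ..
  · refine (run_forPairs (fun D τ => ∀ v ∈ D, τ.nat 6 v.1 v.2 = 0 ∧ τ.real 3 v.1 v.2 = 0)
      (by simp) (by simp) (by simp) (by simp [Program.natMods]) (by simp [Program.natMods])
      (by simp [Program.natMods]) ?_ (fun _ _ _ h => by simpa [Memory.writeNat] using h)
      (fun _ _ _ h => by simpa [Memory.writeNat] using h) (by simp)
      fun D v _ σ' _ h h22 h23 => run_seq (run_setNat (run_setReal ?_))).mono fun υ hυ h => ?_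
    · rw [hf.1 0 (by simp [natMods_forLoop, Program.natMods]), hn]
    · simp only [cell_eval, Memory.writeNat_nat_of_ne (show 22 ≠ 6 by simp),
        Memory.writeNat_nat_of_ne (show 23 ≠ 6 by simp), h22, h23, NatExpr.eval, RealExpr.eval]
      intro w hw
      refine ⟨(writeNat_nat_pair ..).trans ?_, (writeReal_real_pair ..).trans ?_⟩
      · split_ifs with hwv
        exacts [rfl, (h w (mem_of_mem_insert_of_ne hw hwv)).1]
      · split_ifs with hwv
        exacts [Nat.cast_zero, (h w (mem_of_mem_insert_of_ne hw hwv)).2]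
    · refine ⟨?_, fun v => ?_, fun v => ?_⟩
      · rw [union_empty, labels_congr (hυ.1 8 (by simp [natMods_forPairs, Program.natMods])),
          hlab]
        exact hF
      · simp [(h v (mem_univ v)).1]
      · simp [(h v (mem_univ v)).2, Rule.load]

/-- The memory represents a shortest acceptable link in `D`, or the fact that there is none. -/
def HoldsShortest (R : Rule (Fin n)) (F G D : Finset (Fin n × Fin n)) (σ : Memory) : Prop :=
  (σ.nat 9 0 0 = 0 ∧ ∀ v ∈ D, ¬ R.Acceptable F G v) ∨
  (σ.nat 9 0 0 = 1 ∧ ∃ w : Fin n × Fin n, σ.nat 10 0 0 = w.1 ∧ σ.nat 11 0 0 = w.2 ∧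
    R.Acceptable F G w ∧ ∀ v ∈ D, R.Acceptable F G v → R.len w ≤ R.len v)

lemma HoldsShortest.congr {D : Finset (Fin n × Fin n)} (h : HoldsShortest R F G D σ)
    (hτ : Agree {9, 10, 11} ∅ σ τ) : HoldsShortest R F G D τ := by
  rwa [HoldsShortest, hτ.1 9 (by simp), hτ.1 10 (by simp), hτ.1 11 (by simp)]

lemma acceptCond_eval (hD : Describes α σ₀ R ok W) (hσ : SameInput σ₀ σ)
    (hG : HoldsGreedy R F G σ) (h22 : σ.nat 22 0 0 = v.1) (h23 : σ.nat 23 0 0 = v.2) :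
    (acceptCond R.K ok).eval α σ ↔ R.Acceptable F G v := by
  refine and_congr (hD.usable σ hσ v h22 h23) (and_congr (not_congr (natEq_eval.trans ?_)) ?_)
  · simp only [NatExpr.eval, cell_eval, h22, h23]
    exact hG.isLabel v.1 v.2
  · simp only [Cond.eval, RealExpr.eval, cell_eval, h22, h23, hG.load, Nat.cast_one]

lemma run_keepShortest {D : Finset (Fin n × Fin n)} (hD : Describes α σ₀ R ok W)
    (hσ : SameInput σ₀ σ) (hG : HoldsGreedy R F G σ) (h : HoldsShortest R F G D σ)
    (h22 : σ.nat 22 0 0 = v.1) (h23 : σ.nat 23 0 0 = v.2) :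
    Run α n (keepShortest R.K ok) σ (HoldsShortest R F G (insert v D)) := by
  have hacc := acceptCond_eval hD hσ hG h22 h23
  have hlen (w : Fin n × Fin n) (h10 : σ.nat 10 0 0 = w.1) (h11 : σ.nat 11 0 0 = w.2) :
      (Cond.realLe (.get 0 (cell 10) (cell 11)) (.get 0 (cell 22) (cell 23))).eval α σ ↔
        R.len w ≤ R.len v := by
    simp only [Cond.eval, RealExpr.eval, cell_eval, h10, h11, h22, h23, hD.real_len hσ]
  refine run_ite (fun ⟨hv, hbest⟩ => run_seq (run_setNat (run_seq (run_setNat (run_setNat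
    (.inr ⟨rfl, v, h22, h23, hacc.1 hv, forall_mem_insert _ _ _ |>.2
      ⟨fun _ => le_rfl, fun u hu hua => ?_⟩⟩)))))) fun hcond => run_skip ?_
  · rcases h with ⟨_, hnone⟩ | ⟨h9, w, h10, h11, _, hw⟩
    · exact absurd hua (hnone u hu)
    · have hvw : R.len v < R.len w :=
        not_le.1 fun hle => hbest ⟨natEq_eval.2 h9, (hlen w h10 h11).2 hle⟩
      exact hvw.le.trans (hw u hu hua)
  · rcases h with ⟨h9, hnone⟩ | ⟨h9, w, h10, h11, hwa, hw⟩
    · have h9' : ¬ (natEq (cell 9) (.lit 1)).eval α σ :=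
        fun h => zero_ne_one (h9.symm.trans (natEq_eval.1 h))
      exact .inl ⟨h9, forall_mem_insert _ _ _ |>.2
        ⟨fun hv => hcond ⟨hacc.2 hv, fun h => h9' h.1⟩, hnone⟩⟩
    · refine .inr ⟨h9, w, h10, h11, hwa, forall_mem_insert _ _ _ |>.2 ⟨fun hv => ?_, hw⟩⟩
      by_contra hwv
      exact hcond ⟨hacc.2 hv, fun h => hwv ((hlen w h10 h11).1 h.2)⟩

lemma run_scan (hD : Describes α σ₀ R ok W) (hσ : SameInput σ₀ σ) (hG : HoldsGreedy R F G σ) :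
    Run α n (scan R.K ok) σ (HoldsShortest R F G univ) := by
  refine run_seq (run_setNat ?_)
  replace hσ := hσ.trans (.writeNat σ (A := 9) (i := 0) (j := 0) (a := 0) (by simp))
  replace hG := hG.congr (.writeNat σ (A := 9) (i := 0) (j := 0) (a := 0) (by simp))
  refine run_forPairs (c := 22) (d := 23) (HoldsShortest R F G) (by simp) (by simp) (by simp)
    (by simp) (by simp) (by simp) (hD.nat_size hσ) (fun D τ x h => h.congr (.writeNat τ (by simp)))
    (fun D τ x h => h.congr (.writeNat τ (by simp)))
    (.inl ⟨Memory.writeNat_nat_self .., by simp⟩) fun D v _ τ hf h h22 h23 => ?_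
  exact run_keepShortest hD (hσ.trans (hf.agree (by simp [natMods_forPairs]) (by simp)))
    (hG.congr (hf.agree (by simp [natMods_forPairs]) (by simp))) h h22 h23

lemma run_addConflicts (hD : Describes α σ₀ R ok W) (hσ : SameInput σ₀ σ)
    (hG : ∀ v : Fin n × Fin n, σ.real 3 v.1 v.2 = R.load G v) (hw : w ∉ G)
    (h10 : σ.nat 10 0 0 = w.1) (h11 : σ.nat 11 0 0 = w.2) :
    Run α n (addConflicts W) σ fun τ => ∀ v : Fin n × Fin n,
      τ.real 3 v.1 v.2 = R.load (insert w G) v := by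
  refine (run_forPairs (fun D τ => ∀ v : Fin n × Fin n, τ.real 3 v.1 v.2 =
      R.load (if v ∈ D then insert w G else G) v) (by simp) (by simp) (by simp)
    (by simp [Program.natMods]) (by simp [Program.natMods]) (by simp [Program.natMods])
    (hD.nat_size hσ) (fun _ _ _ h => h) (fun _ _ _ h => h) (by simpa using hG)
    fun D v hv τ hf h h22 h23 => ?_).mono fun τ _ h => by simpa using h
  have hτ : Agree {10, 11} ∅ σ τ :=
    hf.agree (by simp [natMods_forPairs, Program.natMods]) (by simp)
  replace hσ : SameInput σ₀ τ := hσ.trans (hf.agree (by simp [natMods_forPairs, Program.natMods])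
      (by simp [Program.realMods]))
  have h10' : τ.nat 10 0 0 = w.1 := (congrFun₂ (hτ.1 10 (by simp)) 0 0).trans h10
  have h11' : τ.nat 11 0 0 = w.2 := (congrFun₂ (hτ.1 11 (by simp)) 0 0).trans h11
  have hcond : (Cond.conj (natEq (cell 10) (cell 22)) (natEq (cell 11) (cell 23))).eval α τ ↔
      w = v := by
    rw [Cond.eval, natEq_eval, natEq_eval, cell_eval, cell_eval, cell_eval, cell_eval, h10',
      h11', h22, h23, val_pair_eq_iff]
  refine run_ite (fun hb => run_skip fun u => ?_) fun hb => run_setReal fun u => ?_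
  · rw [h u]
    obtain rfl := hcond.1 hb
    rcases eq_or_ne u w with rfl | hne
    · simp only [hv, if_false, mem_insert_self, if_true, Rule.load_insert_self hw]
    · simp only [mem_insert, hne, false_or]
  · rw [cell_eval, cell_eval, h22, h23, writeReal_real_pair]
    rcases eq_or_ne u v with rfl | hne
    · rw [if_pos rfl, if_pos (mem_insert_self u D), RealExpr.eval, RealExpr.eval, cell_eval,
        cell_eval, h22, h23, h u, if_neg hv, hD.conflict τ hσ w u h10' h11' h22 h23,
        Rule.load_insert_of_ne hw (mt hcond.2 hb)]
    · simp only [hne, if_false, h u, mem_insert, false_or]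

lemma run_addLink (hD : Describes α σ₀ R ok W) (hσ : SameInput σ₀ σ) (hG : HoldsGreedy R F G σ)
    (hw : w ∉ G) (h10 : σ.nat 10 0 0 = w.1) (h11 : σ.nat 11 0 0 = w.2) :
    Run α n (addLink W) σ (HoldsGreedy R F (insert w G)) := by
  refine run_seq ((run_addConflicts hD hσ hG.load hw h10 h11).mono fun τ hf hload =>
    run_seq (run_setNat ?_))
  have hτ : Agree {0, 6, 8, 10, 11} ∅ σ τ := hf.agree (by simp) (by simp)
  simp only [cell_eval, NatExpr.eval, hτ.1 10 (by simp), hτ.1 11 (by simp), h10, h11]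
  refine (run_mergeProg (A := 8) (by simp) (by simp) (v := w) (F := F ∪ G) ?_ ?_ ?_ ?_).mono
    fun υ hυ hlab => ⟨union_insert w F G ▸ hlab, fun v => ?_, fun v => ?_⟩
  · exact (congrFun₂ (hτ.1 0 (by simp)) 0 0).trans (hD.nat_size hσ)
  · exact (congrFun₂ (hτ.1 10 (by simp)) 0 0).trans h10
  · exact (congrFun₂ (hτ.1 11 (by simp)) 0 0).trans h11
  · exact labels_congr (hτ.1 8 (by simp)) ▸ hG.isLabel
  · rw [hυ.1 6 (by simp), writeNat_nat_pair, hτ.1 6 (by simp), mem_insert]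
    split_ifs with hvw
    · simp [hvw]
    · simp [hvw, hG.mark]
  · rw [hυ.2 3 (by simp)]
    exact hload v

lemma run_growGreedy [NeZero n] (hD : Describes α σ₀ R ok W) (hσ : SameInput σ₀ σ)
    (hF : HoldsGreedy R F ∅ σ) :
    Run α n (growGreedy R.K ok W) σ fun τ => ∃ G, R.Greedy F G ∧ (∀ v, ¬ R.Acceptable F G v) ∧
      HoldsGreedy R F G τ := by
  refine (run_forLoop (fun k τ => ∃ G, R.Greedy F G ∧ HoldsGreedy R F G τ ∧
    ((∀ v, ¬ R.Acceptable F G v) ∨ #G = k)) (by simp) (by simp [Program.natMods])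
    (by simp [Program.natMods]) (hD.nat_size hσ) ?_ ⟨∅, .empty, hF, .inr card_empty⟩ ?_).mono ?_
  · exact fun k τ x ⟨G, hG, h, hk⟩ => ⟨G, hG, h.congr (.writeNat τ (by simp)), hk⟩
  · rintro k - τ hf ⟨G, hG, h, hk⟩ -
    replace hσ : SameInput σ₀ τ := hσ.trans
      (hf.agree (by simp [natMods_forLoop, Program.natMods])
        (by simp [realMods_forLoop, Program.realMods]))
    refine run_seq ((run_scan hD hσ h).mono fun υ hυ hs => ?_)
    replace hσ : SameInput σ₀ υ := hσ.trans (hυ.agree (by simp) (by simp))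
    replace h : HoldsGreedy R F G υ := h.congr (hυ.agree (by simp) (by simp))
    rcases hs with ⟨h9, hnone⟩ | ⟨h9, w, h10, h11, hw, hmin⟩
    · have hmax : ∀ v, ¬ R.Acceptable F G v := fun v => hnone v (mem_univ v)
      exact run_ite (fun hb => absurd (h9.symm.trans (natEq_eval.1 hb)) zero_ne_one)
        fun _ => run_skip ⟨G, hG, h, .inl hmax⟩
    · refine run_ite (fun _ => (run_addLink hD hσ h hw.notMem h10 h11).mono fun ω _ h => ?_)
        fun hb => absurd (natEq_eval.2 h9 : (natEq (cell 9) (.lit 1)).eval α υ) hb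
      exact ⟨insert w G, hG.step hw fun v => hmin v (mem_univ v), h, .inr <| by
        rw [card_insert_of_notMem hw.notMem, hk.resolve_left fun hmax => hmax w hw]⟩
  · rintro τ - ⟨G, hG, h, hk⟩
    exact ⟨G, hG, hk.resolve_right (by simpa using hG.isForestOver.card_lt.ne), h⟩

/-- The memory represents the tree links `F`, colored by `c` with `k` colors. -/
structure HoldsTree (F : Finset (Fin n × Fin n)) (c : Sym2 (Fin n) → ℕ) (k : ℕ) (σ : Memory) :
    Prop where
  isLabel : IsLabel F (labels n σ 7)
  adj : ∀ v : Fin n × Fin n, σ.nat 2 v.1 v.2 = 1 ↔ v ∈ F ∨ v.swap ∈ F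
  color : ∀ v : Fin n × Fin n, σ.nat 3 v.1 v.2 = c s(v.1, v.2)
  link : ∀ v : Fin n × Fin n, σ.nat 4 v.1 v.2 = 1 ↔ v ∈ F
  count : σ.nat 5 0 0 = k

lemma HoldsTree.congr (h : HoldsTree F c k σ) (hτ : Agree {2, 3, 4, 5, 7} ∅ σ τ) :
    HoldsTree F c k τ where
  isLabel := labels_congr (hτ.1 7 (by simp)) ▸ h.isLabel
  adj := hτ.1 2 (by simp) ▸ h.adj
  color := hτ.1 3 (by simp) ▸ h.color
  link := hτ.1 4 (by simp) ▸ h.link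
  count := hτ.1 5 (by simp) ▸ h.count

lemma run_commitLink (h : HoldsTree F c k σ) (hn : σ.nat 0 0 0 = n) (h20 : σ.nat 20 0 0 = r)
    (h22 : σ.nat 22 0 0 = v.1) (h23 : σ.nat 23 0 0 = v.2) :
    Run α n commitLink σ
      (HoldsTree (insert v F) (Function.update c s(v.1, v.2) r) (r + 1)) := by
  refine run_seq (run_setNat (run_seq (run_setNat (run_seq (run_setNat (run_seq (run_setNat
    (run_seq (run_setNat (run_seq (run_setNat ?_)))))))))))
  simp only [cell_eval, h22, h23, NatExpr.eval, ne_eq, Nat.reduceEqDiff, not_false_eq_true,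
    Memory.writeNat_nat_of_ne, h20]
  set σ' := (((((σ.writeNat 2 v.1 v.2 1).writeNat 2 v.2 v.1 1).writeNat 3 v.1 v.2 r).writeNat
    3 v.2 v.1 r).writeNat 4 v.1 v.2 1).writeNat 5 0 0 (r + 1)
  have h2 (w : Fin n × Fin n) : σ'.nat 2 w.1 w.2 =
      if w = v.swap then 1 else if w = v then 1 else σ.nat 2 w.1 w.2 :=
    (writeNat_nat_pair _ 2 1 v.swap w).trans (by rw [writeNat_nat_pair])
  have h3 (w : Fin n × Fin n) : σ'.nat 3 w.1 w.2 =
      if w = v.swap then r else if w = v then r else σ.nat 3 w.1 w.2 :=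
    (writeNat_nat_pair _ 3 r v.swap w).trans (by rw [writeNat_nat_pair]; rfl)
  have h4 (w : Fin n × Fin n) : σ'.nat 4 w.1 w.2 = if w = v then 1 else σ.nat 4 w.1 w.2 :=
    writeNat_nat_pair ..
  have hmerge : Run α n (mergeProg 7 22 23) σ' fun τ => IsLabel (insert v F) (labels n τ 7) :=
    run_mergeProg (by simp) (by simp) hn h22 h23 h.isLabel
  refine hmerge.mono fun υ hυ hlab => ⟨hlab, fun w => ?_, fun w => ?_, fun w => ?_, ?_⟩
  · rw [hυ.1 2 (by simp), h2, mem_insert, mem_insert, Prod.swap_eq_iff_eq_swap, or_or_or_comm,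
      ← h.adj w]
    split_ifs <;> simp_all
  · have hwv : s(w.1, w.2) = s(v.1, v.2) ↔ w = v ∨ w = v.swap := Sym2.mk_eq_mk_iff
    rw [hυ.1 3 (by simp), h3, h.color w, Function.update_apply]
    simp only [hwv]
    split_ifs <;> simp_all
  · rw [hυ.1 4 (by simp), h4, mem_insert, ← h.link w]
    split_ifs <;> simp_all
  · rw [hυ.1 5 (by simp)]
    rfl

lemma lightCond_eval (hG : HoldsGreedy R F G σ) (h22 : σ.nat 22 0 0 = v.1)
    (h23 : σ.nat 23 0 0 = v.2) : (lightCond R.K).eval α σ ↔ v ∈ R.light G := by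
  simp only [lightCond, Cond.eval, natEq_eval, NatExpr.eval, RealExpr.eval, cell_eval, h22, h23,
    hG.mark, hG.load, Rule.light, mem_filter, Nat.cast_ofNat]

lemma run_commit (hG : HoldsGreedy R F G σ) (hT : HoldsTree F c k σ) (hn : σ.nat 0 0 0 = n)
    (h20 : σ.nat 20 0 0 = r) :
    Run α n (commit R.K) σ (HoldsTree (F ∪ R.light G) (recolor c (R.light G) r)
      (if (R.light G).Nonempty then r + 1 else k)) := by
  have h := run_forPairs (α := α) (p := .ite (lightCond R.K) commitLink .skip) (c := 22) (d := 23)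
    (fun D => HoldsTree (F ∪ (R.light G ∩ D)) (recolor c (R.light G ∩ D) r)
      (if (R.light G ∩ D).Nonempty then r + 1 else k)) (by simp) (by simp) (by simp)
    (by simp [Program.natMods]) (by simp [Program.natMods]) (by simp [Program.natMods]) hn
    (fun D τ x h => h.congr (.writeNat τ (by simp)))
    (fun D τ x h => h.congr (.writeNat τ (by simp))) (by simpa [recolor_empty] using hT)
    fun D v _ τ hf h h22 h23 => ?_
  · simp only [inter_univ] at h
    exact h
  · replace hG : HoldsGreedy R F G τ := hG.congr (hf.agree
      (by simp [natMods_forPairs, Program.natMods]) (by simp [Program.realMods]))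
    have hτ : Agree {0, 20} ∅ σ τ :=
      hf.agree (by simp [natMods_forPairs, Program.natMods]) (by simp)
    have hcond := lightCond_eval (α := α) hG h22 h23
    refine run_ite (fun hb => ?_) fun hb => run_skip ?_
    · rw [inter_insert_of_mem (hcond.1 hb), union_insert, recolor_insert,
        if_pos (insert_nonempty ..)]
      exact run_commitLink h ((congrFun₂ (hτ.1 0 (by simp)) 0 0).trans hn)
        ((congrFun₂ (hτ.1 20 (by simp)) 0 0).trans h20) h22 h23
    · rwa [inter_insert_of_notMem (mt hcond.2 hb)]

lemma run_roundProg [NeZero n] (hD : Describes α σ₀ R ok W) (hσ : SameInput σ₀ σ)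
    (hF : R.IsSchedule F c k r) (hT : HoldsTree F c k σ) (h20 : σ.nat 20 0 0 = r) :
    Run α n (roundProg R.K ok W) σ fun τ => ∃ F c k, R.IsSchedule F c k (r + 1) ∧
      HoldsTree F c k τ := by
  refine run_seq ((run_clearGreedy (R := R) (hD.nat_size hσ) hT.isLabel).mono fun τ hτ hG => ?_)
  replace hσ : SameInput σ₀ τ := hσ.trans (hτ.agree (by simp) (by simp))
  refine run_seq ((run_growGreedy hD hσ hG).mono fun υ hυ ⟨G, hgreedy, hmax, hG⟩ => ?_)
  replace hσ : SameInput σ₀ υ := hσ.trans (hυ.agree (by simp) (by simp))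
  have hσυ : Agree {2, 3, 4, 5, 7, 20} ∅ σ υ :=
    (hτ.agree (by simp) (by simp)).trans (hυ.agree (by simp) (by simp))
  refine (run_commit hG (hT.congr ⟨fun A hA => hσυ.1 A ?_, by simp⟩) (hD.nat_size hσ)
    ((congrFun₂ (hσυ.1 20 (by simp)) 0 0).trans h20)).mono fun ω _ hω => ?_
  · revert hA
    simp
    tauto
  · exact ⟨_, _, _, hF.succ ⟨G, hgreedy, hmax, rfl⟩, hω⟩

lemma run_mainProg (hD : Describes α σ₀ R ok W)
    (h0 : ∀ A ∈ ({2, 3, 4, 5} : Finset ℕ), ∀ i j, σ₀.nat A i j = 0) :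
    Run α n (mainProg R.K ok W) σ₀ fun τ => ∃ F c k, R.IsSchedule F c k n ∧
      HoldsTree F c k τ := by
  refine run_seq ((run_initLabels hD.size).mono fun τ hτ hlab => ?_)
  have hσ : SameInput σ₀ τ := hτ.agree (by simp) (by simp)
  refine run_forLoop (fun r τ => ∃ F c k, R.IsSchedule F c k r ∧ HoldsTree F c k τ) (by simp)
    (by simp [roundProg, Program.natMods]) (by simp [roundProg, Program.natMods])
    (hD.nat_size hσ) (fun r τ x ⟨F, c, k, hF, hT⟩ => ⟨F, c, k, hF,
      hT.congr (.writeNat τ (by simp))⟩) ⟨∅, fun _ => 0, 0, .zero R _, hlab, ?_, ?_, ?_, ?_⟩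
    fun r hr υ hυ ⟨F, c, k, hF, hT⟩ h20 => ?_
  · simp [hτ.1 2 (by simp), h0]
  · simp [hτ.1 3 (by simp), h0]
  · simp [hτ.1 4 (by simp), h0]
  · simp [hτ.1 5 (by simp), h0]
  · have : NeZero n := .of_gt hr
    exact run_roundProg hD (hσ.trans (hυ.agree
      (by simp [natMods_forLoop, roundProg, Program.natMods])
      (by simp [roundProg, Program.realMods]))) hF hT h20

end RealRAM

/-! ### The rules as expressions -/

namespace RealRAM

open ConnSched SINR Finset

/-- The SINR threshold. -/
def thresholdExpr : RealExpr := .get 2 (.lit 0) (.lit 0)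

/-- The noise. -/
def noiseExpr : RealExpr := .get 2 (.lit 0) (.lit 1)

/-- The attenuation between two nodes. -/
def attExpr (i j : NatExpr) : RealExpr := .pow (.get 0 i j)

/-- The slack `SINR.slack` of a link. -/
def slackExpr (i j : NatExpr) : RealExpr :=
  .sub (.div (.get 1 i j) (attExpr i j)) (.mul thresholdExpr noiseExpr)

/-- The affectance `SINR.aff` of the link `(i, j)` on the link `(k, l)`. -/
def affExpr (i j k l : NatExpr) : RealExpr :=
  .div (.mul thresholdExpr (.get 1 i j))
    (.add (.mul thresholdExpr (.get 1 i j)) (.mul (attExpr i l) (slackExpr k l)))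

/-- Conflict, in the rule for fixed powers, of the links in the cells `10`, `11` and
`22`, `23`. -/
def fixedConflictExpr : RealExpr :=
  .add (affExpr (cell 10) (cell 11) (cell 22) (cell 23))
    (affExpr (cell 22) (cell 23) (cell 10) (cell 11))

/-- Test whether the link in the cells `22` and `23` is available. -/
def availableCond : Cond := natEq (.get 1 (cell 22) (cell 23)) (.lit 1)

/-- Test whether the rule for fixed powers may use the link in the cells `22` and `23`. -/
def fixedCond : Cond :=
  .conj availableCond <|
    .realLe (.mul (.mul thresholdExpr noiseExpr) (attExpr (cell 22) (cell 23)))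
      (.get 1 (cell 22) (cell 23))

/-- The number `SINR.harm` for the links in the cells `10`, `11` and `22`, `23`. -/
def harmExpr : RealExpr :=
  .div (.mul (attExpr (cell 10) (cell 11)) (attExpr (cell 22) (cell 23)))
    (.add (attExpr (cell 10) (cell 11)) (attExpr (cell 22) (cell 23)))

/-- Closeness `SINR.near` of two nodes, in comparison with `harmExpr`. -/
def nearExpr (i j : NatExpr) : RealExpr := .div harmExpr (.add harmExpr (attExpr i j))

/-- Conflict, in the rule for power control, of the links in the cells `10`, `11` and
`22`, `23`. -/
def globalConflictExpr : RealExpr :=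
  .add (.add (nearExpr (cell 10) (cell 22)) (nearExpr (cell 10) (cell 23)))
    (.add (nearExpr (cell 11) (cell 22)) (nearExpr (cell 11) (cell 23)))

section Input

variable {n : ℕ} {X : Type*} [MetricSpace X] {α β N : ℝ} {pos : Fin n → X}
  {G : SimpleGraph (Fin n)} {P : Fin n × Fin n → ℝ} {σ : Memory} {i j k l : NatExpr}
  {u v : Fin n × Fin n}

lemma input_nat_size : (input β N pos G P).nat 0 0 0 = n := by simp [input]

lemma input_nat_adj (v : Fin n × Fin n) :
    (input β N pos G P).nat 1 v.1 v.2 = 1 ↔ G.Adj v.1 v.2 := by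
  simp [input]

lemma input_nat_eq_zero {A : ℕ} (h : 2 ≤ A) (i j : ℕ) : (input β N pos G P).nat A i j = 0 := by
  simp [input, show A ≠ 0 by omega, show A ≠ 1 by omega]

lemma input_real_dist (x y : Fin n) :
    (input β N pos G P).real 0 x y = dist (pos x) (pos y) := by
  simp [input]

lemma input_real_power (v : Fin n × Fin n) : (input β N pos G P).real 1 v.1 v.2 = P v := by
  simp [input]

lemma thresholdExpr_eval (hσ : SameInput (input β N pos G P) σ) :
    thresholdExpr.eval α σ = β := by
  simp [thresholdExpr, RealExpr.eval, NatExpr.eval, hσ.2 2 (by simp), input]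

lemma noiseExpr_eval (hσ : SameInput (input β N pos G P) σ) : noiseExpr.eval α σ = N := by
  simp [noiseExpr, RealExpr.eval, NatExpr.eval, hσ.2 2 (by simp), input]

lemma attExpr_eval (hσ : SameInput (input β N pos G P) σ) {x y : Fin n} (hi : i.eval σ = x)
    (hj : j.eval σ = y) : (attExpr i j).eval α σ = dist (pos x) (pos y) ^ α := by
  rw [attExpr, RealExpr.eval, RealExpr.eval, hi, hj, hσ.2 0 (by simp), input_real_dist,
    abs_of_nonneg dist_nonneg]

lemma affExpr_eval (hσ : SameInput (input β N pos G P) σ) (hi : i.eval σ = u.1)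
    (hj : j.eval σ = u.2) (hk : k.eval σ = v.1) (hl : l.eval σ = v.2) :
    (affExpr i j k l).eval α σ = aff α β N pos P u v := by
  simp only [affExpr, slackExpr, RealExpr.eval, thresholdExpr_eval hσ, noiseExpr_eval hσ,
    attExpr_eval hσ hi hl, attExpr_eval hσ hk hl, hi, hj, hk, hl, hσ.2 1 (by simp),
    input_real_power]
  rfl

lemma availableCond_eval (hσ : SameInput (input β N pos G P) σ) (h22 : σ.nat 22 0 0 = v.1)
    (h23 : σ.nat 23 0 0 = v.2) : availableCond.eval α σ ↔ G.Adj v.1 v.2 := by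
  rw [availableCond, natEq_eval, NatExpr.eval, NatExpr.eval, cell_eval, cell_eval, h22, h23,
    hσ.1 1 (by simp), input_nat_adj]

lemma fixedCond_eval (hσ : SameInput (input β N pos G P) σ) (h22 : σ.nat 22 0 0 = v.1)
    (h23 : σ.nat 23 0 0 = v.2) :
    fixedCond.eval α σ ↔ G.Adj v.1 v.2 ∧ β * N * len pos v ^ α ≤ P v := by
  rw [fixedCond, Cond.eval, availableCond_eval hσ h22 h23]
  rw [← cell_eval] at h22 h23
  rw [Cond.eval, RealExpr.eval, RealExpr.eval, RealExpr.eval, thresholdExpr_eval hσ,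
    noiseExpr_eval hσ, attExpr_eval hσ h22 h23, h22, h23, hσ.2 1 (by simp), input_real_power, len]

lemma nearExpr_eval (hσ : SameInput (input β N pos G P) σ) (h10 : σ.nat 10 0 0 = u.1)
    (h11 : σ.nat 11 0 0 = u.2) (h22 : σ.nat 22 0 0 = v.1) (h23 : σ.nat 23 0 0 = v.2) {x y : Fin n}
    (hi : i.eval σ = x) (hj : j.eval σ = y) :
    (nearExpr i j).eval α σ = near α pos (harm α pos u v) x y := by
  rw [← cell_eval] at h10 h11 h22 h23
  rw [nearExpr, RealExpr.eval, RealExpr.eval, harmExpr, RealExpr.eval, RealExpr.eval,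
    RealExpr.eval, attExpr_eval hσ h10 h11, attExpr_eval hσ h22 h23, attExpr_eval hσ hi hj]
  rfl

lemma describes_fixedRule (α β N : ℝ) (pos : Fin n → X) (G : SimpleGraph (Fin n))
    (P : Fin n × Fin n → ℝ) :
    Describes α (input β N pos G P) (fixedRule α β N pos G P) fixedCond fixedConflictExpr where
  size := input_nat_size
  len _ := input_real_dist ..
  usable _ hσ _ := fixedCond_eval hσ
  conflict σ hσ u v h10 h11 h22 h23 := by
    rw [← cell_eval] at h10 h11 h22 h23
    rw [fixedConflictExpr, RealExpr.eval, affExpr_eval hσ h10 h11 h22 h23,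
      affExpr_eval hσ h22 h23 h10 h11, fixedRule]

lemma describes_globalRule (α β N : ℝ) (pos : Fin n → X) (G : SimpleGraph (Fin n))
    (P : Fin n × Fin n → ℝ) (K : ℕ) :
    Describes α (input β N pos G P) (globalRule α pos G K) availableCond globalConflictExpr where
  size := input_nat_size
  len _ := input_real_dist ..
  usable _ hσ _ := availableCond_eval hσ
  conflict σ hσ u v h10 h11 h22 h23 := by
    have hnear {i j : NatExpr} {x y : Fin n} : i.eval σ = x → j.eval σ = y →
        (nearExpr i j).eval α σ = near α pos (harm α pos u v) x y :=
      nearExpr_eval hσ h10 h11 h22 h23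
    rw [← cell_eval] at h10 h11 h22 h23
    rw [globalConflictExpr, RealExpr.eval, RealExpr.eval, RealExpr.eval, hnear h10 h22,
      hnear h10 h23, hnear h11 h22, hnear h11 h23, globalRule]

end Input

section Output

variable {n : ℕ} {F : Finset (Fin n × Fin n)} {c : Sym2 (Fin n) → ℕ} {k : ℕ} {τ : Memory}

lemma HoldsTree.outputsTree (h : HoldsTree F c k τ) (hF : IsForestOver ∅ F) :
    OutputsTree τ (linkGraph F) c k := by
  refine ⟨fun x y => linkGraph_adj.trans (Iff.trans ?_ (h.adj (x, y)).symm),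
    fun x y _ => h.color (x, y), h.count⟩
  refine and_iff_right_of_imp fun hxy => ?_
  have hadj {v : Fin n × Fin n} (hv : v ∈ F) : (linkGraph F).Adj v.1 v.2 :=
    (linkGraph_isOrientation hF).1 _ _ hv
  exact hxy.elim (fun h => (hadj h).ne) fun h => (hadj h).ne'

lemma HoldsTree.outputsLinks (h : HoldsTree F c k τ) : OutputsLinks τ F :=
  fun x y => (h.link (x, y)).symm

lemma run_mainProg_input {X : Type*} [MetricSpace X] {α β N : ℝ} {pos : Fin n → X}
    {G : SimpleGraph (Fin n)} {P : Fin n × Fin n → ℝ} {R : Rule (Fin n)} {ok : Cond} {W : RealExpr}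
    (hD : Describes α (input β N pos G P) R ok W) :
    Run α n (mainProg R.K ok W) (input β N pos G P) fun τ => ∃ F c k, R.IsSchedule F c k n ∧
      OutputsTree τ (linkGraph F) c k ∧ OutputsLinks τ F := by
  refine (run_mainProg hD fun A hA => input_nat_eq_zero ?_).mono
    fun τ _ ⟨F, c, k, hF, hτ⟩ => ⟨F, c, k, hF, hτ.outputsTree hF.isForestOver, hτ.outputsLinks⟩
  simp only [mem_insert, mem_singleton] at hA
  omega

end Output

end RealRAM

/-! ### Optimal schedules and schedules of the greedy rule -/

namespace ConnSched

open Finset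

variable {V : Type*} {G T : SimpleGraph V} {c : Sym2 V → ℕ} {k i : ℕ} {D F : Finset (V × V)}
  {e : V × V}

lemma IsColoredSpanningTree.adj_of_mem_slot (h : IsColoredSpanningTree G T c k)
    (hD : IsOrientation T D) (he : e ∈ slot D c i) : G.Adj e.1 e.2 :=
  h.le (hD.1 _ _ (mem_filter.1 he).1)

lemma IsOrientation.swap_notMem (hD : IsOrientation T D) (he : e ∈ D) : e.swap ∉ D :=
  (hD.2 _ _ (hD.1 _ _ he)).1 he

variable [DecidableEq V]

/-- The one of the links `e` and `e.swap` which is in `F`, if there is one. -/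
def redirect (F : Finset (V × V)) (e : V × V) : V × V := if e ∈ F then e else e.swap

lemma redirect_eq_or_eq_swap (F : Finset (V × V)) (e : V × V) :
    redirect F e = e ∨ redirect F e = e.swap :=
  ite_eq_or_eq ..

lemma IsOrientation.redirect_mem (hF : IsOrientation T F) (he : T.Adj e.1 e.2) :
    redirect F e ∈ F := by
  unfold redirect
  split_ifs with hmem
  · exact hmem
  · exact (hF.2 _ _ he.symm).2 hmem

lemma IsOrientation.injOn_redirect (hD : IsOrientation T D) : Set.InjOn (redirect F) D := by
  intro e he f hf hef
  have hne : e ≠ f.swap := fun h => hD.swap_notMem hf (h ▸ he)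
  rcases redirect_eq_or_eq_swap F e with h | h <;>
    rcases redirect_eq_or_eq_swap F f with h' | h' <;>
    rw [h, h'] at hef
  · exact hef
  · exact absurd hef hne
  · exact absurd (e.swap_swap.symm.trans (congrArg Prod.swap hef)) hne
  · exact Prod.swap_injective hef

lemma IsOrientation.redirect_mem_slot (hF : IsOrientation T F) (hD : IsOrientation T D)
    (he : e ∈ slot D c i) : redirect F e ∈ slot F c i := by
  obtain ⟨heD, rfl⟩ := mem_filter.1 he
  refine mem_filter.2 ⟨hF.redirect_mem (hD.1 _ _ heD), ?_⟩
  rcases redirect_eq_or_eq_swap F e with h | h <;> rw [h]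
  exact congrArg c Sym2.eq_swap

lemma IsColoredSpanningTree.joined (h : IsColoredSpanningTree G T c k) (hD : IsOrientation T D)
    (x y : V) : Joined ((range k).biUnion (slot D c)) x y := by
  have hmem {e : V × V} (he : e ∈ D) : e ∈ (range k).biUnion (slot D c) :=
    mem_biUnion.2 ⟨_, mem_range.2 (h.color_lt s(e.1, e.2) (hD.1 _ _ he)), mem_filter.2 ⟨he, rfl⟩⟩
  refine (h.isTree.connected.preconnected x y).mono fun u v huv => linkGraph_adj.2 ⟨huv.ne, ?_⟩
  by_cases hv : (v, u) ∈ D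
  · exact .inr (hmem hv)
  · exact .inl (hmem ((hD.2 u v huv).2 hv))

lemma Rule.load_le_of_injOn {R : Rule V} {S S' : Finset (V × V)} {f : V × V → V × V}
    (hnonneg : ∀ u v, 0 ≤ R.conflict u v) (hf : ∀ u v, R.conflict (f u) (f v) = R.conflict u v)
    (hmaps : ∀ v ∈ S, f v ∈ S') (hinj : Set.InjOn f S) (he : e ∈ S) :
    R.load S e ≤ R.load S' (f e) := by
  calc R.load S e
      = ∑ u ∈ S.erase e, R.conflict (f u) (f e) := sum_congr rfl fun u _ => (hf u e).symm
    _ = ∑ u ∈ (S.erase e).image f, R.conflict u (f e) :=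
        (sum_image (g := f) (f := fun u => R.conflict u (f e))
          (hinj.mono (coe_subset.2 (erase_subset ..)))).symm
    _ ≤ R.load S' (f e) := by
        refine sum_le_sum_of_subset_of_nonneg (fun u hu => ?_) fun u _ _ => hnonneg u _
        obtain ⟨v, hv, rfl⟩ := mem_image.1 hu
        obtain ⟨hne, hvS⟩ := mem_erase.1 hv
        exact mem_erase.2 ⟨hinj.ne hvS he hne, hmaps v hvS⟩

variable {X : Type*} [MetricSpace X] {α β N : ℝ} {pos : V → X} {P : V × V → ℝ} {χ : ℕ}

lemma FixedSchedulable.nonempty (h : FixedSchedulable α β N pos G P χ) : Nonempty V := by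
  obtain ⟨T, c, D, hT, -⟩ := h
  exact hT.isTree.connected.nonempty

lemma GlobalSchedulable.nonempty (h : GlobalSchedulable α β N pos G χ) : Nonempty V := by
  obtain ⟨T, c, D, hT, -⟩ := h
  exact hT.isTree.connected.nonempty

lemma FixedSchedulable.coverable_fixedRule (h : FixedSchedulable α β N pos G P χ) (hα : 0 < α)
    (hβ : 1 ≤ β) (hN : 0 ≤ N) (hpos : Function.Injective pos)
    (hP : SINR.IsMonotonePower α pos G P) :
    (SINR.fixedRule α β N pos G P).Coverable (2 * (1 + 3 * 3 ^ α)) χ := by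
  obtain ⟨T, c, D, hT, hD, hfeas⟩ := h
  exact ⟨slot D c, hT.joined hD, fun i hi O hO =>
    ((hfeas i hi).mono hO).exists_large_fixedRule_conflict_le hα hβ hN hpos hP
      fun v hv => hT.adj_of_mem_slot hD (hO hv)⟩

lemma GlobalSchedulable.coverable_globalRule (h : GlobalSchedulable α β N pos G χ) (hα : 0 < α)
    (hβ : 1 ≤ β) (hN : 0 ≤ N) (hpos : Function.Injective pos) (K : ℕ) :
    (SINR.globalRule α pos G K).Coverable (4 * (1 + 3 * 3 ^ α)) χ := by
  obtain ⟨T, c, D, hT, hD, hfeas⟩ := h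
  refine ⟨slot D c, hT.joined hD, fun i hi O hO => ?_⟩
  obtain ⟨P, hP⟩ := hfeas i hi
  exact (hP.mono hO).exists_large_globalRule_conflict_le hα hβ hN hpos
    fun v hv => hT.adj_of_mem_slot hD (hO hv)

end ConnSched

namespace SINR

open Finset ConnSched

variable {V X : Type*} [Finite V] [DecidableEq V] [MetricSpace X] {α β N : ℝ} {pos : V → X}
  {G : SimpleGraph V} {P : V × V → ℝ} {F D : Finset (V × V)} {c : Sym2 V → ℕ} {k r K i χ : ℕ}

lemma fixedRule_exists_dual_feasible (hα : 0 < α) (hβ : 0 < β) (hN : 0 ≤ N)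
    (hpos : Function.Injective pos) (hP : IsMonotonePower α pos G P)
    (hF : (fixedRule α β N pos G P).IsSchedule F c k r) :
    ∃ κ : ℝ, 0 < κ ∧ ∀ i < k, Feasible α β N pos P (slot F c i) ∧
      Feasible α β N pos (dualPower α κ pos P) (reversed (slot F c i)) := by
  obtain ⟨M, hM⟩ := Finite.exists_le fun e => 2 * β * N * P e
  refine ⟨max 1 M, by positivity, fun i hi => ?_⟩
  obtain ⟨E, hE⟩ := hF.isRound hi
  have hload : ∀ v ∈ slot F c i, (fixedRule α β N pos G P).load (slot F c i) v ≤ 1 / 4 := by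
    intro v hv
    have h : ((16 : ℕ) : ℝ) * (fixedRule α β N pos G P).load (slot F c i) v ≤ 4 :=
      hE.mul_load_le (fixedRule_valid hβ.le hpos hP) hv
    push_cast at h
    linarith
  obtain ⟨hfeas, hdual⟩ := feasible_of_fixedRule_load_le hα hβ hN hpos hP
    (fun v hv => hE.usable hv) hload
  exact ⟨hfeas, hdual _ (by positivity) fun v _ => (hM v).trans (le_max_right ..)⟩

lemma globalRule_exists_feasible (hα : 0 < α) (hβ : 1 ≤ β) (hN : 0 ≤ N)
    (hpos : Function.Injective pos) (hK : 512 * β ^ 2 * 3 ^ α ≤ K)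
    (hF : (globalRule α pos G K).IsSchedule F c k r) (hD : IsOrientation (linkGraph F) D)
    (hi : i < k) : ∃ P, Feasible α β N pos P (slot D c i) := by
  obtain ⟨E, hE⟩ := hF.isRound hi
  have hFF := linkGraph_isOrientation hF.isForestOver
  have hmem {v : V × V} (hv : v ∈ slot D c i) : redirect F v ∈ slot F c i :=
    hFF.redirect_mem_slot hD hv
  have hconflict (u v : V × V) : (globalRule α pos G K).conflict (redirect F u) (redirect F v) =
      (globalRule α pos G K).conflict u v := by
    rcases redirect_eq_or_eq_swap F u with h | h <;>
      rcases redirect_eq_or_eq_swap F v with h' | h' <;>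
      simp only [h, h', globalRule_conflict_swap_left, globalRule_conflict_swap_right]
  refine exists_feasible_of_globalRule_load_le (G := G) hα hβ hN hpos hK (fun v hv => ?_)
    fun v hv => ?_
  · have hadj : G.Adj (redirect F v).1 (redirect F v).2 := hE.usable (hmem hv)
    rcases redirect_eq_or_eq_swap F v with h | h <;> rw [h] at hadj
    exacts [hadj, hadj.symm]
  · refine le_trans ?_ (hE.mul_load_le globalRule_valid (hmem hv))
    exact mul_le_mul_of_nonneg_left (Rule.load_le_of_injOn globalRule_conflict_nonneg hconflict
      (fun v hv => hmem hv) (hD.injOn_redirect.mono (coe_subset.2 (filter_subset ..))) hv)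
      (Nat.cast_nonneg K)

theorem fixedRule_approximates (hα : 0 < α) (hβ : 1 ≤ β) (hN : 0 ≤ N)
    (hpos : Function.Injective pos) (hP : IsMonotonePower α pos G P)
    (hF : (fixedRule α β N pos G P).IsSchedule F c k r) (hr : Nat.card V ≤ r)
    (hχ : FixedSchedulable α β N pos G P χ) :
    IsColoredSpanningTree G (linkGraph F) c k ∧ 2 * (k : ℝ) ≤
      2 * (4 * (1 + 16 * (2 * (1 + 3 * 3 ^ α))) + 2) * Real.log (Nat.card V) * χ := by
  have := hχ.nonempty
  have hR := fixedRule_valid (N := N) (zero_le_one.trans hβ) hpos hP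
  have hcov := hχ.coverable_fixedRule hα hβ hN hpos hP
  have hk : (k : ℝ) ≤ (4 * (1 + (16 : ℕ) * (2 * (1 + 3 * 3 ^ α))) + 2) *
      Real.log (Nat.card V) * χ := hF.natCast_le_mul_log hR (by positivity) hcov
  refine ⟨hF.isColoredSpanningTree hR (fun v hv => hv.1) (by positivity) hcov hr, ?_⟩
  push_cast at hk
  linarith

theorem globalRule_approximates (hα : 0 < α) (hβ : 1 ≤ β) (hN : 0 ≤ N)
    (hpos : Function.Injective pos) (hF : (globalRule α pos G K).IsSchedule F c k r)
    (hr : Nat.card V ≤ r) (hχ : GlobalSchedulable α β N pos G χ) :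
    IsColoredSpanningTree G (linkGraph F) c k ∧ (k : ℝ) ≤
      (4 * (1 + K * (4 * (1 + 3 * 3 ^ α))) + 2) * Real.log (Nat.card V) * χ := by
  have := hχ.nonempty
  have hcov := hχ.coverable_globalRule hα hβ hN hpos K
  exact ⟨hF.isColoredSpanningTree globalRule_valid (fun v hv => hv) (by positivity) hcov hr,
    hF.natCast_le_mul_log globalRule_valid (by positivity) hcov⟩

end SINR

theorem mainTheorem5 (α β : ℝ) (hα : 0 < α) (hβ : 1 ≤ β) :
    -- fixed monotone power assignments
    (∃ (C : ℝ) (prog : RealRAM.Program) (q : Polynomial ℕ),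
      ∀ (n : ℕ) (X : Type*) [MetricSpace X] (pos : Fin n → X), Function.Injective pos →
      ∀ (G : SimpleGraph (Fin n)) (N : ℝ), 0 ≤ N →
      ∀ P : Fin n × Fin n → ℝ, SINR.IsMonotonePower α pos G P →
      ∃ (τ : RealRAM.Memory) (t : ℕ),
        RealRAM.Exec α prog (RealRAM.input β N pos G P) τ t ∧ t ≤ q.eval n ∧
        ∀ χ : ℕ, IsLeast {k | ConnSched.FixedSchedulable α β N pos G P k} χ →
          ∃ (T : SimpleGraph (Fin n)) (color : Sym2 (Fin n) → ℕ) (D : Finset (Fin n × Fin n))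
            (k : ℕ) (κ : ℝ),
            RealRAM.OutputsTree τ T color k ∧ RealRAM.OutputsLinks τ D ∧
            ConnSched.IsColoredSpanningTree G T color k ∧ ConnSched.IsOrientation T D ∧
            0 < κ ∧
            (∀ i < k, SINR.Feasible α β N pos P (ConnSched.slot D color i) ∧
              SINR.Feasible α β N pos (SINR.dualPower α κ pos P)
                (ConnSched.reversed (ConnSched.slot D color i))) ∧
            2 * (k : ℝ) ≤ C * Real.log n * χ) ∧
    -- global power control
    (∃ (C : ℝ) (prog : RealRAM.Program) (q : Polynomial ℕ),
      ∀ (n : ℕ) (X : Type*) [MetricSpace X] (pos : Fin n → X), Function.Injective pos →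
      ∀ (G : SimpleGraph (Fin n)) (N : ℝ), 0 ≤ N →
      ∃ (τ : RealRAM.Memory) (t : ℕ),
        RealRAM.Exec α prog (RealRAM.input β N pos G 0) τ t ∧ t ≤ q.eval n ∧
        ∀ χ : ℕ, IsLeast {k | ConnSched.GlobalSchedulable α β N pos G k} χ →
          ∃ (T : SimpleGraph (Fin n)) (color : Sym2 (Fin n) → ℕ) (k : ℕ),
            RealRAM.OutputsTree τ T color k ∧
            ConnSched.IsColoredSpanningTree G T color k ∧
            (∀ D : Finset (Fin n × Fin n), ConnSched.IsOrientation T D →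
              ∀ i < k, ∃ Q : Fin n × Fin n → ℝ,
                SINR.Feasible α β N pos Q (ConnSched.slot D color i)) ∧
            (k : ℝ) ≤ C * Real.log n * χ) := by
  constructor
  · set prog := RealRAM.mainProg 16 RealRAM.fixedCond RealRAM.fixedConflictExpr
    obtain ⟨q, hq⟩ := prog.exists_polynomial
    refine ⟨2 * (4 * (1 + 16 * (2 * (1 + 3 * 3 ^ α))) + 2), prog, q,
      fun n X _ pos hpos G N hN P hP => ?_⟩
    obtain ⟨τ, t, hexec, ht, F, c, k, hF, hT, hL⟩ :=
      RealRAM.run_mainProg_input (RealRAM.describes_fixedRule α β N pos G P)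
    refine ⟨τ, t, hexec, ht.trans (hq n).le, fun χ hχ => ?_⟩
    obtain ⟨htree, hk⟩ :=
      SINR.fixedRule_approximates hα hβ hN hpos hP hF (Nat.card_fin n).le hχ.1
    obtain ⟨κ, hκ, hfeas⟩ :=
      SINR.fixedRule_exists_dual_feasible hα (zero_lt_one.trans_le hβ) hN hpos hP hF
    rw [Nat.card_fin] at hk
    exact ⟨_, c, F, k, κ, hT, hL, htree, ConnSched.linkGraph_isOrientation hF.isForestOver, hκ,
      hfeas, hk⟩
  · obtain ⟨K, hK⟩ := exists_nat_ge (512 * β ^ 2 * 3 ^ α)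
    set prog := RealRAM.mainProg K RealRAM.availableCond RealRAM.globalConflictExpr
    obtain ⟨q, hq⟩ := prog.exists_polynomial
    refine ⟨4 * (1 + K * (4 * (1 + 3 * 3 ^ α))) + 2, prog, q, fun n X _ pos hpos G N hN => ?_⟩
    obtain ⟨τ, t, hexec, ht, F, c, k, hF, hT, -⟩ :=
      RealRAM.run_mainProg_input (RealRAM.describes_globalRule α β N pos G 0 K)
    refine ⟨τ, t, hexec, ht.trans (hq n).le, fun χ hχ => ?_⟩
    obtain ⟨htree, hk⟩ := SINR.globalRule_approximates hα hβ hN hpos hF (Nat.card_fin n).le hχ.1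
    rw [Nat.card_fin] at hk
    exact ⟨_, c, k, hT, htree,
      fun D hD i hi => SINR.globalRule_exists_feasible hα hβ hN hpos hK hF hD hi, hk⟩
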